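/- Let $k_e,k_h,k_f\ge 0$, $n=k_e+k_h+2k_f$, and consider on $\mathbb R^{2n}$, with coordinates $(x_1,y_1,\dots,x_n,y_n)$, the linear system given by $\omega=\sum_i dx_i\wedge dy_i$ and the quadratic moment map $\mathbf h=(h_1,\dots,h_n)$, where $h_i=x_i^2+y_i^2$ for $i\le k_e$, $h_i=x_iy_i$ for $k_e<i\le k_e+k_h$, and $h_i=x_iy_{i+1}-x_{i+1}y_i$, $h_{i+1}=x_iy_i+x_{i+1}y_{i+1}$ for $i=k_e+k_h+2j-1$, $1\le j\le k_f$. For a local diffeomorphism $\psi$ of $(\mathbb R^{2n},0)$ write $\psi^{(1)}=d_0\psi$, and for a function $f$ let $X_f$ be its Hamiltonian vector field, $\omega(X_f,\cdot)=df$. A map preserves the system if it preserves $\omega$ and $\mathbf h$. Let $G$ be a compact Lie group. Below, $C^r$ means either $C^\infty$ throughout or real analytic throughout. (a) Let $\rho$ be a $C^r$ local action of $G$ on $(\mathbb R^{2n},0)$, defined near the fixed point $0$ and preserving the system. For $g\in G$ and $t\in[0,1]$ put $R^g_t(z)=\rho(g)^{(1)}\big(\tfrac1t\,\rho(g)^{-1}(tz)\big)$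 for $t\neq0$ and $R^g_0=\mathrm{id}$, and let $X^g_t$ be the vector field near $0$ with $X^g_t\circ R^g_t=\frac{d}{dt}R^g_t$. Then on some connected open neighbourhood $V$ of $0$, independent of $g$, there are functions $\Psi(g)$, jointly $C^r$ on $G\times V$, with $\Psi(g)(0)=0$ and $X_{\Psi(g)}=\int_0^1X^g_t\,dt$; they are first integrals of the system, and near $0$ (uniformly in $g$) the time-$1$ map of $X_{\Psi(g)}$ is $\rho(g)^{(1)}\circ\rho(g)^{-1}$. Let $\mu$ be the normalized Haar measure of $G$. The averaged vector field $X_G=\int_GX_{\Psi(g)}\,d\mu(g)$ is the Hamiltonian vector field of $\int_G\Psi(g)\,d\mu(g)$ on $V$, and its time-$1$ map $\Phi_G$ is defined on a $G$-invariant open neighbourhood $V'\subset V$ of $0$, is a $C^r$ diffeomorphism of $V'$ onto an open set, fixes $0$, preserves the system, and linearizes the action: $$\Phi_G\circ\rho(g)=\rho(g)^{(1)}\circ\Phi_G\quad\text{on }V'\text{ for all }g\in G.$$ Moreover $g\mapsto\rho(g)^{(1)}$ is a linear action of $G$ on $\mathbb R^{2n}$ preserving the system. (b) Let $D\subset\mathbb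 R^m$ be an open disk centred at $0$, and let $\rho_p$, $p\in D$, be a family of local actions of $G$ on $(\mathbb R^{2n},0)$ preserving the system, defined on an open neighbourhood of $D\times\{0\}$ in $D\times\mathbb R^{2n}$ and jointly $C^r$ in $p$, in the group element and in the point. Then there are an open neighbourhood $W'$ of $D\times\{0\}$ in that neighbourhood and a map $\Phi_p(z)$, jointly $C^r$ in $(p,z)\in W'$, such that for every $p\in D$ the slice $W'_p=\{z:(p,z)\in W'\}$ is invariant under $\rho_p$, $\Phi_p$ is a $C^r$ diffeomorphism of $W'_p$ onto an open set, fixes $0$, preserves the system, and $$\Phi_p\circ\rho_p(g)=\rho_0(g)^{(1)}\circ\Phi_p\quad\text{on }W'_p\text{ for all }g\in G.$$ Moreover $g\mapsto\rho_0(g)^{(1)}$ is a linear action of $G$ on $\mathbb R^{2n}$ preserving the system. -/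

import Mathlib

open Set MeasureTheory
open scoped Manifold ContDiff

namespace LinearSystem

/-- Labels of the `n = ke + kh + 2 * kf` degrees of freedom: `ke` elliptic ones, `kh` hyperbolic
ones, and `kf` focus-focus pairs (each pair being indexed by `Fin 2`). -/
abbrev Idx (ke kh kf : ℕ) : Type := Fin ke ⊕ Fin kh ⊕ (Fin kf × Fin 2)

/-- The phase space `ℝ²ⁿ`; a point `z` has coordinates `x = z.1` and `y = z.2`. -/
abbrev Phase (ke kh kf : ℕ) : Type := (Idx ke kh kf → ℝ) × (Idx ke kh kf → ℝ)

variable {ke kh kf : ℕ}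

/-- The standard symplectic form `∑ dxᵢ ∧ dyᵢ`. -/
def omega (u v : Phase ke kh kf) : ℝ := ∑ i, (u.1 i * v.2 i - u.2 i * v.1 i)

/-- The quadratic moment map `h = (h₁, …, hₙ)` of Williamson type `(ke, kh, kf)`. -/
def momentMap (z : Phase ke kh kf) : Idx ke kh kf → ℝ
  | .inl i => z.1 (.inl i) ^ 2 + z.2 (.inl i) ^ 2
  | .inr (.inl i) => z.1 (.inr (.inl i)) * z.2 (.inr (.inl i))
  | .inr (.inr (j, 0)) =>
      z.1 (.inr (.inr (j, 0))) * z.2 (.inr (.inr (j, 1)))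
        - z.1 (.inr (.inr (j, 1))) * z.2 (.inr (.inr (j, 0)))
  | .inr (.inr (j, 1)) =>
      z.1 (.inr (.inr (j, 0))) * z.2 (.inr (.inr (j, 0)))
        + z.1 (.inr (.inr (j, 1))) * z.2 (.inr (.inr (j, 1)))

/-- The Hamiltonian vector field `X_f = ∑ (∂f/∂yᵢ) ∂/∂xᵢ - (∂f/∂xᵢ) ∂/∂yᵢ`, i.e. the vector field
with `ω(X_f, ·) = df`. -/
noncomputable def hamVF (f : Phase ke kh kf → ℝ) (z : Phase ke kh kf) : Phase ke kh kf :=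
  (fun i => fderiv ℝ f z (0, Pi.single i 1), fun i => - fderiv ℝ f z (Pi.single i 1, 0))

/-- The linear part `ψ⁽¹⁾ = d₀ψ` of `ψ` at the origin. -/
noncomputable def linearPart (ψ : Phase ke kh kf → Phase ke kh kf) :
    Phase ke kh kf →L[ℝ] Phase ke kh kf :=
  fderiv ℝ ψ 0

/-- `φ` preserves the system `(ω, h)` on the set `U`. -/
def PreservesSystem (φ : Phase ke kh kf → Phase ke kh kf) (U : Set (Phase ke kh kf)) : Prop :=
  (∀ z ∈ U, ∀ u v, omega (fderiv ℝ φ z u) (fderiv ℝ φ z v) = omega u v) ∧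
    ∀ z ∈ U, momentMap (φ z) = momentMap z

/-- `φ` is a local symplectic variable transformation at the origin, preserving the system, of
class `C^r` and with domain `V`: a `C^r` diffeomorphism of the open neighbourhood `V` of `0` onto
an open set, with `φ(0) = 0`, `φ^*ω = ω` and `h ∘ φ = h`. -/
structure IsSystemAutomorphism (r : ℕ∞ω) (φ : Phase ke kh kf → Phase ke kh kf)
    (V : Set (Phase ke kh kf)) : Prop where
  isOpen : IsOpen V
  zero_mem : (0 : Phase ke kh kf) ∈ V
  map_zero : φ 0 = 0
  contDiffOn : ContDiffOn ℝ r φ V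
  diffeo : ∃ e : OpenPartialHomeomorph (Phase ke kh kf) (Phase ke kh kf),
    e.source = V ∧ (∀ z ∈ V, e z = φ z) ∧ ContDiffOn ℝ r e.symm e.target
  preserves : PreservesSystem φ V

section Action

variable {d : ℕ} {G : Type*} [Group G] [TopologicalSpace G]
  [ChartedSpace (EuclideanSpace ℝ (Fin d)) G]

/-- A `C^r` local action of `G` on `(ℝ²ⁿ, 0)` preserving the system, given on the open
neighbourhood `U` of the origin (which need not be `G`-invariant). -/
structure IsLocalAction (r : ℕ∞ω) (ρ : G → Phase ke kh kf → Phase ke kh kf)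
    (U : Set (Phase ke kh kf)) : Prop where
  isOpen : IsOpen U
  zero_mem : (0 : Phase ke kh kf) ∈ U
  contMDiffOn : ContMDiffOn ((𝓡 d).prod 𝓘(ℝ, Phase ke kh kf)) 𝓘(ℝ, Phase ke kh kf) r
    (fun q : G × Phase ke kh kf => ρ q.1 q.2) (univ ×ˢ U)
  map_zero : ∀ g, ρ g 0 = 0
  one : ∀ z ∈ U, ρ 1 z = z
  mul : ∀ g k, ∀ z ∈ U, ρ k z ∈ U → ρ (g * k) z = ρ g (ρ k z)
  preserves : ∀ g, PreservesSystem (ρ g) U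

/-- A family `ρ_p` of system-preserving local actions on `(ℝ²ⁿ, 0)` depending in a `C^r` way on the
parameter `p` in the open disk of radius `ε` centred at `0` in `ℝᵐ`. The family is given on an open
neighbourhood `W` of `disk × {0}` in `disk × ℝ²ⁿ`. -/
structure IsLocalActionFamily {m : ℕ} (r : ℕ∞ω)
    (ρ : EuclideanSpace ℝ (Fin m) → G → Phase ke kh kf → Phase ke kh kf) (ε : ℝ)
    (W : Set (EuclideanSpace ℝ (Fin m) × Phase ke kh kf)) : Prop where
  isOpen : IsOpen W
  subset : W ⊆ Metric.ball 0 ε ×ˢ univ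
  contMDiffOn : ContMDiffOn
    (𝓘(ℝ, EuclideanSpace ℝ (Fin m)).prod ((𝓡 d).prod 𝓘(ℝ, Phase ke kh kf)))
    𝓘(ℝ, Phase ke kh kf) r
    (fun q : EuclideanSpace ℝ (Fin m) × (G × Phase ke kh kf) => ρ q.1 q.2.1 q.2.2)
    {q | (q.1, q.2.2) ∈ W}
  action : ∀ p ∈ Metric.ball (0 : EuclideanSpace ℝ (Fin m)) ε,
    IsLocalAction (d := d) r (ρ p) {z | (p, z) ∈ W}

end Action

section Path

variable {G : Type*} [Group G]

/-- The path `S_t^ψ(z) = ψ(t z) / t`, with `S_0^ψ = ψ⁽¹⁾`. -/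
noncomputable def contraction (ψ : Phase ke kh kf → Phase ke kh kf) (t : ℝ)
    (z : Phase ke kh kf) : Phase ke kh kf :=
  if t = 0 then linearPart ψ z else t⁻¹ • ψ (t • z)

/-- The path `R_t = ρ(g)⁽¹⁾ ∘ S_t^{ρ(g)⁻¹}` from the identity (`t = 0`) to
`ρ(g)⁽¹⁾ ∘ ρ(g)⁻¹` (`t = 1`). -/
noncomputable def pathMap (ρ : G → Phase ke kh kf → Phase ke kh kf) (g : G) (t : ℝ)
    (z : Phase ke kh kf) : Phase ke kh kf :=
  linearPart (ρ g) (contraction (ρ g⁻¹) t z)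

/-- The local inverse `R_t⁻¹ = S_t^{ρ(g)} ∘ (ρ(g)⁻¹)⁽¹⁾` of `R_t`. -/
noncomputable def pathInv (ρ : G → Phase ke kh kf → Phase ke kh kf) (g : G) (t : ℝ)
    (z : Phase ke kh kf) : Phase ke kh kf :=
  contraction (ρ g) t (linearPart (ρ g⁻¹) z)

/-- The time-dependent vector field `X_t` with `X_t ∘ R_t = dR_t/dt`, i.e.
`X_t(z) = d/ds|_{s = t} R_s(R_t⁻¹(z))`. -/
noncomputable def pathField (ρ : G → Phase ke kh kf → Phase ke kh kf) (g : G) (t : ℝ)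
    (z : Phase ke kh kf) : Phase ke kh kf :=
  deriv (fun s => pathMap ρ g s (pathInv ρ g t z)) t

/-- `Φ` is, on `V'`, the time-one map of the vector field `X` on `V`: the integral curve of `X`
through each point of `V'` exists in `V` up to time one, and ends at the value of `Φ`. -/
def IsTimeOneMap (X : Phase ke kh kf → Phase ke kh kf) (V V' : Set (Phase ke kh kf))
    (Φ : Phase ke kh kf → Phase ke kh kf) : Prop :=
  ∀ z ∈ V', ∃ γ : ℝ → Phase ke kh kf, γ 0 = z ∧ γ 1 = Φ z ∧ (∀ t ∈ Icc (0 : ℝ) 1, γ t ∈ V) ∧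
    IsIntegralCurveOn γ (fun _ => X) (Icc 0 1)

/-- The average `X_G = ∫_G X_{Ψ(g)} dμ(g)`. -/
noncomputable def averagedField [MeasurableSpace G] (μ : Measure G)
    (Ψ : G → Phase ke kh kf → ℝ) (z : Phase ke kh kf) : Phase ke kh kf :=
  ∫ g, hamVF (Ψ g) z ∂μ

end Path

/-- `Ψ(g)`, for `g ∈ G`, are the generating Hamiltonians on `V` of the local action `ρ` with
domain `U`: the functions with `Ψ(g)(0) = 0` and `X_{Ψ(g)} = ∫₀¹ X_t dt`, where `X_t` generates the
path `R_t` from the identity to `ρ(g)⁽¹⁾ ∘ ρ(g)⁻¹`. They are first integrals of the system and are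
of class `C^r` on `G × V`. The fields `mem`, `path_inv`, `differentiableAt` and `continuousOn` say
that `R_t`, `R_t⁻¹`, `X_t` and the integral are well defined on `V`. -/
structure IsGeneratingFamily {d : ℕ} {G : Type*} [Group G] [TopologicalSpace G]
    [ChartedSpace (EuclideanSpace ℝ (Fin d)) G] (r : ℕ∞ω)
    (ρ : G → Phase ke kh kf → Phase ke kh kf) (U V : Set (Phase ke kh kf))
    (Ψ : G → Phase ke kh kf → ℝ) : Prop where
  isOpen : IsOpen V
  isConnected : IsConnected V
  zero_mem : (0 : Phase ke kh kf) ∈ V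
  subset : V ⊆ U
  mem : ∀ g, ∀ t ∈ Icc (0 : ℝ) 1, ∀ z ∈ V,
    t • linearPart (ρ g⁻¹) z ∈ U ∧ t • pathInv ρ g t z ∈ U
  path_inv : ∀ g, ∀ t ∈ Icc (0 : ℝ) 1, ∀ z ∈ V, pathMap ρ g t (pathInv ρ g t z) = z
  differentiableAt : ∀ g, ∀ t ∈ Icc (0 : ℝ) 1, ∀ z ∈ V,
    DifferentiableAt ℝ (fun s => pathMap ρ g s (pathInv ρ g t z)) t
  continuousOn : ∀ g, ∀ z ∈ V, ContinuousOn (fun t => pathField ρ g t z) (Icc 0 1)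
  contMDiffOn : ContMDiffOn ((𝓡 d).prod 𝓘(ℝ, Phase ke kh kf)) 𝓘(ℝ, ℝ) r
    (fun q : G × Phase ke kh kf => Ψ q.1 q.2) (univ ×ˢ V)
  map_zero : ∀ g, Ψ g 0 = 0
  hamVF_eq : ∀ g, ∀ z ∈ V, hamVF (Ψ g) z = ∫ t in (0 : ℝ)..1, pathField ρ g t z
  firstIntegral : ∀ g, ∀ z ∈ V, fderiv ℝ momentMap z (hamVF (Ψ g) z) = 0

/-- The linear parts `ρ(g)⁽¹⁾` form a linear action of `G` on `ℝ²ⁿ` preserving the system. -/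
def IsLinearSystemAction {G : Type*} [Group G] (ρ : G → Phase ke kh kf → Phase ke kh kf) : Prop :=
  ∃ A : G →* (Phase ke kh kf →L[ℝ] Phase ke kh kf), ∀ g,
    A g = linearPart (ρ g) ∧ PreservesSystem (A g) univ

end LinearSystem

open LinearSystem

/-!
The vector fields `X_{hᵢ}` are linear and commute. Write `gen c` for their combination with
constant coefficients `c`, and `flow c` for its time-one map, which is an explicit linear map built
from rotations and dilations. Every symplectic map `R` with `h ∘ R = h` intertwines the `gen c`
(`PreservesSystem.fderiv_gen`), hence the `flow c`. If moreover `R` has linear part the identity at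
the fixed point `0`, then `R z = flow (C z) z` near `0` for a small exponent `C z`. The exponent is
given by explicit formulas (`coef`): in an elliptic or hyperbolic block the factor by which `R`
multiplies the coordinate is an integral of partial derivatives of `R` over a segment; in a
focus-focus block it is read off on a section of the complexified flow. Hence `C` is as smooth as
`R`, jointly in all parameters (`eventually_coef`). It is unique, because the flows are free, up to
the periods of the rotations, at a dense set of points (`eq_of_flow_eq`, `eq_of_eq_regular`);
uniqueness makes `C` invariant under the flows (`IsExponentOn.map_flow`). That `R` is symplectic
means that the one-form `∑ Cᵢ dhᵢ` is closed (`omegaL_fderiv_flow`).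

Let `C_g` be the exponent of `ρ(g)⁽¹⁾ ∘ ρ(g)⁻¹`. Then the path `R_t` of the statement is
`z ↦ flow (C_g (t z)) z`, so `∫₀¹ X_t dt` is `z ↦ gen (C_g z) z`
(`HasExponents.integral_pathField`). By the Poincaré lemma (`hasFDerivAt_potential`) this field has a
Hamiltonian, and as `C_g` is constant along its orbits its time-one map is `z ↦ flow (C_g z) z`.
Uniqueness of exponents gives the cocycle relation
`C_{gk} = C_k ∘ ρ(g⁻¹)⁽¹⁾ + C_g` (`HasExponents.coef_mul`). Integrating it over `k` against an
invariant probability measure, the average `A = ∫ C_k dk` satisfies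
`A ∘ ρ(g⁻¹)⁽¹⁾ = A - C_g`, which says exactly that `Φ z = flow (A z) z` intertwines `ρ(g)` with its
linear part (`HasExponents.flow_averagedCoef_apply`). The form `∑ Aᵢ dhᵢ` is again closed and `A` is
again invariant, so `Φ` preserves the system and has inverse `w ↦ flow (-A w) w`
(`isSystemAutomorphism_flow`). Smoothness of `A`, in the `C^∞` and in the analytic case, is the
smoothness of integrals over a compact space with respect to a parameter
(`ParamIntegral.contDiffAt_integral`).

For a family, `Φ_p` linearizes `ρ_p` to `ρ_p(g)⁽¹⁾`, and it remains to see that this does not depend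
on `p` (`IsLocalActionFamily.linearPart_eq`). Linear maps preserving the system commute with one
another (`comm_of_gen_comm`), so `g ↦ ρ_p(g)⁽¹⁾ (ρ_q(g)⁽¹⁾)⁻¹` is a homomorphism. For `p` close to
`q` it is uniformly close to `1`, hence trivial, since there are no small subgroups; the disk is
connected.
-/

set_option linter.unusedSectionVars false
set_option linter.unusedSimpArgs false

/-! ### Smoothness of integrals with respect to a parameter -/

namespace ParamIntegral
open Filter Topology

variable {T 𝔸 X Y : Type*} [TopologicalSpace T]
  [NormedAddCommGroup 𝔸] [NormedSpace ℝ 𝔸] [NormedAddCommGroup X] [NormedSpace ℝ X]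
  [NormedAddCommGroup Y] [NormedSpace ℝ Y]

/-- `F : T → X → Y` is jointly `C^r` at `(k₀, x₀)`, when smoothness in the first variable is read
through a continuous chart-like map `χ` with values in the normed space `𝔸`. -/
def JointContDiffAt (𝔸 : Type*) [NormedAddCommGroup 𝔸] [NormedSpace ℝ 𝔸] (r : ℕ∞ω)
    (F : T → X → Y) (k₀ : T) (x₀ : X) : Prop :=
  ∃ (χ : T → 𝔸) (f : 𝔸 × X → Y), (∀ᶠ k in 𝓝 k₀, ContinuousAt χ k) ∧
    ContDiffAt ℝ r f (χ k₀, x₀) ∧ ∀ᶠ q in 𝓝 (k₀, x₀), F q.1 q.2 = f (χ q.1, q.2)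

lemma JointContDiffAt.of_le {r r' : ℕ∞ω} {F : T → X → Y} {k₀ : T} {x₀ : X}
    (h : JointContDiffAt 𝔸 r F k₀ x₀) (hr : r' ≤ r) : JointContDiffAt 𝔸 r' F k₀ x₀ := by
  obtain ⟨χ, f, h1, h2, h3⟩ := h
  exact ⟨χ, f, h1, h2.of_le hr, h3⟩

lemma JointContDiffAt.continuousAt {r : ℕ∞ω} {F : T → X → Y} {k₀ : T} {x₀ : X}
    (h : JointContDiffAt 𝔸 r F k₀ x₀) : ContinuousAt (fun q : T × X => F q.1 q.2) (k₀, x₀) := by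
  obtain ⟨χ, f, h1, h2, h3⟩ := h
  have hχ : ContinuousAt χ k₀ := h1.self_of_nhds
  refine ContinuousAt.congr (f := fun q : T × X => f (χ q.1, q.2)) ?_ (h3.mono fun q hq => hq.symm)
  refine ContinuousAt.comp (x := (k₀, x₀)) (g := f) h2.continuousAt ?_
  exact (ContinuousAt.comp (x := (k₀, x₀)) (f := Prod.fst) hχ continuousAt_fst).prodMk continuousAt_snd

lemma JointContDiffAt.eventually {n : ℕ} {F : T → X → Y} {k₀ : T} {x₀ : X}
    (h : JointContDiffAt 𝔸 n F k₀ x₀) :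
    ∀ᶠ q in 𝓝 (k₀, x₀), JointContDiffAt 𝔸 n F q.1 q.2 := by
  obtain ⟨χ, f, h1, h2, h3⟩ := h
  have hχ : ContinuousAt (fun q : T × X => (χ q.1, q.2)) (k₀, x₀) :=
    (ContinuousAt.comp (x := (k₀, x₀)) (f := Prod.fst) h1.self_of_nhds
      continuousAt_fst).prodMk continuousAt_snd
  have h2' := hχ.eventually (h2.eventually (by simp))
  have h1' : ∀ᶠ q : T × X in 𝓝 (k₀, x₀), ∀ᶠ k in 𝓝 q.1, ContinuousAt χ k :=
    continuousAt_fst.eventually (p := fun k' => ∀ᶠ k in 𝓝 k', ContinuousAt χ k)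
      h1.eventually_nhds
  filter_upwards [h1', h2', h3.eventually_nhds] with q hq1 hq2 hq3
  exact ⟨χ, f, hq1, hq2, hq3⟩

lemma JointContDiffAt.fderiv {n : ℕ} {F : T → X → Y} {k₀ : T} {x₀ : X}
    (h : JointContDiffAt 𝔸 (n + 1 : ℕ) F k₀ x₀) :
    JointContDiffAt 𝔸 n (fun k x => fderiv ℝ (F k) x) k₀ x₀ ∧
      ∀ᶠ q in 𝓝 (k₀, x₀), DifferentiableAt ℝ (F q.1) q.2 := by
  obtain ⟨χ, f, h1, h2, h3⟩ := h
  have hχ : ContinuousAt (fun q : T × X => (χ q.1, q.2)) (k₀, x₀) :=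
    (ContinuousAt.comp (x := (k₀, x₀)) (f := Prod.fst) h1.self_of_nhds
      continuousAt_fst).prodMk continuousAt_snd
  have h2' := hχ.eventually (h2.eventually (by simp))
  have key : ∀ᶠ q in 𝓝 (k₀, x₀), HasFDerivAt (F q.1)
      ((_root_.fderiv ℝ f (χ q.1, q.2)).comp (ContinuousLinearMap.inr ℝ 𝔸 X)) q.2 := by
    filter_upwards [h2', h3.eventually_nhds] with q hq2 hq3
    have hd : HasFDerivAt f (_root_.fderiv ℝ f (χ q.1, q.2)) (χ q.1, q.2) :=
      (hq2.differentiableAt (by simp)).hasFDerivAt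
    have hc : HasFDerivAt (fun x : X => (χ q.1, x)) (ContinuousLinearMap.inr ℝ 𝔸 X) q.2 :=
      hasFDerivAt_prodMk_right _ _
    refine (hd.comp q.2 hc).congr_of_eventuallyEq ?_
    have : ContinuousAt (fun x : X => (q.1, x)) q.2 := by fun_prop
    exact this.eventually hq3
  refine ⟨⟨χ, fun y => (_root_.fderiv ℝ f y).comp (ContinuousLinearMap.inr ℝ 𝔸 X), h1, ?_, ?_⟩, ?_⟩
  · have : ContDiffAt ℝ n (_root_.fderiv ℝ f) (χ k₀, x₀) := h2.fderiv_right (by norm_cast)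
    exact this.clm_comp contDiffAt_const
  · exact key.mono fun q hq => hq.fderiv
  · exact key.mono fun q hq => hq.differentiableAt

variable [MeasurableSpace T] [OpensMeasurableSpace T] [T2Space T]
  {μ : Measure T} [IsFiniteMeasure μ] {K : Set T}

lemma integrable_of_continuousAt (hK : IsCompact K) (hμ : ∀ᵐ k ∂μ, k ∈ K) {f : T → Y}
    (hf : ∀ k ∈ K, ContinuousAt f k) : Integrable f μ := by
  have h : μ.restrict K = μ := Measure.restrict_eq_self_of_ae_mem hμ
  rw [← h]
  exact (show ContinuousOn f K from fun k hk => (hf k hk).continuousWithinAt).integrableOn_compact hK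

lemma eventually_norm_le (hK : IsCompact K) {F : T → X → Y} {x₀ : X}
    (hF : ∀ k ∈ K, ContinuousAt (fun q : T × X => F q.1 q.2) (k, x₀)) :
    ∃ B : ℝ, ∀ᶠ x in 𝓝 x₀, ∀ k ∈ K, ‖F k x‖ ≤ B := by
  have hc : ContinuousOn (fun k => F k x₀) K := fun k hk =>
    (ContinuousAt.comp (x := k) (f := fun k => (k, x₀)) (hF k hk)
      (by fun_prop)).continuousWithinAt
  obtain ⟨B, hB⟩ := hK.exists_bound_of_continuousOn hc
  refine ⟨B + 1, hK.eventually_forall_of_forall_eventually fun k hk => ?_⟩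
  have h1 : ContinuousAt (fun q : X × T => ‖F q.2 q.1‖) (x₀, k) :=
    (ContinuousAt.comp (x := (x₀, k)) (f := Prod.swap) (g := fun q : T × X => F q.1 q.2)
      (hF k hk) continuous_swap.continuousAt).norm
  have h2 := h1.eventually (gt_mem_nhds (show ‖F k x₀‖ < B + 1 by linarith [hB k hk]))
  exact h2.mono fun q hq => le_of_lt hq

/-- Differentiation under the integral sign over a compact space. -/
lemma hasFDerivAt_integral (hK : IsCompact K) (hμ : ∀ᵐ k ∂μ, k ∈ K)
    {F : T → X → Y} {x₀ : X} (hF : ∀ k ∈ K, JointContDiffAt 𝔸 (1 : ℕ) F k x₀) :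
    HasFDerivAt (fun x => ∫ k, F k x ∂μ) (∫ k, fderiv ℝ (F k) x₀ ∂μ) x₀ := by
  have hF' : ∀ k ∈ K, JointContDiffAt 𝔸 ((0 : ℕ) + 1 : ℕ) F k x₀ := hF
  obtain ⟨B, hB⟩ := eventually_norm_le hK (F := fun k x => fderiv ℝ (F k) x)
    (fun k hk => ((hF' k hk).fderiv.1).continuousAt)
  have hd : ∀ᶠ x in 𝓝 x₀, ∀ k ∈ K, DifferentiableAt ℝ (F k) x :=
    hK.eventually_forall_of_forall_eventually fun k hk =>
      (continuous_swap.continuousAt (x := (x₀, k))).eventually (hF' k hk).fderiv.2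
  have hm : ∀ᶠ x in 𝓝 x₀, ∀ k ∈ K, JointContDiffAt 𝔸 (1 : ℕ) F k x :=
    hK.eventually_forall_of_forall_eventually fun k hk =>
      (continuous_swap.continuousAt (x := (x₀, k))).eventually (hF k hk).eventually
  have hint : ∀ x, (∀ k ∈ K, JointContDiffAt 𝔸 (1 : ℕ) F k x) → Integrable (fun k => F k x) μ :=
    fun x hx => integrable_of_continuousAt hK hμ fun k hk =>
      ContinuousAt.comp (x := k) (f := fun k => (k, x)) (hx k hk).continuousAt (by fun_prop)
  refine hasFDerivAt_integral_of_dominated_of_fderiv_le (F := fun x k => F k x)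
    (F' := fun x k => fderiv ℝ (F k) x) (bound := fun _ => B) (hB.and hd)
    (hm.mono fun x hx => (hint x hx).aestronglyMeasurable) (hint x₀ hF)
    ?_ ?_ (integrable_const B) ?_
  · refine (integrable_of_continuousAt hK hμ fun k hk => ?_).aestronglyMeasurable
    exact ContinuousAt.comp (x := k) (f := fun k => (k, x₀))
      (g := fun q : T × X => fderiv ℝ (F q.1) q.2) ((hF' k hk).fderiv.1).continuousAt (by fun_prop)
  · exact hμ.mono fun k hk x hx => hx.1 k hk
  · exact hμ.mono fun k hk x hx => (hx.2 k hk).hasFDerivAt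

universe u

/-- The finite case of `contDiffAt_integral`. The induction replaces `Y` by `X →L[ℝ] Y`, which is why
both spaces live in the same universe. -/
lemma contDiffAt_integral_nat {X : Type u} [NormedAddCommGroup X] [NormedSpace ℝ X]
    (hK : IsCompact K) (hμ : ∀ᵐ k ∂μ, k ∈ K) (n : ℕ) :
    ∀ {Y : Type u} [NormedAddCommGroup Y] [NormedSpace ℝ Y] {F : T → X → Y} {x₀ : X},
      (∀ k ∈ K, JointContDiffAt 𝔸 n F k x₀) → ContDiffAt ℝ n (fun x => ∫ k, F k x ∂μ) x₀ := by
  have hev : ∀ (n : ℕ) {Y : Type u} [NormedAddCommGroup Y] [NormedSpace ℝ Y] {F : T → X → Y}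
      {x₀ : X}, (∀ k ∈ K, JointContDiffAt 𝔸 n F k x₀) →
      ∀ᶠ x in 𝓝 x₀, ∀ k ∈ K, JointContDiffAt 𝔸 n F k x := fun n Y _ _ F x₀ hF =>
    hK.eventually_forall_of_forall_eventually fun k hk =>
      (continuous_swap.continuousAt (x := (x₀, k))).eventually (hF k hk).eventually
  induction n with
  | zero =>
    intro Y _ _ F x₀ hF
    have hc : ∀ x, (∀ k ∈ K, JointContDiffAt 𝔸 (0 : ℕ) F k x) →
        ContinuousAt (fun x => ∫ k, F k x ∂μ) x := fun x hx => by
      obtain ⟨B, hB⟩ := eventually_norm_le hK fun k hk => (hx k hk).continuousAt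
      refine continuousAt_of_dominated (bound := fun _ => B) ?_ ?_ (integrable_const B) ?_
      · filter_upwards [hev 0 hx] with y hy
        exact (integrable_of_continuousAt hK hμ fun k hk =>
          ContinuousAt.comp (x := k) (f := fun k => (k, y)) (hy k hk).continuousAt
            (by fun_prop)).aestronglyMeasurable
      · exact hB.mono fun y hy => hμ.mono fun k hk => hy k hk
      · exact hμ.mono fun k hk => ContinuousAt.comp (x := x) (f := fun y => (k, y))
          (hx k hk).continuousAt (by fun_prop)
    refine contDiffAt_zero.2 ⟨_, hev 0 hF, fun x hx => (hc x hx).continuousWithinAt⟩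
  | succ n ih =>
    intro Y _ _ F x₀ hF
    refine contDiffAt_succ_iff_hasFDerivAt.2 ⟨fun x => ∫ k, fderiv ℝ (F k) x ∂μ,
      ⟨_, hev (n + 1) hF, fun x hx => ?_⟩, ih fun k hk => (hF k hk).fderiv.1⟩
    exact hasFDerivAt_integral (𝔸 := 𝔸) hK hμ fun k hk => (hx k hk).of_le (by norm_cast; omega)

/-- An integral of analytic functions with a parameter is analytic over a small piece of the
parameter space, on which the functions are sums of power series with a common majorant. -/
lemma JointContDiffAt.exists_analyticAt_setIntegral [SecondCountableTopology T] [CompleteSpace Y]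
    {F : T → X → Y} {k₀ : T} {x₀ : X} (h : JointContDiffAt 𝔸 ω F k₀ x₀) :
    ∃ O : Set T, IsOpen O ∧ k₀ ∈ O ∧ ∀ S ⊆ O, MeasurableSet S →
      (∀ᶠ x in 𝓝 x₀, IntegrableOn (fun k => F k x) S μ) ∧
      AnalyticAt ℝ (fun x => ∫ k in S, F k x ∂μ) x₀ := by
  obtain ⟨χ, f, h1, h2, h3⟩ := h
  obtain ⟨p, ρ, hp⟩ : AnalyticAt ℝ f (χ k₀, x₀) := h2.analyticAt
  obtain ⟨r, hr0, hr⟩ : ∃ r : NNReal, 0 < r ∧ (r + r : ENNReal) < ρ := by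
    obtain ⟨r, hr0, hr⟩ := ENNReal.lt_iff_exists_nnreal_btwn.1 hp.r_pos
    refine ⟨r / 2, by simpa using hr0, ?_⟩
    rw [← ENNReal.coe_add, add_halves]; exact hr
  have hrρ : (r : ENNReal) < ρ := lt_of_le_of_lt le_self_add hr
  have hpr : (r + r : ENNReal) < p.radius := hr.trans_le hp.r_le
  -- a box `O × ball x₀ r'` on which `F` is given by `f`, with `χ` staying within `r` of `χ k₀`
  have hχ : ContinuousAt χ k₀ := h1.self_of_nhds
  obtain ⟨u, hu, v, hv, huv⟩ := mem_nhds_prod_iff.1 h3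
  obtain ⟨r₁, hr₁, hv'⟩ := Metric.mem_nhds_iff.1 hv
  obtain ⟨r', hr'0, hr'⟩ : ∃ r' : NNReal, 0 < r' ∧ r' ≤ r ∧ (r' : ℝ) ≤ r₁ :=
    ⟨min r ⟨r₁, hr₁.le⟩, lt_min hr0 hr₁, min_le_left _ _, by
      have : min r (⟨r₁, hr₁.le⟩ : NNReal) ≤ ⟨r₁, hr₁.le⟩ := min_le_right _ _
      exact this⟩
  have hχr : ∀ᶠ k in 𝓝 k₀, ‖χ k - χ k₀‖₊ < r := by
    have : Tendsto (fun k => ‖χ k - χ k₀‖₊) (𝓝 k₀) (𝓝 0) := by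
      have := (hχ.sub (continuousAt_const (y := χ k₀))).nnnorm
      simpa [ContinuousAt] using this
    exact this.eventually (gt_mem_nhds hr0)
  obtain ⟨O, hO, hOo, hkO⟩ := eventually_nhds_iff.1 (h1.and (hχr.and hu))
  set c : T → 𝔸 × X := fun k => (χ k - χ k₀, 0) with hc
  have hcn : ∀ k ∈ O, ‖c k‖₊ < r := fun k hk => by
    have : ‖c k‖₊ = ‖χ k - χ k₀‖₊ := by simp [hc, Prod.nnnorm_def]
    rw [this]; exact (hO k hk).2.1
  -- the power series of `F k` at `x₀`, obtained by moving the centre of `p` to `χ k`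
  set q : T → FormalMultilinearSeries ℝ X Y := fun k n =>
    (p.changeOrigin (c k) n).compContinuousLinearMap
      (fun _ => ContinuousLinearMap.inr ℝ 𝔸 X) with hq
  -- the common majorant: the terms of the re-expansion of `p` at distance `r`
  set B : ℕ → NNReal := fun n =>
    ∑' s : Σ l : ℕ, { s : Finset (Fin (n + l)) // s.card = l }, ‖p (n + s.1)‖₊ * r ^ s.1 with hB
  have hBs : Summable fun n => B n * r ^ n := by
    simpa only [hB, ← NNReal.tsum_mul_right] using
      (NNReal.summable_sigma.1 (p.changeOriginSeries_summable_aux₁ hpr)).2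
  have hqB : ∀ n, ∀ k ∈ O, ‖q k n‖ ≤ B n := fun n k hk => by
    have e1 : ‖q k n‖ ≤ ‖p.changeOrigin (c k) n‖ * ∏ _ : Fin n, ‖ContinuousLinearMap.inr ℝ 𝔸 X‖ :=
      ContinuousMultilinearMap.norm_compContinuousLinearMap_le _ _
    have e2 : ∏ _ : Fin n, ‖ContinuousLinearMap.inr ℝ 𝔸 X‖ ≤ 1 :=
      Finset.prod_le_one (fun _ _ => norm_nonneg _)
        fun _ _ => ContinuousLinearMap.norm_inr_le_one _ _ _
    have e3 : ‖p.changeOrigin (c k) n‖₊ ≤ B n := by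
      have hck : (‖c k‖₊ : ENNReal) < r := by exact_mod_cast hcn k hk
      have hrr : (r : ENNReal) < p.radius := hrρ.trans_le hp.r_le
      refine (p.nnnorm_changeOrigin_le n (hck.trans hrr)).trans ?_
      refine Summable.tsum_le_tsum (fun s => ?_) (NNReal.summable_of_le (fun s => ?_)
        (p.changeOriginSeries_summable_aux₂ hrr n)) (p.changeOriginSeries_summable_aux₂ hrr n)
      all_goals gcongr; exact (hcn k hk).le
    exact e1.trans ((mul_le_of_le_one_right (norm_nonneg _) e2).trans e3)
  have hqc : ∀ n, ContinuousOn (fun k => q k n) O := fun n k hk => by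
    have e0 : ContinuousAt c k :=
      (((hO k hk).1).sub continuousAt_const).prodMk continuousAt_const
    have e1 : ContinuousAt (fun y => p.changeOrigin y n) (c k) := by
      have hpos : 0 < p.radius := hp.r_pos.trans_le hp.r_le
      refine ((p.hasFPowerSeriesOnBall_changeOrigin n hpos).analyticAt_of_mem ?_).continuousAt
      rw [mem_eball_zero_iff]
      have : (‖c k‖₊ : ENNReal) < r := by exact_mod_cast hcn k hk
      exact this.trans (hrρ.trans_le hp.r_le)
    have e2 : ContinuousAt (fun k => p.changeOrigin (c k) n) k :=
      ContinuousAt.comp (g := fun y => p.changeOrigin y n) e1 e0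
    exact ((ContinuousMultilinearMap.compContinuousLinearMapL (𝕜 := ℝ) (F := Y)
      (fun _ : Fin n => ContinuousLinearMap.inr ℝ 𝔸 X)).continuous.continuousAt.comp
        e2).continuousWithinAt
  have hsum : ∀ k ∈ O, ∀ y : X, ‖y‖₊ < r' → HasSum (fun n => q k n fun _ => y) (F k (x₀ + y)) := by
    intro k hk y hy
    have hk1 : (‖c k‖₊ : ENNReal) < ρ := by
      have : (‖c k‖₊ : ENNReal) < r := by exact_mod_cast hcn k hk
      exact this.trans hrρ
    have e := hp.changeOrigin hk1
    have hx : (χ k₀, x₀) + c k = (χ k, x₀) := by simp [hc]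
    rw [hx] at e
    have hyin : ((0, y) : 𝔸 × X) ∈ Metric.eball (0 : 𝔸 × X) (ρ - ‖c k‖₊) := by
      rw [mem_eball_zero_iff, lt_tsub_iff_right]
      have h1 : ‖((0, y) : 𝔸 × X)‖₊ ≤ r := by
        have : ‖((0, y) : 𝔸 × X)‖₊ = ‖y‖₊ := by simp [Prod.nnnorm_def]
        rw [this]; exact hy.le.trans hr'.1
      refine lt_of_le_of_lt ?_ hr
      exact add_le_add (by exact_mod_cast h1) (by exact_mod_cast (hcn k hk).le)
    have e' := e.hasSum hyin
    have hF : F k (x₀ + y) = f ((χ k, x₀) + (0, y)) := by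
      have hin : (k, x₀ + y) ∈ u ×ˢ v := by
        refine ⟨(hO k hk).2.2, hv' ?_⟩
        rw [Metric.mem_ball, dist_self_add_left]
        exact lt_of_lt_of_le (by exact_mod_cast hy) hr'.2
      have := huv hin
      simpa using this
    rw [hF]
    exact e'
  refine ⟨O, hOo, hkO, fun S hSO hS => ?_⟩
  have hSr : ∀ᵐ k ∂μ.restrict S, k ∈ O := (ae_restrict_mem hS).mono fun k hk => hSO hk
  have hqm : ∀ n, AEStronglyMeasurable (fun k => q k n) (μ.restrict S) := fun n => by
    have : SecondCountableTopologyEither T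
      (ContinuousMultilinearMap ℝ (fun _ : Fin n => X) Y) := ⟨Or.inl inferInstance⟩
    exact ((hqc n).mono hSO).aestronglyMeasurable hS
  have hqi : ∀ n, Integrable (fun k => q k n) (μ.restrict S) := fun n =>
    Integrable.of_bound (hqm n) (B n) (hSr.mono fun k hk => hqB n k hk)
  have hqyi : ∀ n (y : X), Integrable (fun k => q k n fun _ => y) (μ.restrict S) := fun n y =>
    (ContinuousMultilinearMap.apply ℝ (fun _ : Fin n => X) Y (fun _ => y)).integrable_comp (hqi n)
  have hqyb : ∀ n (y : X), ‖y‖₊ < r' → ∀ k ∈ O, ‖q k n fun _ => y‖ ≤ B n * r ^ n :=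
    fun n y hy k hk => by
      refine ((q k n).le_opNorm _).trans ?_
      rw [Finset.prod_const, Finset.card_univ, Fintype.card_fin]
      have : ‖y‖ ≤ r := by exact_mod_cast hy.le.trans hr'.1
      gcongr
      exact hqB n k hk
  have hBs' : Summable fun n => ((B n : ℝ) * r ^ n) := by exact_mod_cast hBs
  have hint : ∀ y : X, ‖y‖₊ < r' →
      HasSum (fun n => ∫ k in S, (q k n fun _ => y) ∂μ) (∫ k in S, F k (x₀ + y) ∂μ) ∧
      IntegrableOn (fun k => F k (x₀ + y)) S μ := by
    intro y hy
    refine ⟨hasSum_integral_of_dominated_convergence (fun n _ => (B n : ℝ) * r ^ n)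
      (fun n => (hqyi n y).aestronglyMeasurable)
      (fun n => hSr.mono fun k hk => hqyb n y hy k hk) (Eventually.of_forall fun _ => hBs')
      (integrable_const _) (hSr.mono fun k hk => hsum k hk y hy), ?_⟩
    have hm : AEStronglyMeasurable (fun k => F k (x₀ + y)) (μ.restrict S) := by
      refine aestronglyMeasurable_of_tendsto_ae atTop
        (f := fun (N : ℕ) k => ∑ n ∈ Finset.range N, q k n fun _ => y)
        (fun N => ?_) (hSr.mono fun k hk => (hsum k hk y hy).tendsto_sum_nat)
      exact Finset.aestronglyMeasurable_fun_sum _ fun n _ => (hqyi n y).aestronglyMeasurable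
    refine Integrable.of_bound hm (∑' n, (B n : ℝ) * r ^ n) (hSr.mono fun k hk => ?_)
    rw [← (hsum k hk y hy).tsum_eq]
    exact tsum_of_norm_bounded hBs'.hasSum fun n => hqyb n y hy k hk
  constructor
  · have : ∀ᶠ x in 𝓝 x₀, ‖x - x₀‖₊ < r' := by
      have h0 : Tendsto (fun x => ‖x - x₀‖₊) (𝓝 x₀) (𝓝 0) := by
        have : ContinuousAt (fun x => ‖x - x₀‖₊) x₀ := by fun_prop
        simpa [ContinuousAt] using this
      exact h0.eventually (gt_mem_nhds hr'0)
    filter_upwards [this] with x hx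
    simpa using (hint (x - x₀) hx).2
  · refine ⟨fun n => ∫ k in S, q k n ∂μ, r', ⟨?_, by exact_mod_cast hr'0, fun {y} hy => ?_⟩⟩
    · refine FormalMultilinearSeries.le_radius_of_bound _ (μ.real S * ∑' n, (B n : ℝ) * r ^ n)
        fun n => ?_
      have e1 : ‖∫ k in S, q k n ∂μ‖ ≤ B n * μ.real S :=
        norm_setIntegral_le_of_norm_le_const_ae (measure_lt_top _ _)
          (hSr.mono fun k hk => hqB n k hk)
      have e2 : (B n : ℝ) * r ^ n ≤ ∑' n, (B n : ℝ) * r ^ n :=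
        hBs'.le_tsum n fun m _ => by positivity
      have e3 : (r' : ℝ) ^ n ≤ r ^ n := by gcongr; exact_mod_cast hr'.1
      calc _ ≤ (B n * μ.real S) * (r : ℝ) ^ n := by gcongr
        _ = μ.real S * (B n * r ^ n) := by ring
        _ ≤ _ := by gcongr
    · rw [mem_eball_zero_iff] at hy
      have hy' : ‖y‖₊ < r' := by exact_mod_cast hy
      have e := (hint y hy').1
      have e' : ∀ n, (∫ k in S, (q k n fun _ => y) ∂μ) = (∫ k in S, q k n ∂μ) fun _ => y :=
        fun n => (ContinuousMultilinearMap.apply ℝ (fun _ : Fin n => X) Y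
          (fun _ => y)).integral_comp_comm (hqi n)
      simpa only [e'] using e

/-- The integral over a compact space of a jointly `C^r` function is `C^r` in the parameter, both
for `r = ∞` and for `r = ω`. -/
theorem contDiffAt_integral {X Y : Type u} [NormedAddCommGroup X] [NormedSpace ℝ X]
    [NormedAddCommGroup Y] [NormedSpace ℝ Y] [CompleteSpace Y] [SecondCountableTopology T]
    {r : ℕ∞ω} (hr : r = ∞ ∨ r = ω) (hK : IsCompact K) (hμ : ∀ᵐ k ∂μ, k ∈ K)
    {F : T → X → Y} {x₀ : X} (hF : ∀ k ∈ K, JointContDiffAt 𝔸 r F k x₀) :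
    ContDiffAt ℝ r (fun x => ∫ k, F k x ∂μ) x₀ := by
  rcases hr with rfl | rfl
  · refine contDiffAt_infty.2 fun n => contDiffAt_integral_nat (𝔸 := 𝔸) hK hμ n fun k hk =>
      (hF k hk).of_le (by exact_mod_cast le_top)
  -- the pieces with analytic integrals are glued along a finite cover of `K`
  · have key : ∃ O : Set T, IsOpen O ∧ K ⊆ O ∧ ∀ S ⊆ O, MeasurableSet S →
        (∀ᶠ x in 𝓝 x₀, IntegrableOn (fun k => F k x) S μ) ∧
        AnalyticAt ℝ (fun x => ∫ k in S, F k x ∂μ) x₀ := by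
      refine hK.induction_on (p := fun K => ∃ O : Set T, IsOpen O ∧ K ⊆ O ∧ ∀ S ⊆ O,
        MeasurableSet S → (∀ᶠ x in 𝓝 x₀, IntegrableOn (fun k => F k x) S μ) ∧
        AnalyticAt ℝ (fun x => ∫ k in S, F k x ∂μ) x₀) ?_ ?_ ?_ ?_
      · refine ⟨∅, isOpen_empty, Subset.rfl, fun S hS _ => ?_⟩
        obtain rfl := subset_empty_iff.1 hS
        simpa using analyticAt_const
      · rintro s t hst ⟨O, h1, h2, h3⟩
        exact ⟨O, h1, hst.trans h2, h3⟩
      · rintro s t ⟨O, h1, h2, h3⟩ ⟨O', h1', h2', h3'⟩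
        refine ⟨O ∪ O', h1.union h1', union_subset_union h2 h2', fun S hS hm => ?_⟩
        obtain ⟨i1, a1⟩ := h3 (S ∩ O) inter_subset_right (hm.inter h1.measurableSet)
        obtain ⟨i2, a2⟩ := h3' (S \ O) (fun k hk => (hS hk.1).resolve_left hk.2)
          (hm.diff h1.measurableSet)
        refine ⟨?_, (a1.add a2).congr ?_⟩
        · filter_upwards [i1, i2] with x j1 j2
          rw [← inter_union_sdiff S O]
          exact j1.union j2
        · filter_upwards [i1, i2] with x j1 j2
          rw [Pi.add_apply, ← setIntegral_union (disjoint_sdiff_self_right.mono_left inter_subset_right)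
            (hm.diff h1.measurableSet) j1 j2, inter_union_sdiff]
      · intro k hk
        obtain ⟨O, h1, h2, h3⟩ := (hF k hk).exists_analyticAt_setIntegral (μ := μ)
        exact ⟨O, mem_nhdsWithin_of_mem_nhds (h1.mem_nhds h2), O, h1, Subset.rfl, h3⟩
    obtain ⟨O, hO, hKO, h⟩ := key
    have := (h O Subset.rfl hO.measurableSet).2
    rw [Measure.restrict_eq_self_of_ae_mem (hμ.mono fun k hk => hKO hk)] at this
    exact this.contDiffAt

end ParamIntegral

namespace LinearSystem
open Filter Topology

variable {ke kh kf : ℕ}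

/-! ### The abelian Lie algebra spanned by the Hamiltonian vector fields of the moment map -/

/-- The linear vector field `∑ i, c i • X_{h i}`, evaluated at `z`. -/
def genFun (c : Idx ke kh kf → ℝ) (z : Phase ke kh kf) : Phase ke kh kf :=
  (fun i => match i with
    | .inl i => 2 * c (.inl i) * z.2 (.inl i)
    | .inr (.inl i) => c (.inr (.inl i)) * z.1 (.inr (.inl i))
    | .inr (.inr (j, 0)) => c (.inr (.inr (j, 1))) * z.1 (.inr (.inr (j, 0)))
        - c (.inr (.inr (j, 0))) * z.1 (.inr (.inr (j, 1)))
    | .inr (.inr (j, 1)) => c (.inr (.inr (j, 1))) * z.1 (.inr (.inr (j, 1)))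
        + c (.inr (.inr (j, 0))) * z.1 (.inr (.inr (j, 0))),
   fun i => match i with
    | .inl i => -(2 * c (.inl i) * z.1 (.inl i))
    | .inr (.inl i) => -(c (.inr (.inl i)) * z.2 (.inr (.inl i)))
    | .inr (.inr (j, 0)) => -(c (.inr (.inr (j, 1))) * z.2 (.inr (.inr (j, 0))))
        - c (.inr (.inr (j, 0))) * z.2 (.inr (.inr (j, 1)))
    | .inr (.inr (j, 1)) => -(c (.inr (.inr (j, 1))) * z.2 (.inr (.inr (j, 1))))
        + c (.inr (.inr (j, 0))) * z.2 (.inr (.inr (j, 0))))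

/-- The flow at time one of the linear vector field `∑ i, c i • X_{h i}`. -/
noncomputable def flowFun (c : Idx ke kh kf → ℝ) (z : Phase ke kh kf) : Phase ke kh kf :=
  (fun i => match i with
    | .inl i => Real.cos (2 * c (.inl i)) * z.1 (.inl i) + Real.sin (2 * c (.inl i)) * z.2 (.inl i)
    | .inr (.inl i) => Real.exp (c (.inr (.inl i))) * z.1 (.inr (.inl i))
    | .inr (.inr (j, 0)) => Real.exp (c (.inr (.inr (j, 1)))) *
        (Real.cos (c (.inr (.inr (j, 0)))) * z.1 (.inr (.inr (j, 0)))
          - Real.sin (c (.inr (.inr (j, 0)))) * z.1 (.inr (.inr (j, 1))))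
    | .inr (.inr (j, 1)) => Real.exp (c (.inr (.inr (j, 1)))) *
        (Real.cos (c (.inr (.inr (j, 0)))) * z.1 (.inr (.inr (j, 1)))
          + Real.sin (c (.inr (.inr (j, 0)))) * z.1 (.inr (.inr (j, 0)))),
   fun i => match i with
    | .inl i => Real.cos (2 * c (.inl i)) * z.2 (.inl i) - Real.sin (2 * c (.inl i)) * z.1 (.inl i)
    | .inr (.inl i) => Real.exp (-c (.inr (.inl i))) * z.2 (.inr (.inl i))
    | .inr (.inr (j, 0)) => Real.exp (-c (.inr (.inr (j, 1)))) *
        (Real.cos (c (.inr (.inr (j, 0)))) * z.2 (.inr (.inr (j, 0)))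
          - Real.sin (c (.inr (.inr (j, 0)))) * z.2 (.inr (.inr (j, 1))))
    | .inr (.inr (j, 1)) => Real.exp (-c (.inr (.inr (j, 1)))) *
        (Real.cos (c (.inr (.inr (j, 0)))) * z.2 (.inr (.inr (j, 1)))
          + Real.sin (c (.inr (.inr (j, 0)))) * z.2 (.inr (.inr (j, 0)))))

/-- A point is determined by its coordinates in the elliptic, hyperbolic and focus-focus blocks. -/
lemma phase_ext {u v : Phase ke kh kf}
    (h1 : ∀ i, u.1 (.inl i) = v.1 (.inl i)) (h2 : ∀ i, u.2 (.inl i) = v.2 (.inl i))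
    (h3 : ∀ i, u.1 (.inr (.inl i)) = v.1 (.inr (.inl i)))
    (h4 : ∀ i, u.2 (.inr (.inl i)) = v.2 (.inr (.inl i)))
    (h5 : ∀ j, u.1 (.inr (.inr (j, 0))) = v.1 (.inr (.inr (j, 0))))
    (h6 : ∀ j, u.1 (.inr (.inr (j, 1))) = v.1 (.inr (.inr (j, 1))))
    (h7 : ∀ j, u.2 (.inr (.inr (j, 0))) = v.2 (.inr (.inr (j, 0))))
    (h8 : ∀ j, u.2 (.inr (.inr (j, 1))) = v.2 (.inr (.inr (j, 1)))) : u = v := by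
  refine Prod.ext (funext fun i => ?_) (funext fun i => ?_)
  · rcases i with i | i | ⟨j, k⟩
    · exact h1 i
    · exact h3 i
    · fin_cases k
      · exact h5 j
      · exact h6 j
  · rcases i with i | i | ⟨j, k⟩
    · exact h2 i
    · exact h4 i
    · fin_cases k
      · exact h7 j
      · exact h8 j

lemma idx_ext {α : Type*} {u v : Idx ke kh kf → α} (h1 : ∀ i, u (.inl i) = v (.inl i))
    (h2 : ∀ i, u (.inr (.inl i)) = v (.inr (.inl i)))
    (h3 : ∀ j, u (.inr (.inr (j, 0))) = v (.inr (.inr (j, 0))))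
    (h4 : ∀ j, u (.inr (.inr (j, 1))) = v (.inr (.inr (j, 1)))) : u = v := by
  funext i
  rcases i with i | i | ⟨j, k⟩
  · exact h1 i
  · exact h2 i
  · fin_cases k
    · exact h3 j
    · exact h4 j

lemma sum_idx (f : Idx ke kh kf → ℝ) : ∑ i, f i = (∑ i, f (.inl i)) + ((∑ i, f (.inr (.inl i))) +
    ∑ j, (f (.inr (.inr (j, 0))) + f (.inr (.inr (j, 1))))) := by
  rw [Fintype.sum_sum_type, Fintype.sum_sum_type, Fintype.sum_prod_type]
  simp [Fin.sum_univ_two]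

/-- `genFun` as a continuous bilinear map. -/
noncomputable def gen : (Idx ke kh kf → ℝ) →L[ℝ] Phase ke kh kf →L[ℝ] Phase ke kh kf :=
  LinearMap.toContinuousBilinearMap (LinearMap.mk₂ ℝ genFun
    (fun c c' z => by apply phase_ext <;> intro i <;> simp [genFun] <;> ring)
    (fun a c z => by apply phase_ext <;> intro i <;> simp [genFun] <;> ring)
    (fun c z z' => by apply phase_ext <;> intro i <;> simp [genFun] <;> ring)
    (fun a c z => by apply phase_ext <;> intro i <;> simp [genFun] <;> ring))

lemma gen_apply (c : Idx ke kh kf → ℝ) (z : Phase ke kh kf) : gen c z = genFun c z := rfl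

/-- The symplectic form as a continuous bilinear map. -/
noncomputable def omegaL : Phase ke kh kf →L[ℝ] Phase ke kh kf →L[ℝ] ℝ :=
  LinearMap.toContinuousBilinearMap (LinearMap.mk₂ ℝ omega
    (fun u u' v => by simp only [omega, ← Finset.sum_add_distrib]; congr! 1; simp; ring)
    (fun a u v => by simp only [omega, smul_eq_mul, Finset.mul_sum]; congr! 1; simp; ring)
    (fun u v v' => by simp only [omega, ← Finset.sum_add_distrib]; congr! 1; simp; ring)
    (fun a u v => by simp only [omega, smul_eq_mul, Finset.mul_sum]; congr! 1; simp; ring))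

lemma omegaL_apply (u v : Phase ke kh kf) : omegaL u v = omega u v := rfl

lemma omegaL_swap (u v : Phase ke kh kf) : omegaL u v = -omegaL v u := by
  simp only [omegaL_apply, omega, ← Finset.sum_neg_distrib]; congr! 1; ring

lemma omegaL_single_left (u : Phase ke kh kf) (i : Idx ke kh kf) :
    omegaL u (Pi.single i 1, 0) = - u.2 i := by
  simp [omegaL_apply, omega, Pi.single_apply]

lemma omegaL_single_right (u : Phase ke kh kf) (i : Idx ke kh kf) :
    omegaL u (0, Pi.single i 1) = u.1 i := by
  simp [omegaL_apply, omega, Pi.single_apply]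

lemma eq_of_omegaL_eq {u u' : Phase ke kh kf} (h : ∀ v, omegaL u v = omegaL u' v) : u = u' := by
  refine Prod.ext (funext fun i => ?_) (funext fun i => ?_)
  · simpa [omegaL_single_right] using h (0, Pi.single i 1)
  · simpa [omegaL_single_left] using h (Pi.single i 1, 0)

lemma omegaL_gen_symm (c : Idx ke kh kf → ℝ) (u v : Phase ke kh kf) :
    omegaL (gen c u) v = omegaL (gen c v) u := by
  simp only [omegaL_apply, omega, gen_apply, sum_idx]
  congr! 2
  · simp [genFun]; ring
  · congr! 1
    simp [genFun]; ring
  · congr! 1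
    simp [genFun]; ring

lemma omegaL_gen_gen (c c' : Idx ke kh kf → ℝ) (z : Phase ke kh kf) :
    omegaL (gen c z) (gen c' z) = 0 := by
  have : ∀ a b e : ℝ, a = 0 → b = 0 → e = 0 → a + (b + e) = 0 := by intros; simp [*]
  simp only [omegaL_apply, omega, gen_apply, sum_idx]
  apply this <;> refine Finset.sum_eq_zero fun i _ => ?_ <;> simp [genFun] <;> ring

lemma gen_comm (c c' : Idx ke kh kf → ℝ) (z : Phase ke kh kf) :
    gen c (gen c' z) = gen c' (gen c z) := by
  apply phase_ext <;> intro i <;> simp [gen_apply, genFun] <;> ring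

lemma hasFDerivAt_momentMap (z : Phase ke kh kf) :
    HasFDerivAt momentMap (fderiv ℝ momentMap z) z := by
  have : ContDiff ℝ 1 (momentMap : Phase ke kh kf → _) := by
    refine contDiff_pi.2 fun i => ?_
    rcases i with i | i | ⟨j, k⟩
    · simp only [momentMap]; fun_prop
    · simp only [momentMap]; fun_prop
    · fin_cases k <;> simp only [momentMap] <;> fun_prop
  exact (this.differentiable (by simp) z).hasFDerivAt

lemma fderiv_momentMap_apply (z v : Phase ke kh kf) (i : Idx ke kh kf) :
    HasDerivAt (fun t : ℝ => momentMap (z + t • v) i) (fderiv ℝ momentMap z v i) 0 := by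
  have h := (hasFDerivAt_momentMap z)
  have h1 : HasDerivAt (fun t : ℝ => z + t • v) v 0 := by
    simpa using ((hasDerivAt_id (0 : ℝ)).smul_const v).const_add z
  have h2 : HasFDerivAt momentMap (fderiv ℝ momentMap z) (z + (0 : ℝ) • v) := by simpa using h
  exact (hasDerivAt_pi.1 (h2.comp_hasDerivAt 0 h1)) i

/-- The vector field `gen c` is the Hamiltonian vector field of `∑ i, c i * h i`. -/
lemma sum_mul_fderiv_momentMap (c : Idx ke kh kf → ℝ) (z v : Phase ke kh kf) :
    ∑ i, c i * fderiv ℝ momentMap z v i = omegaL (gen c z) v := by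
  have key : ∀ i, HasDerivAt (fun t : ℝ => c i * momentMap (z + t • v) i)
      (c i * fderiv ℝ momentMap z v i) 0 := fun i => (fderiv_momentMap_apply z v i).const_mul _
  have hl : ∀ a b : ℝ, HasDerivAt (fun t : ℝ => a + t * b) b 0 := fun a b => by
    simpa using ((hasDerivAt_id (0 : ℝ)).mul_const b).const_add a
  have h1 : ∀ i, fderiv ℝ momentMap z v (.inl i) =
      2 * z.1 (.inl i) * v.1 (.inl i) + 2 * z.2 (.inl i) * v.2 (.inl i) := fun i => by
    refine (fderiv_momentMap_apply z v (.inl i)).unique ?_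
    refine HasDerivAt.congr_deriv (((hl (z.1 (.inl i)) (v.1 (.inl i))).pow 2).add
      ((hl (z.2 (.inl i)) (v.2 (.inl i))).pow 2)) ?_
    simp
  have h2 : ∀ i, fderiv ℝ momentMap z v (.inr (.inl i)) =
      v.1 (.inr (.inl i)) * z.2 (.inr (.inl i)) + z.1 (.inr (.inl i)) * v.2 (.inr (.inl i)) :=
    fun i => by
      refine (fderiv_momentMap_apply z v (.inr (.inl i))).unique ?_
      refine HasDerivAt.congr_deriv ((hl (z.1 (.inr (.inl i))) (v.1 (.inr (.inl i)))).mul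
        (hl (z.2 (.inr (.inl i))) (v.2 (.inr (.inl i))))) ?_
      simp
  have h3 : ∀ j, fderiv ℝ momentMap z v (.inr (.inr (j, 0))) =
      v.1 (.inr (.inr (j, 0))) * z.2 (.inr (.inr (j, 1)))
        + z.1 (.inr (.inr (j, 0))) * v.2 (.inr (.inr (j, 1)))
        - (v.1 (.inr (.inr (j, 1))) * z.2 (.inr (.inr (j, 0)))
        + z.1 (.inr (.inr (j, 1))) * v.2 (.inr (.inr (j, 0)))) := fun j => by
    refine (fderiv_momentMap_apply z v (.inr (.inr (j, 0)))).unique ?_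
    refine HasDerivAt.congr_deriv (((hl (z.1 (.inr (.inr (j, 0)))) (v.1 (.inr (.inr (j, 0))))).mul
        (hl (z.2 (.inr (.inr (j, 1)))) (v.2 (.inr (.inr (j, 1)))))).sub
        ((hl (z.1 (.inr (.inr (j, 1)))) (v.1 (.inr (.inr (j, 1))))).mul
        (hl (z.2 (.inr (.inr (j, 0)))) (v.2 (.inr (.inr (j, 0))))))) ?_
    simp
  have h4 : ∀ j, fderiv ℝ momentMap z v (.inr (.inr (j, 1))) =
      v.1 (.inr (.inr (j, 0))) * z.2 (.inr (.inr (j, 0)))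
        + z.1 (.inr (.inr (j, 0))) * v.2 (.inr (.inr (j, 0)))
        + (v.1 (.inr (.inr (j, 1))) * z.2 (.inr (.inr (j, 1)))
        + z.1 (.inr (.inr (j, 1))) * v.2 (.inr (.inr (j, 1)))) := fun j => by
    refine (fderiv_momentMap_apply z v (.inr (.inr (j, 1)))).unique ?_
    refine HasDerivAt.congr_deriv (((hl (z.1 (.inr (.inr (j, 0)))) (v.1 (.inr (.inr (j, 0))))).mul
        (hl (z.2 (.inr (.inr (j, 0)))) (v.2 (.inr (.inr (j, 0)))))).add
        ((hl (z.1 (.inr (.inr (j, 1)))) (v.1 (.inr (.inr (j, 1))))).mul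
        (hl (z.2 (.inr (.inr (j, 1)))) (v.2 (.inr (.inr (j, 1))))))) ?_
    simp
  simp only [omegaL_apply, omega, gen_apply, sum_idx, h1, h2, h3, h4]
  congr! 2
  · simp [genFun]; ring
  · congr! 1
    simp [genFun]; ring
  · congr! 1
    simp [genFun]; ring

lemma fderiv_momentMap_gen (c : Idx ke kh kf → ℝ) (z : Phase ke kh kf) :
    fderiv ℝ momentMap z (gen c z) = 0 := by
  classical
  funext i
  have h := sum_mul_fderiv_momentMap (Pi.single i 1) z (gen c z)
  rw [omegaL_gen_gen] at h
  simpa [Pi.single_apply] using h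

/-! ### The linear flows -/

/-- `flowFun` as a continuous linear map in the point. -/
noncomputable def flow (c : Idx ke kh kf → ℝ) : Phase ke kh kf →L[ℝ] Phase ke kh kf :=
  LinearMap.toContinuousLinearMap
    { toFun := flowFun c
      map_add' := fun z z' => by apply phase_ext <;> intro i <;> simp [flowFun] <;> ring
      map_smul' := fun a z => by apply phase_ext <;> intro i <;> simp [flowFun] <;> ring }

lemma flow_apply (c : Idx ke kh kf → ℝ) (z : Phase ke kh kf) : flow c z = flowFun c z := rfl

lemma flow_zero (z : Phase ke kh kf) : flow 0 z = z := by
  apply phase_ext <;> intro i <;> simp [flow_apply, flowFun]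

lemma flow_add (c c' : Idx ke kh kf → ℝ) (z : Phase ke kh kf) :
    flow (c + c') z = flow c (flow c' z) := by
  apply phase_ext <;> intro i <;>
    simp [flow_apply, flowFun, mul_add, Real.cos_add, Real.sin_add, Real.exp_add] <;> ring

lemma flow_comm (c c' : Idx ke kh kf → ℝ) (z : Phase ke kh kf) :
    flow c (flow c' z) = flow c' (flow c z) := by
  rw [← flow_add, add_comm, flow_add]

lemma flow_neg_flow (c : Idx ke kh kf → ℝ) (z : Phase ke kh kf) : flow (-c) (flow c z) = z := by
  rw [← flow_add, neg_add_cancel, flow_zero]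

lemma flow_flow_neg (c : Idx ke kh kf → ℝ) (z : Phase ke kh kf) : flow c (flow (-c) z) = z := by
  rw [← flow_add, add_neg_cancel, flow_zero]

lemma contDiff_flow {n : ℕ∞ω} :
    ContDiff ℝ n fun q : (Idx ke kh kf → ℝ) × Phase ke kh kf => flow q.1 q.2 := by
  simp only [flow_apply]
  refine ContDiff.prodMk (contDiff_pi.2 fun i => ?_) (contDiff_pi.2 fun i => ?_)
  · rcases i with i | i | ⟨j, k⟩
    · simp only [flowFun]; fun_prop
    · simp only [flowFun]; fun_prop
    · fin_cases k <;> simp only [flowFun] <;> fun_prop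
  · rcases i with i | i | ⟨j, k⟩
    · simp only [flowFun]; fun_prop
    · simp only [flowFun]; fun_prop
    · fin_cases k <;> simp only [flowFun] <;> fun_prop

lemma momentMap_flow (c : Idx ke kh kf → ℝ) (z : Phase ke kh kf) :
    momentMap (flow c z) = momentMap z := by
  have he : ∀ x, Real.exp x * Real.exp (-x) = 1 := fun x => by rw [← Real.exp_add]; simp
  apply idx_ext <;> intro i <;> simp only [flow_apply, flowFun, momentMap]
  · linear_combination (z.1 (.inl i) ^ 2 + z.2 (.inl i) ^ 2) * Real.sin_sq_add_cos_sq (2 * c (.inl i))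
  · linear_combination (z.1 (.inr (.inl i)) * z.2 (.inr (.inl i))) * he (c (.inr (.inl i)))
  · have h1 := he (c (.inr (.inr (i, 1))))
    have h2 := Real.sin_sq_add_cos_sq (c (.inr (.inr (i, 0))))
    linear_combination (z.1 (.inr (.inr (i, 0))) * z.2 (.inr (.inr (i, 1)))
        - z.1 (.inr (.inr (i, 1))) * z.2 (.inr (.inr (i, 0)))) * (h1 *
        (Real.sin (c (.inr (.inr (i, 0)))) ^ 2 + Real.cos (c (.inr (.inr (i, 0)))) ^ 2) + h2)
  · have h1 := he (c (.inr (.inr (i, 1))))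
    have h2 := Real.sin_sq_add_cos_sq (c (.inr (.inr (i, 0))))
    linear_combination (z.1 (.inr (.inr (i, 0))) * z.2 (.inr (.inr (i, 0)))
        + z.1 (.inr (.inr (i, 1))) * z.2 (.inr (.inr (i, 1)))) * (h1 *
        (Real.sin (c (.inr (.inr (i, 0)))) ^ 2 + Real.cos (c (.inr (.inr (i, 0)))) ^ 2) + h2)

lemma omegaL_flow_flow (c : Idx ke kh kf → ℝ) (u v : Phase ke kh kf) :
    omegaL (flow c u) (flow c v) = omegaL u v := by
  have he : ∀ x, Real.exp x * Real.exp (-x) = 1 := fun x => by rw [← Real.exp_add]; simp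
  simp only [omegaL_apply, omega, sum_idx]
  congr! 2 with i hi
  · simp only [flow_apply, flowFun]
    linear_combination (u.1 (.inl i) * v.2 (.inl i) - u.2 (.inl i) * v.1 (.inl i))
      * Real.sin_sq_add_cos_sq (2 * c (.inl i))
  · congr! 1 with i hi
    simp only [flow_apply, flowFun]
    linear_combination (u.1 (.inr (.inl i)) * v.2 (.inr (.inl i))
      - u.2 (.inr (.inl i)) * v.1 (.inr (.inl i))) * he (c (.inr (.inl i)))
  · congr! 1 with i hi
    simp only [flow_apply, flowFun]
    have h1 := he (c (.inr (.inr (i, 1))))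
    have h2 := Real.sin_sq_add_cos_sq (c (.inr (.inr (i, 0))))
    linear_combination (u.1 (.inr (.inr (i, 0))) * v.2 (.inr (.inr (i, 0)))
        - u.2 (.inr (.inr (i, 0))) * v.1 (.inr (.inr (i, 0)))
        + u.1 (.inr (.inr (i, 1))) * v.2 (.inr (.inr (i, 1)))
        - u.2 (.inr (.inr (i, 1))) * v.1 (.inr (.inr (i, 1)))) * (h1 *
        (Real.sin (c (.inr (.inr (i, 0)))) ^ 2 + Real.cos (c (.inr (.inr (i, 0)))) ^ 2) + h2)

lemma gen_flow (c c' : Idx ke kh kf → ℝ) (z : Phase ke kh kf) :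
    gen c (flow c' z) = flow c' (gen c z) := by
  apply phase_ext <;> intro i <;> simp [gen_apply, genFun, flow_apply, flowFun] <;> ring

lemma hasDerivAt_flow_zero (c : Idx ke kh kf → ℝ) (z : Phase ke kh kf) :
    HasDerivAt (fun t : ℝ => flow (t • c) z) (gen c z) 0 := by
  have hs : ∀ a : ℝ, HasDerivAt (fun t : ℝ => Real.sin (t * a)) a 0 := fun a => by
    simpa using ((hasDerivAt_id (0 : ℝ)).mul_const a).sin
  have hc : ∀ a : ℝ, HasDerivAt (fun t : ℝ => Real.cos (t * a)) 0 0 := fun a => by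
    simpa using ((hasDerivAt_id (0 : ℝ)).mul_const a).cos
  have hs2 : ∀ a : ℝ, HasDerivAt (fun t : ℝ => Real.sin (2 * (t * a))) (2 * a) 0 := fun a => by
    simpa using (((hasDerivAt_id (0 : ℝ)).mul_const a).const_mul 2).sin
  have hc2 : ∀ a : ℝ, HasDerivAt (fun t : ℝ => Real.cos (2 * (t * a))) 0 0 := fun a => by
    simpa using (((hasDerivAt_id (0 : ℝ)).mul_const a).const_mul 2).cos
  have he : ∀ a : ℝ, HasDerivAt (fun t : ℝ => Real.exp (t * a)) a 0 := fun a => by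
    simpa using ((hasDerivAt_id (0 : ℝ)).mul_const a).exp
  have he' : ∀ a : ℝ, HasDerivAt (fun t : ℝ => Real.exp (-(t * a))) (-a) 0 := fun a => by
    simpa using (((hasDerivAt_id (0 : ℝ)).mul_const a).neg).exp
  simp only [flow_apply, gen_apply]
  refine HasDerivAt.prodMk (hasDerivAt_pi.2 fun i => ?_) (hasDerivAt_pi.2 fun i => ?_)
  · rcases i with i | i | ⟨j, k⟩
    · simp only [flowFun, genFun, Pi.smul_apply, smul_eq_mul]
      refine HasDerivAt.congr_deriv (((hc2 (c (.inl i))).mul_const (z.1 (.inl i))).add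
        ((hs2 (c (.inl i))).mul_const (z.2 (.inl i)))) ?_; ring
    · simp only [flowFun, genFun, Pi.smul_apply, smul_eq_mul]
      exact (he _).mul_const _
    · have e := he (c (.inr (.inr (j, 1))))
      have s := hs (c (.inr (.inr (j, 0))))
      have o := hc (c (.inr (.inr (j, 0))))
      fin_cases k <;> simp only [flowFun, genFun, Pi.smul_apply, smul_eq_mul]
      · refine HasDerivAt.congr_deriv (e.mul ((o.mul_const (z.1 (.inr (.inr (j, 0))))).sub
          (s.mul_const (z.1 (.inr (.inr (j, 1))))))) ?_
        simp; ring
      · refine HasDerivAt.congr_deriv (e.mul ((o.mul_const (z.1 (.inr (.inr (j, 1))))).add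
          (s.mul_const (z.1 (.inr (.inr (j, 0))))))) ?_
        simp
  · rcases i with i | i | ⟨j, k⟩
    · simp only [flowFun, genFun, Pi.smul_apply, smul_eq_mul]
      refine HasDerivAt.congr_deriv (((hc2 (c (.inl i))).mul_const (z.2 (.inl i))).sub
        ((hs2 (c (.inl i))).mul_const (z.1 (.inl i)))) ?_; ring
    · simp only [flowFun, genFun, Pi.smul_apply, smul_eq_mul]
      refine HasDerivAt.congr_deriv ((he' (c (.inr (.inl i)))).mul_const (z.2 (.inr (.inl i)))) ?_; ring
    · have e := he' (c (.inr (.inr (j, 1))))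
      have s := hs (c (.inr (.inr (j, 0))))
      have o := hc (c (.inr (.inr (j, 0))))
      fin_cases k <;> simp only [flowFun, genFun, Pi.smul_apply, smul_eq_mul]
      · refine HasDerivAt.congr_deriv (e.mul ((o.mul_const (z.2 (.inr (.inr (j, 0))))).sub
          (s.mul_const (z.2 (.inr (.inr (j, 1))))))) ?_
        simp; ring
      · refine HasDerivAt.congr_deriv (e.mul ((o.mul_const (z.2 (.inr (.inr (j, 1))))).add
          (s.mul_const (z.2 (.inr (.inr (j, 0))))))) ?_
        simp

lemma hasDerivAt_flow (c : Idx ke kh kf → ℝ) (z : Phase ke kh kf) (t : ℝ) :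
    HasDerivAt (fun s : ℝ => flow (s • c) z) (gen c (flow (t • c) z)) t := by
  have h := hasDerivAt_flow_zero c (flow (t • c) z)
  have h1 : HasDerivAt (fun s : ℝ => s - t) 1 t := (hasDerivAt_id t).sub_const t
  have h2 := HasDerivAt.scomp (h := fun s : ℝ => s - t) (g₁ := fun s : ℝ => flow (s • c) (flow (t • c) z))
    t (by simpa using h) h1
  rw [one_smul] at h2
  convert! h2 using 1
  funext s
  simp only [Function.comp]
  rw [← flow_add, ← add_smul, sub_add_cancel]

/-- The derivative of `y ↦ flow (C y) (B y)`. -/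
lemma hasFDerivAt_flow_comp {E : Type*} [NormedAddCommGroup E] [NormedSpace ℝ E]
    {C : E → Idx ke kh kf → ℝ} {C' : E →L[ℝ] Idx ke kh kf → ℝ}
    {B : E → Phase ke kh kf} {B' : E →L[ℝ] Phase ke kh kf} {y : E}
    (hC : HasFDerivAt C C' y) (hB : HasFDerivAt B B' y) :
    HasFDerivAt (fun y => flow (C y) (B y))
      ((flow (C y)).comp B' + (gen.flip (flow (C y) (B y))).comp C') y := by
  set F : (Idx ke kh kf → ℝ) × Phase ke kh kf → Phase ke kh kf := fun q => flow q.1 q.2 with hF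
  have hd : HasFDerivAt F (fderiv ℝ F (C y, B y)) (C y, B y) :=
    ((contDiff_flow (n := 1)).differentiable (by simp) _).hasFDerivAt
  have h1 : ∀ v, fderiv ℝ F (C y, B y) (0, v) = flow (C y) v := fun v => by
    have e1 : HasFDerivAt (fun x => F (C y, x)) _ (B y) :=
      hd.comp (B y) (hasFDerivAt_prodMk_right (C y) (B y))
    have e2 : HasFDerivAt (fun x => F (C y, x)) (flow (C y)) (B y) := (flow (C y)).hasFDerivAt
    simpa using congrArg (fun L => L v) (e1.unique e2)
  have h2 : ∀ δ, fderiv ℝ F (C y, B y) (δ, 0) = gen δ (flow (C y) (B y)) := fun δ => by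
    have e0 : HasDerivAt (fun t : ℝ => (t • δ + C y, B y)) (δ, 0) 0 := by
      refine HasDerivAt.prodMk ?_ (hasDerivAt_const _ _)
      simpa using ((hasDerivAt_id (0 : ℝ)).smul_const δ).add_const (C y)
    have e1 : HasDerivAt (fun t : ℝ => F (t • δ + C y, B y)) (fderiv ℝ F (C y, B y) (δ, 0)) 0 :=
      HasFDerivAt.comp_hasDerivAt (l := F) (f := fun t : ℝ => (t • δ + C y, B y)) 0
        (by simpa using hd) e0
    have e2 := hasDerivAt_flow_zero δ (flow (C y) (B y))
    refine e1.unique ?_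
    convert! e2 using 1
    funext t
    exact flow_add _ _ _
  refine (hd.comp y (hC.prodMk hB)).congr_fderiv ?_
  ext1 v
  have : (C' v, B' v) = (0, B' v) + (C' v, 0) := by simp
  simp only [ContinuousLinearMap.comp_apply, add_apply,
    ContinuousLinearMap.prod_apply, ContinuousLinearMap.flip_apply]
  rw [this, map_add, h1, h2]

/-- A crude bound: an exponential is at most `3`, and a rotation at most doubles the sup norm. -/
lemma norm_flow_le {c : Idx ke kh kf → ℝ} (hc : ∀ i, |c i| ≤ 1) (z : Phase ke kh kf) :
    ‖flow c z‖ ≤ 6 * ‖z‖ := by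
  have hx : ∀ i, |z.1 i| ≤ ‖z‖ := fun i => (norm_le_pi_norm z.1 i).trans (norm_fst_le z)
  have hy : ∀ i, |z.2 i| ≤ ‖z‖ := fun i => (norm_le_pi_norm z.2 i).trans (norm_snd_le z)
  have he : ∀ x : ℝ, |x| ≤ 1 → Real.exp x ≤ 3 := fun x hx =>
    (Real.exp_le_exp.2 (abs_le.1 hx).2).trans (Real.exp_one_lt_three.le)
  have he' : ∀ x : ℝ, |x| ≤ 1 → Real.exp (-x) ≤ 3 := fun x hx => he _ (by rwa [abs_neg])
  have h0 := norm_nonneg z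
  have ha : ∀ a b x y : ℝ, |a| ≤ 1 → |b| ≤ 1 → |x| ≤ ‖z‖ → |y| ≤ ‖z‖ →
      |a * x + b * y| ≤ 2 * ‖z‖ := fun a b x y ha hb hx hy => by
    refine (abs_add_le _ _).trans ?_
    rw [abs_mul, abs_mul]
    nlinarith [abs_nonneg a, abs_nonneg b, abs_nonneg x, abs_nonneg y]
  have hs : ∀ a b x y : ℝ, |a| ≤ 1 → |b| ≤ 1 → |x| ≤ ‖z‖ → |y| ≤ ‖z‖ →
      |a * x - b * y| ≤ 2 * ‖z‖ := fun a b x y h1 h2 h3 h4 => by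
    have := ha a (-b) x y h1 (by rwa [abs_neg]) h3 h4
    rwa [neg_mul, ← sub_eq_add_neg] at this
  have hm : ∀ e w : ℝ, e ≤ 3 → 0 < e → |w| ≤ 2 * ‖z‖ → |e * w| ≤ 6 * ‖z‖ := fun e w h1 h2 h3 => by
    rw [abs_mul, abs_of_pos h2]
    nlinarith [abs_nonneg w]
  have hC := fun x => Real.abs_cos_le_one x
  have hS := fun x => Real.abs_sin_le_one x
  have h6 : 0 ≤ 6 * ‖z‖ := by positivity
  refine norm_prod_le_iff.2 ⟨(pi_norm_le_iff_of_nonneg h6).2 fun i => ?_,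
    (pi_norm_le_iff_of_nonneg h6).2 fun i => ?_⟩ <;> rw [Real.norm_eq_abs]
  · rcases i with i | i | ⟨j, k⟩
    · exact (ha _ _ _ _ (hC _) (hS _) (hx _) (hy _)).trans (by linarith)
    · exact hm _ _ (he _ (hc _)) (Real.exp_pos _) ((hx _).trans (by linarith))
    · fin_cases k
      · exact hm _ _ (he _ (hc _)) (Real.exp_pos _) (hs _ _ _ _ (hC _) (hS _) (hx _) (hx _))
      · exact hm _ _ (he _ (hc _)) (Real.exp_pos _) (ha _ _ _ _ (hC _) (hS _) (hx _) (hx _))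
  · rcases i with i | i | ⟨j, k⟩
    · exact (hs _ _ _ _ (hC _) (hS _) (hy _) (hx _)).trans (by linarith)
    · exact hm _ _ (he' _ (hc _)) (Real.exp_pos _) ((hy _).trans (by linarith))
    · fin_cases k
      · exact hm _ _ (he' _ (hc _)) (Real.exp_pos _) (hs _ _ _ _ (hC _) (hS _) (hy _) (hy _))
      · exact hm _ _ (he' _ (hc _)) (Real.exp_pos _) (ha _ _ _ _ (hC _) (hS _) (hy _) (hy _))

/-- On points with nonzero positions the flow acts freely, up to the periods of the rotations. -/
lemma eq_zero_of_flow_eq {c : Idx ke kh kf → ℝ} {z : Phase ke kh kf} (hz : ∀ i, z.1 i ≠ 0)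
    (hc : ∀ i, |c i| < 3) (h : flow c z = z) : c = 0 := by
  have rot : ∀ a x y : ℝ, x ≠ 0 → |a| < 6 → Real.cos a * x + Real.sin a * y = x →
      Real.cos a * y - Real.sin a * x = y → a = 0 := fun a x y hx ha h1 h2 => by
    have h3 : (Real.cos a - 1) * (x ^ 2 + y ^ 2) = 0 := by linear_combination x * h1 + y * h2
    have h4 : x ^ 2 + y ^ 2 ≠ 0 := by positivity
    have h5 : Real.cos a = 1 := by
      have := (mul_eq_zero.1 h3).resolve_right h4
      linarith
    have ha' := abs_lt.1 ha
    refine (Real.cos_eq_one_iff_of_lt_of_lt ?_ ?_).1 h5 <;> linarith [Real.pi_gt_three]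
  refine idx_ext (fun i => ?_) (fun i => ?_) (fun j => ?_) (fun j => ?_)
  · have h1 := congrFun (congrArg Prod.fst h) (.inl i)
    have h2 := congrFun (congrArg Prod.snd h) (.inl i)
    simp only [flow_apply, flowFun] at h1 h2
    have := rot _ _ _ (hz (.inl i)) (by rw [abs_mul]; norm_num; linarith [hc (.inl i)]) h1 h2
    simpa using this
  · have h1 := congrFun (congrArg Prod.fst h) (.inr (.inl i))
    simp only [flow_apply, flowFun] at h1
    have h2 : Real.exp (c (.inr (.inl i))) = 1 := by
      have := hz (.inr (.inl i))
      field_simp at h1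
      exact h1
    simpa using h2
  all_goals
    have h1 := congrFun (congrArg Prod.fst h) (.inr (.inr (j, 0)))
    have h2 := congrFun (congrArg Prod.fst h) (.inr (.inr (j, 1)))
    simp only [flow_apply, flowFun] at h1 h2
    set a := c (.inr (.inr (j, 0)))
    set e := c (.inr (.inr (j, 1)))
    set x := z.1 (.inr (.inr (j, 0))) with hxd
    set y := z.1 (.inr (.inr (j, 1)))
    have hx : x ≠ 0 := hz _
    have h3 : x ^ 2 + y ^ 2 ≠ 0 := by positivity
    have h4 : Real.exp e ^ 2 * (x ^ 2 + y ^ 2) = x ^ 2 + y ^ 2 := by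
      have h5 := Real.sin_sq_add_cos_sq a
      calc Real.exp e ^ 2 * (x ^ 2 + y ^ 2)
          = (Real.exp e * (Real.cos a * x - Real.sin a * y)) ^ 2
            + (Real.exp e * (Real.cos a * y + Real.sin a * x)) ^ 2 := by
              linear_combination (-(Real.exp e ^ 2 * (x ^ 2 + y ^ 2))) * h5
        _ = _ := by rw [h1, h2]
    have h5 : Real.exp e = 1 := by
      have h6 : Real.exp e ^ 2 = 1 := by
        have : (Real.exp e ^ 2 - 1) * (x ^ 2 + y ^ 2) = 0 := by linear_combination h4
        linarith [(mul_eq_zero.1 this).resolve_right h3]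
      have := Real.exp_pos e
      nlinarith
  · rw [h5] at h1 h2
    have := rot (-a) x y hx (by rw [abs_neg]; linarith [hc (.inr (.inr (j, 0)))])
      (by rw [Real.cos_neg, Real.sin_neg]; linarith) (by rw [Real.cos_neg, Real.sin_neg]; linarith)
    simpa using this
  · simpa using h5

lemma eq_of_flow_eq {c c' : Idx ke kh kf → ℝ} {z : Phase ke kh kf} (hz : ∀ i, z.1 i ≠ 0)
    (hc : ∀ i, |c i - c' i| < 3) (h : flow c z = flow c' z) : c = c' := by
  have : flow (c - c') z = z := by
    rw [sub_eq_add_neg, flow_add, flow_comm, h, flow_neg_flow]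
  exact sub_eq_zero.1 (eq_zero_of_flow_eq hz (by simpa using hc) this)

/-- The points with nonzero positions are dense. -/
lemma frequently_regular (z : Phase ke kh kf) : ∃ᶠ y in 𝓝 z, ∀ i, y.1 i ≠ 0 := by
  have h1 : ContinuousAt (fun t : ℝ => z + t • ((fun _ => 1, 0) : Phase ke kh kf)) 0 := by fun_prop
  have h2 : Tendsto (fun t : ℝ => z + t • ((fun _ => 1, 0) : Phase ke kh kf)) (𝓝[≠] 0) (𝓝 z) := by
    have := h1.tendsto.mono_left (nhdsWithin_le_nhds (s := {0}ᶜ))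
    simpa using this
  refine h2.frequently (Eventually.frequently ?_)
  simp only [Prod.fst_add, Prod.smul_fst, Pi.add_apply, Pi.smul_apply, smul_eq_mul, mul_one]
  refine eventually_all.2 fun i => ?_
  by_cases hi : z.1 i = 0
  · filter_upwards [self_mem_nhdsWithin] with t ht
    simpa [hi] using ht
  · have : ContinuousAt (fun t : ℝ => z.1 i + t) 0 := by fun_prop
    have h3 := this.eventually_ne (by simpa using hi)
    exact h3.filter_mono nhdsWithin_le_nhds

/-- Continuous maps which agree at the nearby points with nonzero positions agree. -/
lemma eq_of_eq_regular {Y : Type*} [TopologicalSpace Y] [T2Space Y] {f f' : Phase ke kh kf → Y}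
    {z : Phase ke kh kf} (hf : ContinuousAt f z) (hf' : ContinuousAt f' z)
    (h : ∀ᶠ y in 𝓝 z, (∀ i, y.1 i ≠ 0) → f y = f' y) : f z = f' z :=
  tendsto_nhds_unique_of_frequently_eq hf hf'
    (((frequently_regular z).and_eventually h).mono fun _ hy => hy.2 hy.1)

/-! ### Maps preserving the system commute with the linear flows -/

/-- The derivative of a map preserving the system intertwines the Hamiltonian vector fields of the
components of the moment map. -/
lemma PreservesSystem.fderiv_gen {R : Phase ke kh kf → Phase ke kh kf} {O : Set (Phase ke kh kf)}
    (hO : IsOpen O) (hR : PreservesSystem R O) {z : Phase ke kh kf} (hz : z ∈ O)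
    (hd : DifferentiableAt ℝ R z) (c : Idx ke kh kf → ℝ) :
    fderiv ℝ R z (gen c z) = gen c (R z) := by
  have hω : ∀ u v, omegaL (fderiv ℝ R z u) (fderiv ℝ R z v) = omegaL u v := hR.1 z hz
  have hinj : Function.Injective (fderiv ℝ R z) := by
    intro u u' huu
    refine eq_of_omegaL_eq fun v => ?_
    rw [← hω, huu, hω]
  have hsurj : Function.Surjective (fderiv ℝ R z) :=
    (LinearMap.injective_iff_surjective (f := (fderiv ℝ R z : Phase ke kh kf →ₗ[ℝ] _))).1 hinj
  refine eq_of_omegaL_eq fun w => ?_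
  obtain ⟨v, rfl⟩ := hsurj w
  rw [hω, ← sum_mul_fderiv_momentMap, ← sum_mul_fderiv_momentMap]
  have e1 : HasFDerivAt (fun y => momentMap (R y))
      ((fderiv ℝ momentMap (R z)).comp (fderiv ℝ R z)) z :=
    (hasFDerivAt_momentMap (R z)).comp z hd.hasFDerivAt
  have e2 : HasFDerivAt (fun y => momentMap (R y)) (fderiv ℝ momentMap z) z :=
    (hasFDerivAt_momentMap z).congr_of_eventuallyEq
      (Filter.Eventually.mono (hO.mem_nhds hz) fun y hy => hR.2 y hy)
  rw [e2.unique e1]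
  rfl

/-- A map whose derivative intertwines `gen c` along an orbit intertwines the flows. -/
lemma map_flow_eq_flow_map {R : Phase ke kh kf → Phase ke kh kf} {c : Idx ke kh kf → ℝ}
    {z : Phase ke kh kf}
    (hd : ∀ t ∈ Icc (0 : ℝ) 1, DifferentiableAt ℝ R (flow (t • c) z))
    (hg : ∀ t ∈ Icc (0 : ℝ) 1, fderiv ℝ R (flow (t • c) z) (gen c (flow (t • c) z)) =
      gen c (R (flow (t • c) z))) : R (flow c z) = flow c (R z) := by
  have key : ∀ t ∈ Icc (0 : ℝ) 1,
      HasDerivAt (fun s : ℝ => flow (s • (-c)) (R (flow (s • c) z))) 0 t := fun t ht => by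
    have h1 : HasFDerivAt (fun s : ℝ => s • (-c))
        ((ContinuousLinearMap.id ℝ ℝ).smulRight (-c)) t :=
      ((ContinuousLinearMap.id ℝ ℝ).smulRight (-c)).hasFDerivAt
    have h2 : HasDerivAt (fun s : ℝ => R (flow (s • c) z)) _ t :=
      (hd t ht).hasFDerivAt.comp_hasDerivAt t (hasDerivAt_flow c z t)
    rw [hg t ht] at h2
    refine (hasFDerivAt_flow_comp h1 h2.hasFDerivAt).hasDerivAt.congr_deriv ?_
    simp [← gen_flow]
  have hconst := constant_of_has_deriv_right_zero (a := (0 : ℝ)) (b := 1)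
    (f := fun s : ℝ => flow (s • (-c)) (R (flow (s • c) z)))
    (fun t ht => (key t ht).continuousAt.continuousWithinAt)
    (fun t ht => (key t (Ico_subset_Icc_self ht)).hasDerivWithinAt) 1 ⟨zero_le_one, le_rfl⟩
  simp only [one_smul, zero_smul, flow_zero] at hconst
  rw [← hconst, flow_flow_neg]

/-! ### The exponents of a map preserving the system -/

/-- If `C'` is the derivative of `C` at `z`, this says that the one-form `∑ i, C i • dh i` is closed
at `z`: recall that `dh i` is the contraction of the symplectic form with `X_{h i}`. -/
def IsClosedAt (C' : Phase ke kh kf →L[ℝ] Idx ke kh kf → ℝ) (z : Phase ke kh kf) : Prop :=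
  ∀ u v, omegaL (gen (C' u) z) v = omegaL (gen (C' v) z) u

/-- The symplectic form changes under `z ↦ flow (C z) z` by the differential of `∑ i, C i • dh i`. -/
lemma omegaL_fderiv_flow {C : Phase ke kh kf → Idx ke kh kf → ℝ} {z : Phase ke kh kf}
    {C' : Phase ke kh kf →L[ℝ] Idx ke kh kf → ℝ} (hC : HasFDerivAt C C' z)
    (u v : Phase ke kh kf) :
    omegaL (fderiv ℝ (fun y => flow (C y) y) z u) (fderiv ℝ (fun y => flow (C y) y) z v) =
      omegaL u v + (omegaL (gen (C' u) z) v - omegaL (gen (C' v) z) u) := by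
  have h := (hasFDerivAt_flow_comp hC (hasFDerivAt_id z)).fderiv
  simp only [id] at h
  rw [h]
  simp only [add_apply, ContinuousLinearMap.comp_apply,
    ContinuousLinearMap.flip_apply, map_add, ContinuousLinearMap.id_apply, gen_flow,
    omegaL_flow_flow, omegaL_gen_gen]
  rw [omegaL_swap u (gen (C' v) z)]
  ring

/-! ### The exponents, and the elliptic and hyperbolic factors -/

/-- The point `z` with the two coordinates of index `i` multiplied by `s`. -/
def blk (i : Idx ke kh kf) (s : ℝ) (z : Phase ke kh kf) : Phase ke kh kf :=
  z + (s - 1) • (Pi.single i (z.1 i), Pi.single i (z.2 i))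

lemma blk_one (i : Idx ke kh kf) (z : Phase ke kh kf) : blk i 1 z = z := by simp [blk]

lemma blk_zero_right (i : Idx ke kh kf) (s : ℝ) : blk i s (0 : Phase ke kh kf) = 0 := by simp [blk]

lemma blk_fst_self (i : Idx ke kh kf) (s : ℝ) (z : Phase ke kh kf) :
    (blk i s z).1 i = s * z.1 i := by
  simp [blk]; ring

lemma blk_snd_self (i : Idx ke kh kf) (s : ℝ) (z : Phase ke kh kf) :
    (blk i s z).2 i = s * z.2 i := by
  simp [blk]; ring

lemma norm_blk_le (i : Idx ke kh kf) {s : ℝ} (hs : s ∈ Icc (0 : ℝ) 1) (z : Phase ke kh kf) :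
    ‖blk i s z‖ ≤ ‖z‖ := by
  have hx : ∀ i, |z.1 i| ≤ ‖z‖ := fun i => (norm_le_pi_norm z.1 i).trans (norm_fst_le z)
  have hy : ∀ i, |z.2 i| ≤ ‖z‖ := fun i => (norm_le_pi_norm z.2 i).trans (norm_snd_le z)
  have h1 : ∀ x : ℝ, |x| ≤ ‖z‖ → |s * x| ≤ ‖z‖ := fun x hx => by
    rw [abs_mul, abs_of_nonneg hs.1]
    nlinarith [hs.2, abs_nonneg x]
  refine norm_prod_le_iff.2 ⟨(pi_norm_le_iff_of_nonneg (norm_nonneg _)).2 fun k => ?_,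
    (pi_norm_le_iff_of_nonneg (norm_nonneg _)).2 fun k => ?_⟩ <;> rw [Real.norm_eq_abs]
  · by_cases hk : k = i
    · subst hk; rw [blk_fst_self]; exact h1 _ (hx _)
    · simpa [blk, hk] using hx k
  · by_cases hk : k = i
    · subst hk; rw [blk_snd_self]; exact h1 _ (hy _)
    · simpa [blk, hk] using hy k

lemma contDiff_blk {n : ℕ∞ω} (i : Idx ke kh kf) :
    ContDiff ℝ n fun q : ℝ × Phase ke kh kf => blk i q.1 q.2 := by
  have h : ∀ z : Phase ke kh kf, ((Pi.single i (z.1 i), Pi.single i (z.2 i)) : Phase ke kh kf) =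
      z.1 i • (Pi.single i 1, 0) + z.2 i • (0, Pi.single i 1) := fun z => by
    simp [← Pi.single_smul]
  simp only [blk, h]
  fun_prop

lemma hasDerivAt_blk (i : Idx ke kh kf) (z : Phase ke kh kf) (s : ℝ) :
    HasDerivAt (fun s => blk i s z) (Pi.single i (z.1 i), Pi.single i (z.2 i)) s := by
  simpa [blk] using (((hasDerivAt_id s).sub_const 1).smul_const
    ((Pi.single i (z.1 i), Pi.single i (z.2 i)) : Phase ke kh kf)).const_add z

/-- The partial derivative of the `i`-th position component of `R` along `xᵢ`. -/
noncomputable def dxx (R : Phase ke kh kf → Phase ke kh kf) (i : Idx ke kh kf)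
    (z : Phase ke kh kf) : ℝ := (fderiv ℝ R z (Pi.single i 1, 0)).1 i

/-- The partial derivative of the `i`-th momentum component of `R` along `yᵢ`. -/
noncomputable def dyy (R : Phase ke kh kf → Phase ke kh kf) (i : Idx ke kh kf)
    (z : Phase ke kh kf) : ℝ := (fderiv ℝ R z (0, Pi.single i 1)).2 i

/-- The partial derivative of the `i`-th position component of `R` along `yᵢ`. -/
noncomputable def dxy (R : Phase ke kh kf → Phase ke kh kf) (i : Idx ke kh kf)
    (z : Phase ke kh kf) : ℝ := (fderiv ℝ R z (0, Pi.single i 1)).1 i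

/-- The partial derivative of the `i`-th momentum component of `R` along `xᵢ`. -/
noncomputable def dyx (R : Phase ke kh kf → Phase ke kh kf) (i : Idx ke kh kf)
    (z : Phase ke kh kf) : ℝ := (fderiv ℝ R z (Pi.single i 1, 0)).2 i

/-- Real part of the complex factor by which `R` multiplies the elliptic coordinate `xᵢ + i yᵢ`. -/
noncomputable def ellA (R : Phase ke kh kf → Phase ke kh kf) (i : Fin ke)
    (z : Phase ke kh kf) : ℝ :=
  ∫ s in (0 : ℝ)..1, s * (dxx R (.inl i) (blk (.inl i) s z) + dyy R (.inl i) (blk (.inl i) s z))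

/-- Imaginary part of the complex factor by which `R` multiplies the elliptic coordinate
`xᵢ + i yᵢ`. -/
noncomputable def ellB (R : Phase ke kh kf → Phase ke kh kf) (i : Fin ke)
    (z : Phase ke kh kf) : ℝ :=
  ∫ s in (0 : ℝ)..1, s * (dyx R (.inl i) (blk (.inl i) s z) - dxy R (.inl i) (blk (.inl i) s z))

/-- The factor by which `R` multiplies the hyperbolic coordinate `xᵢ`. -/
noncomputable def hypU (R : Phase ke kh kf → Phase ke kh kf) (i : Fin kh)
    (z : Phase ke kh kf) : ℝ :=
  ∫ s in (0 : ℝ)..1, 2 * s * dxx R (.inr (.inl i)) (blk (.inr (.inl i)) s z)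

/-- The unit vector in the direction of the first position of a focus-focus pair. -/
def focusDir (j : Fin kf) : Phase ke kh kf := (Pi.single (.inr (.inr (j, 0))) 1, 0)

/-- Real part of the complex factor by which `R` multiplies the focus-focus coordinate
`x_{j,0} + i x_{j,1}`. The limit makes sense of the quotient where this coordinate vanishes. -/
noncomputable def focusA (R : Phase ke kh kf → Phase ke kh kf) (j : Fin kf)
    (z : Phase ke kh kf) : ℝ :=
  limUnder (𝓝[>] (0 : ℝ)) fun t =>
    ((R (z + t • focusDir j)).1 (.inr (.inr (j, 0))) * (z.1 (.inr (.inr (j, 0))) + t)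
      + (R (z + t • focusDir j)).1 (.inr (.inr (j, 1))) * z.1 (.inr (.inr (j, 1))))
    / ((z.1 (.inr (.inr (j, 0))) + t) ^ 2 + z.1 (.inr (.inr (j, 1))) ^ 2)

/-- Imaginary part of the complex factor by which `R` multiplies the focus-focus coordinate
`x_{j,0} + i x_{j,1}`. -/
noncomputable def focusB (R : Phase ke kh kf → Phase ke kh kf) (j : Fin kf)
    (z : Phase ke kh kf) : ℝ :=
  limUnder (𝓝[>] (0 : ℝ)) fun t =>
    ((R (z + t • focusDir j)).1 (.inr (.inr (j, 1))) * (z.1 (.inr (.inr (j, 0))) + t)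
      - (R (z + t • focusDir j)).1 (.inr (.inr (j, 0))) * z.1 (.inr (.inr (j, 1))))
    / ((z.1 (.inr (.inr (j, 0))) + t) ^ 2 + z.1 (.inr (.inr (j, 1))) ^ 2)

/-- The exponents `c` with `R z = flow c z`, for a map `R` preserving the system with linear part
the identity. They are the logarithms of the factors by which `R` multiplies the coordinates; the
formulas are meaningful where the real parts of these factors are positive. -/
noncomputable def coef (R : Phase ke kh kf → Phase ke kh kf) (z : Phase ke kh kf) :
    Idx ke kh kf → ℝ
  | .inl i => -(1 / 2) * Real.arctan (ellB R i z / ellA R i z)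
  | .inr (.inl i) => Real.log (hypU R i z)
  | .inr (.inr (j, 0)) => Real.arctan (focusB R j z / focusA R j z)
  | .inr (.inr (j, 1)) => 1 / 2 * Real.log (focusA R j z ^ 2 + focusB R j z ^ 2)

section Single

variable {R : Phase ke kh kf → Phase ke kh kf} {ε : ℝ}

/-- `R` is a `C¹` map on the ball of radius `ε` preserving the system, with fixed point `0` and
linear part the identity. -/
structure IsUnipotentOn (R : Phase ke kh kf → Phase ke kh kf) (ε : ℝ) : Prop where
  contDiffOn : ContDiffOn ℝ 1 R (Metric.ball 0 ε)
  preserves : PreservesSystem R (Metric.ball 0 ε)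
  map_zero : R 0 = 0
  fderiv_zero : fderiv ℝ R 0 = ContinuousLinearMap.id ℝ _

lemma IsUnipotentOn.differentiableAt (h : IsUnipotentOn R ε) {z : Phase ke kh kf}
    (hz : z ∈ Metric.ball 0 ε) : DifferentiableAt ℝ R z :=
  (h.contDiffOn.contDiffAt (Metric.isOpen_ball.mem_nhds hz)).differentiableAt (by simp)

lemma IsUnipotentOn.fderiv_gen (h : IsUnipotentOn R ε) {z : Phase ke kh kf}
    (hz : z ∈ Metric.ball 0 ε) (c : Idx ke kh kf → ℝ) : fderiv ℝ R z (gen c z) = gen c (R z) :=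
  h.preserves.fderiv_gen Metric.isOpen_ball hz (h.differentiableAt hz) c

lemma IsUnipotentOn.map_flow (h : IsUnipotentOn R ε) {z : Phase ke kh kf} {c : Idx ke kh kf → ℝ}
    (hz : ∀ t ∈ Icc (0 : ℝ) 1, flow (t • c) z ∈ Metric.ball 0 ε) :
    R (flow c z) = flow c (R z) :=
  map_flow_eq_flow_map (fun t ht => h.differentiableAt (hz t ht))
    fun t ht => h.fderiv_gen (hz t ht) c

lemma IsUnipotentOn.mem_blk {z : Phase ke kh kf} (hz : z ∈ Metric.ball 0 ε) (i : Idx ke kh kf)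
    {s : ℝ} (hs : s ∈ Icc (0 : ℝ) 1) : blk i s z ∈ Metric.ball 0 ε := by
  rw [mem_ball_zero_iff] at hz ⊢
  exact (norm_blk_le i hs z).trans_lt hz

lemma IsUnipotentOn.continuousOn_fderiv_blk (h : IsUnipotentOn R ε) {z : Phase ke kh kf}
    (hz : z ∈ Metric.ball 0 ε) (i : Idx ke kh kf) (v : Phase ke kh kf) :
    ContinuousOn (fun s => fderiv ℝ R (blk i s z) v) (uIcc 0 1) := by
  rw [uIcc_of_le zero_le_one]
  have h1 : ContinuousOn (fderiv ℝ R) (Metric.ball 0 ε) :=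
    h.contDiffOn.continuousOn_fderiv_of_isOpen Metric.isOpen_ball le_rfl
  have h2 : Continuous fun s => blk i s z :=
    ((contDiff_blk (n := 1) i).continuous).comp (Continuous.prodMk_left z)
  exact (h1.comp h2.continuousOn fun s hs => mem_blk hz i hs).clm_apply continuousOn_const

/-- The derivative of `R ∘ blk` in terms of the partial derivatives. -/
lemma IsUnipotentOn.hasDerivAt_map_blk (h : IsUnipotentOn R ε) {z : Phase ke kh kf}
    (hz : z ∈ Metric.ball 0 ε) (i : Idx ke kh kf) {s : ℝ} (hs : s ∈ Icc (0 : ℝ) 1) :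
    HasDerivAt (fun s => R (blk i s z))
      (z.1 i • fderiv ℝ R (blk i s z) (Pi.single i 1, 0)
        + z.2 i • fderiv ℝ R (blk i s z) (0, Pi.single i 1)) s := by
  have h1 := (h.differentiableAt (mem_blk hz i hs)).hasFDerivAt.comp_hasDerivAt s
    (hasDerivAt_blk i z s)
  refine h1.congr_deriv ?_
  rw [← map_smul, ← map_smul, ← map_add]
  congr 1
  simp [← Pi.single_smul]

lemma gen_single_inl (i : Fin ke) (w : Phase ke kh kf) :
    gen (Pi.single (.inl i) 1) w = (2 * w.2 (.inl i)) • (Pi.single (.inl i) 1, 0)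
      - (2 * w.1 (.inl i)) • (0, Pi.single (.inl i) 1) := by
  apply phase_ext <;> intro k <;> simp [gen_apply, genFun, Pi.single_apply]
  · split_ifs with h <;> simp [h]
  · split_ifs with h <;> simp [h]

lemma gen_single_inr_inl (i : Fin kh) (w : Phase ke kh kf) :
    gen (Pi.single (.inr (.inl i)) 1) w = w.1 (.inr (.inl i)) • (Pi.single (.inr (.inl i)) 1, 0)
      - w.2 (.inr (.inl i)) • (0, Pi.single (.inr (.inl i)) 1) := by
  apply phase_ext <;> intro k <;> simp [gen_apply, genFun, Pi.single_apply]
  · split_ifs with h <;> simp [h]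
  · split_ifs with h <;> simp [h]

/-- In an elliptic block `R` is the multiplication of `xᵢ + i yᵢ` by a complex factor. By equivariance
under the rotation, the derivative in `s` of `s R(blk i s z)` is the product of `xᵢ + i yᵢ` with the
integrand of the factor. -/
lemma IsUnipotentOn.elliptic (h : IsUnipotentOn R ε) {z : Phase ke kh kf}
    (hz : z ∈ Metric.ball 0 ε) (i : Fin ke) :
    (R z).1 (.inl i) = ellA R i z * z.1 (.inl i) - ellB R i z * z.2 (.inl i) ∧
    (R z).2 (.inl i) = ellB R i z * z.1 (.inl i) + ellA R i z * z.2 (.inl i) := by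
  set k : Idx ke kh kf := .inl i with hk
  have hcx := h.continuousOn_fderiv_blk hz k (Pi.single k 1, 0)
  have hcy := h.continuousOn_fderiv_blk hz k (0, Pi.single k 1)
  have c1 : ContinuousOn (fun s => dxx R k (blk k s z)) (uIcc 0 1) :=
    (continuous_apply k).comp_continuousOn hcx.fst
  have c2 : ContinuousOn (fun s => dyx R k (blk k s z)) (uIcc 0 1) :=
    (continuous_apply k).comp_continuousOn hcx.snd
  have c3 : ContinuousOn (fun s => dxy R k (blk k s z)) (uIcc 0 1) :=
    (continuous_apply k).comp_continuousOn hcy.fst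
  have c4 : ContinuousOn (fun s => dyy R k (blk k s z)) (uIcc 0 1) :=
    (continuous_apply k).comp_continuousOn hcy.snd
  have i1 : IntervalIntegrable (fun s => s * (dxx R k (blk k s z) + dyy R k (blk k s z)))
      volume 0 1 := (continuousOn_id.mul (c1.add c4)).intervalIntegrable
  have i2 : IntervalIntegrable (fun s => s * (dyx R k (blk k s z) - dxy R k (blk k s z)))
      volume 0 1 := (continuousOn_id.mul (c2.sub c3)).intervalIntegrable
  -- infinitesimal equivariance under the rotation
  have heq : ∀ s ∈ Icc (0 : ℝ) 1,
      s * (z.2 k * dxx R k (blk k s z) - z.1 k * dxy R k (blk k s z)) = (R (blk k s z)).2 k ∧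
      s * (z.2 k * dyx R k (blk k s z) - z.1 k * dyy R k (blk k s z)) = -(R (blk k s z)).1 k := by
    intro s hs
    have e := h.fderiv_gen (mem_blk hz k hs) (Pi.single k 1)
    rw [gen_single_inl, ← hk, map_sub, map_smul, map_smul, blk_fst_self, blk_snd_self, gen_apply] at e
    have e1 := congrFun (congrArg Prod.fst e) k
    have e2 := congrFun (congrArg Prod.snd e) k
    simp only [Prod.fst_sub, Prod.snd_sub, Prod.smul_fst, Prod.smul_snd, Pi.sub_apply,
      Pi.smul_apply, smul_eq_mul, genFun, hk, Pi.single_eq_same] at e1 e2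
    simp only [dxx, dyy, dxy, dyx, hk]
    constructor <;> linarith
  have d1 : ∀ s ∈ uIcc (0 : ℝ) 1, HasDerivAt (fun s => s * (R (blk k s z)).1 k)
      (s * (dxx R k (blk k s z) + dyy R k (blk k s z)) * z.1 k
        - s * (dyx R k (blk k s z) - dxy R k (blk k s z)) * z.2 k) s := by
    intro s hs
    rw [uIcc_of_le zero_le_one] at hs
    have e := hasDerivAt_pi.1 (h.hasDerivAt_map_blk hz k hs).fst k
    refine ((hasDerivAt_id s).mul e).congr_deriv ?_
    have := (heq s hs).2
    simp only [dxx, dyy, dxy, dyx] at this ⊢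
    simp only [Prod.fst_add, Prod.smul_fst, Pi.add_apply, Pi.smul_apply, smul_eq_mul, id]
    linarith
  have d2 : ∀ s ∈ uIcc (0 : ℝ) 1, HasDerivAt (fun s => s * (R (blk k s z)).2 k)
      (s * (dyx R k (blk k s z) - dxy R k (blk k s z)) * z.1 k
        + s * (dxx R k (blk k s z) + dyy R k (blk k s z)) * z.2 k) s := by
    intro s hs
    rw [uIcc_of_le zero_le_one] at hs
    have e := hasDerivAt_pi.1 (h.hasDerivAt_map_blk hz k hs).snd k
    refine ((hasDerivAt_id s).mul e).congr_deriv ?_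
    have := (heq s hs).1
    simp only [dxx, dyy, dxy, dyx] at this ⊢
    simp only [Prod.snd_add, Prod.smul_snd, Pi.add_apply, Pi.smul_apply, smul_eq_mul, id]
    linarith
  have f1 := intervalIntegral.integral_eq_sub_of_hasDerivAt d1
    ((i1.mul_const _).sub (i2.mul_const _))
  have f2 := intervalIntegral.integral_eq_sub_of_hasDerivAt d2
    ((i2.mul_const _).add (i1.mul_const _))
  rw [intervalIntegral.integral_sub (i1.mul_const _) (i2.mul_const _),
    intervalIntegral.integral_mul_const, intervalIntegral.integral_mul_const, blk_one] at f1
  rw [intervalIntegral.integral_add (i2.mul_const _) (i1.mul_const _),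
    intervalIntegral.integral_mul_const, intervalIntegral.integral_mul_const, blk_one] at f2
  simp only [ellA, ellB, ← hk]
  constructor <;> linarith

/-- In a hyperbolic block `R` multiplies the position by a real factor, for the same reason as in
`IsUnipotentOn.elliptic`. -/
lemma IsUnipotentOn.hyperbolic (h : IsUnipotentOn R ε) {z : Phase ke kh kf}
    (hz : z ∈ Metric.ball 0 ε) (i : Fin kh) :
    (R z).1 (.inr (.inl i)) = hypU R i z * z.1 (.inr (.inl i)) := by
  set k : Idx ke kh kf := .inr (.inl i) with hk
  have hcx := h.continuousOn_fderiv_blk hz k (Pi.single k 1, 0)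
  have c1 : ContinuousOn (fun s => dxx R k (blk k s z)) (uIcc 0 1) :=
    (continuous_apply k).comp_continuousOn hcx.fst
  have i1 : IntervalIntegrable (fun s => 2 * s * dxx R k (blk k s z)) volume 0 1 :=
    ((by fun_prop : ContinuousOn (fun s : ℝ => 2 * s) (uIcc 0 1)).mul c1).intervalIntegrable
  -- infinitesimal equivariance under the hyperbolic flow
  have heq : ∀ s ∈ Icc (0 : ℝ) 1,
      s * (z.1 k * dxx R k (blk k s z) - z.2 k * dxy R k (blk k s z)) = (R (blk k s z)).1 k := by
    intro s hs
    have e := h.fderiv_gen (mem_blk hz k hs) (Pi.single k 1)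
    rw [gen_single_inr_inl, ← hk, map_sub, map_smul, map_smul, blk_fst_self, blk_snd_self,
      gen_apply] at e
    have e1 := congrFun (congrArg Prod.fst e) k
    simp only [Prod.fst_sub, Prod.smul_fst, Pi.sub_apply,
      Pi.smul_apply, smul_eq_mul, genFun, hk, Pi.single_eq_same] at e1
    simp only [dxx, dxy, hk]
    linarith
  have d1 : ∀ s ∈ uIcc (0 : ℝ) 1, HasDerivAt (fun s => s * (R (blk k s z)).1 k)
      (2 * s * dxx R k (blk k s z) * z.1 k) s := by
    intro s hs
    rw [uIcc_of_le zero_le_one] at hs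
    have e := hasDerivAt_pi.1 (h.hasDerivAt_map_blk hz k hs).fst k
    refine ((hasDerivAt_id s).mul e).congr_deriv ?_
    have := heq s hs
    simp only [dxx, dxy] at this ⊢
    simp only [Prod.fst_add, Prod.smul_fst, Pi.add_apply, Pi.smul_apply, smul_eq_mul, id]
    linarith
  have f1 := intervalIntegral.integral_eq_sub_of_hasDerivAt d1 (i1.mul_const _)
  rw [intervalIntegral.integral_mul_const, blk_one] at f1
  simp only [hypU, ← hk]
  linarith

end Single

/-! ### The focus-focus factors -/

/-- The point of the section `x_{j,0} = 2ε`, `x_{j,1} = 0` lying on the orbit of `z` under the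
flows of the focus-focus pair `j`. The formula makes sense, and is polynomial, also where the
positions of the pair vanish; this gives the smoothness of the focus-focus factors there. -/
noncomputable def focusSec (ε : ℝ) (j : Fin kf) (z : Phase ke kh kf) : Phase ke kh kf :=
  z + ((2 * ε - z.1 (.inr (.inr (j, 0)))) • (Pi.single (.inr (.inr (j, 0))) 1, 0)
    + (-z.1 (.inr (.inr (j, 1)))) • (Pi.single (.inr (.inr (j, 1))) 1, 0)
    + ((z.1 (.inr (.inr (j, 0))) * z.2 (.inr (.inr (j, 0)))
      + z.1 (.inr (.inr (j, 1))) * z.2 (.inr (.inr (j, 1)))) / (2 * ε)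
        - z.2 (.inr (.inr (j, 0)))) • (0, Pi.single (.inr (.inr (j, 0))) 1)
    + ((z.1 (.inr (.inr (j, 0))) * z.2 (.inr (.inr (j, 1)))
      - z.1 (.inr (.inr (j, 1))) * z.2 (.inr (.inr (j, 0)))) / (2 * ε)
        - z.2 (.inr (.inr (j, 1)))) • (0, Pi.single (.inr (.inr (j, 1))) 1))

lemma contDiff_focusSec {n : ℕ∞ω} (ε : ℝ) (j : Fin kf) :
    ContDiff ℝ n (focusSec ε j : Phase ke kh kf → Phase ke kh kf) := by
  unfold focusSec
  fun_prop

lemma focusSec_zero (ε : ℝ) (j : Fin kf) :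
    focusSec ε j (0 : Phase ke kh kf) = (2 * ε) • focusDir j := by
  simp [focusSec, focusDir]

lemma abs_coord_lt {z : Phase ke kh kf} {ε : ℝ} (hz : z ∈ Metric.ball 0 ε) (i : Idx ke kh kf) :
    |z.1 i| < ε ∧ |z.2 i| < ε := by
  rw [mem_ball_zero_iff] at hz
  exact ⟨((norm_le_pi_norm z.1 i).trans (norm_fst_le z)).trans_lt hz,
    ((norm_le_pi_norm z.2 i).trans (norm_snd_le z)).trans_lt hz⟩

lemma mem_ball_of_abs_lt {z : Phase ke kh kf} {ε : ℝ} (hε : 0 < ε)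
    (h1 : ∀ i, |z.1 i| < ε) (h2 : ∀ i, |z.2 i| < ε) : z ∈ Metric.ball 0 ε := by
  rw [mem_ball_zero_iff]
  exact max_lt ((pi_norm_lt_iff hε).2 h1) ((pi_norm_lt_iff hε).2 h2)

lemma focusSec_mem {z : Phase ke kh kf} {ε : ℝ} (hε : 0 < ε) (hz : z ∈ Metric.ball 0 ε)
    (j : Fin kf) : focusSec ε j z ∈ Metric.ball 0 (4 * ε) := by
  have hc := abs_coord_lt hz
  have hm : ∀ x y x' y' : ℝ, |x| < ε → |y| < ε → |x'| < ε → |y'| < ε →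
      |(x * y + x' * y') / (2 * ε)| < 4 * ε := fun x y x' y' h1 h2 h3 h4 => by
    rw [abs_div, abs_of_pos (show 0 < 2 * ε by linarith), div_lt_iff₀ (by linarith)]
    refine (abs_add_le _ _).trans_lt ?_
    rw [abs_mul, abs_mul]
    nlinarith [abs_nonneg x, abs_nonneg y, abs_nonneg x', abs_nonneg y']
  have h0 := hc (.inr (.inr (j, 0)))
  have h1 := hc (.inr (.inr (j, 1)))
  refine mem_ball_of_abs_lt (by linarith) (fun i => ?_) (fun i => ?_)
  · have hi := (hc i).1
    by_cases e0 : i = .inr (.inr (j, 0))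
    · subst e0
      simp [focusSec]
      rw [abs_of_pos hε]; linarith
    · by_cases e1 : i = .inr (.inr (j, 1))
      · subst e1
        simp [focusSec]; linarith
      · simp [focusSec, e0, e1]; linarith
  · have hi := (hc i).2
    by_cases e0 : i = .inr (.inr (j, 0))
    · subst e0
      simpa [focusSec] using hm _ _ _ _ h0.1 h0.2 h1.1 h1.2
    · by_cases e1 : i = .inr (.inr (j, 1))
      · subst e1
        have := hm (z.1 (.inr (.inr (j, 0)))) (z.2 (.inr (.inr (j, 1))))
          (-z.1 (.inr (.inr (j, 1)))) (z.2 (.inr (.inr (j, 0)))) h0.1 h1.2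
          (by rw [abs_neg]; exact h1.1) h0.2
        simpa [focusSec, sub_eq_add_neg] using this
      · simp [focusSec, e0, e1]; linarith

set_option maxHeartbeats 1000000 in
/-- On the orbits of the focus-focus flow the complex factor of `R` is determined by its value at
the section. -/
lemma IsUnipotentOn.focus_section {R : Phase ke kh kf → Phase ke kh kf} {ε : ℝ} (hε : 0 < ε)
    (h : IsUnipotentOn R (4 * ε)) {z : Phase ke kh kf} (hz : z ∈ Metric.ball 0 ε) (j : Fin kf)
    (hne : z.1 (.inr (.inr (j, 0))) ≠ 0 ∨ z.1 (.inr (.inr (j, 1))) ≠ 0) :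
    (R z).1 (.inr (.inr (j, 0))) * z.1 (.inr (.inr (j, 0)))
      + (R z).1 (.inr (.inr (j, 1))) * z.1 (.inr (.inr (j, 1))) =
      (R (focusSec ε j z)).1 (.inr (.inr (j, 0))) / (2 * ε) *
        (z.1 (.inr (.inr (j, 0))) ^ 2 + z.1 (.inr (.inr (j, 1))) ^ 2) ∧
    (R z).1 (.inr (.inr (j, 1))) * z.1 (.inr (.inr (j, 0)))
      - (R z).1 (.inr (.inr (j, 0))) * z.1 (.inr (.inr (j, 1))) =
      (R (focusSec ε j z)).1 (.inr (.inr (j, 1))) / (2 * ε) *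
        (z.1 (.inr (.inr (j, 0))) ^ 2 + z.1 (.inr (.inr (j, 1))) ^ 2) := by
  have hc := abs_coord_lt hz
  obtain ⟨hx0, hy0⟩ := hc (.inr (.inr (j, 0)))
  obtain ⟨hx1, hy1⟩ := hc (.inr (.inr (j, 1)))
  set x0 := z.1 (.inr (.inr (j, 0))) with hx0d
  set x1 := z.1 (.inr (.inr (j, 1))) with hx1d
  -- polar coordinates of `x0 + i x1`
  obtain ⟨ρ, θ, hρ, e0, e1⟩ : ∃ ρ θ : ℝ, 0 < ρ ∧ x0 = ρ * Real.cos θ ∧ x1 = ρ * Real.sin θ := by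
    have hw : (⟨x0, x1⟩ : ℂ) ≠ 0 := by
      intro hw
      have := Complex.ext_iff.1 hw
      simp at this
      exact hne.elim (fun h => h this.1) (fun h => h this.2)
    refine ⟨‖(⟨x0, x1⟩ : ℂ)‖, Complex.arg ⟨x0, x1⟩, norm_pos_iff.2 hw, ?_, ?_⟩
    · simp
    · simp
  have hsc := Real.sin_sq_add_cos_sq θ
  have hρ2 : ρ ^ 2 = x0 ^ 2 + x1 ^ 2 := by rw [e0, e1]; linear_combination (-(ρ ^ 2)) * hsc
  have hρε : ρ ≤ 2 * ε := by
    have h1 := sq_lt_sq' (abs_lt.1 hx0).1 (abs_lt.1 hx0).2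
    have h2 := sq_lt_sq' (abs_lt.1 hx1).1 (abs_lt.1 hx1).2
    nlinarith
  set L := Real.log (2 * ε / ρ) with hL
  have hL0 : 0 ≤ L := Real.log_nonneg (by rw [le_div_iff₀ hρ]; linarith)
  have hLe : Real.exp L = 2 * ε / ρ := Real.exp_log (by positivity)
  have hLe' : Real.exp (-L) = ρ / (2 * ε) := by rw [Real.exp_neg, hLe, inv_div]
  -- the flow by `c` carries `z` to the section
  set c : Idx ke kh kf → ℝ :=
    Pi.single (.inr (.inr (j, 0))) (-θ) + Pi.single (.inr (.inr (j, 1))) L with hcd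
  have c0 : c (.inr (.inr (j, 0))) = -θ := by simp [hcd]
  have c1 : c (.inr (.inr (j, 1))) = L := by simp [hcd]
  have co : ∀ i, i ≠ .inr (.inr (j, 0)) → i ≠ .inr (.inr (j, 1)) → c i = 0 := fun i h0 h1 => by
    simp [hcd, h0, h1]
  have hflow : flow c z = focusSec ε j z := by
    have hεne : ε ≠ 0 := hε.ne'
    have hρne : ρ ≠ 0 := hρ.ne'
    rw [flow_apply]
    apply phase_ext <;> intro i
    · simp [flowFun, co, focusSec]
    · simp [flowFun, co, focusSec]
    · simp [flowFun, co, focusSec]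
    · simp [flowFun, co, focusSec]
    all_goals
      by_cases hij : i = j
      · subst hij
        simp only [flowFun, c0, c1, focusSec, hLe, hLe', Real.cos_neg, Real.sin_neg]
        simp [← hx0d, ← hx1d]
        rw [e0, e1]
        first
          | (field_simp; linear_combination hsc)
          | (field_simp; linear_combination (2 * ε) * hsc)
          | (right; ring)
          | (field_simp; done)
          | ring
      · simp [flowFun, co, focusSec, hij]
  have hpath : ∀ t ∈ Icc (0 : ℝ) 1, flow (t • c) z ∈ Metric.ball 0 (4 * ε) := by
    intro t ht
    have hab : ∀ e a x y : ℝ, 0 < e → |e * (Real.cos a * x - Real.sin a * y)| ≤ e * (|x| + |y|) ∧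
        |e * (Real.cos a * x + Real.sin a * y)| ≤ e * (|x| + |y|) := fun e a x y he => by
      have h1 := Real.abs_cos_le_one a
      have h2 := Real.abs_sin_le_one a
      rw [abs_mul, abs_mul, abs_of_pos he]
      constructor
      · gcongr
        refine (abs_sub _ _).trans ?_
        rw [abs_mul, abs_mul]
        nlinarith [abs_nonneg x, abs_nonneg y]
      · gcongr
        refine (abs_add_le _ _).trans ?_
        rw [abs_mul, abs_mul]
        nlinarith [abs_nonneg x, abs_nonneg y]
    have het : Real.exp (t * L) * ρ ≤ 2 * ε := by
      have : Real.exp (t * L) ≤ Real.exp L := Real.exp_le_exp.2 (by nlinarith [ht.2])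
      calc _ ≤ Real.exp L * ρ := by gcongr
        _ = 2 * ε := by rw [hLe]; field_simp
    have hxy : |x0| + |x1| ≤ 3 / 2 * ρ := by
      have : (|x0| + |x1|) ^ 2 ≤ (3 / 2 * ρ) ^ 2 := by
        nlinarith [sq_abs x0, sq_abs x1, sq_nonneg (|x0| - |x1|), sq_nonneg ρ]
      exact (sq_le_sq₀ (by positivity) (by positivity)).1 this
    have hX : Real.exp (t * L) * (|x0| + |x1|) < 4 * ε := by
      calc _ ≤ Real.exp (t * L) * (3 / 2 * ρ) := by gcongr
        _ < 4 * ε := by linarith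
    have hX' : Real.exp (t * L) * (|x1| + |x0|) < 4 * ε := by rwa [add_comm |x1|]
    have hem : Real.exp (-(t * L)) ≤ 1 := by
      rw [Real.exp_le_one_iff]; nlinarith [ht.1]
    have hem0 := Real.exp_pos (-(t * L))
    set y0 := z.2 (.inr (.inr (j, 0))) with hy0d
    set y1 := z.2 (.inr (.inr (j, 1))) with hy1d
    have hY : Real.exp (-(t * L)) * (|y0| + |y1|) < 4 * ε := by
      calc _ ≤ 1 * (|y0| + |y1|) := by gcongr
        _ < 4 * ε := by linarith
    have hY' : Real.exp (-(t * L)) * (|y1| + |y0|) < 4 * ε := by rwa [add_comm |y1|]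
    refine mem_ball_of_abs_lt (by linarith) (fun i => ?_) (fun i => ?_)
    · rw [flow_apply]
      rcases i with i | i | ⟨i, k⟩
      · simp [flowFun, co]; linarith [(hc (.inl i)).1]
      · simp [flowFun, co]; linarith [(hc (.inr (.inl i))).1]
      · by_cases hij : i = j
        · subst hij
          fin_cases k
          · simp only [flowFun, Pi.smul_apply, smul_eq_mul, c0, c1, Fin.zero_eta]
            exact (hab _ _ _ _ (Real.exp_pos _)).1.trans_lt hX
          · simp only [flowFun, Pi.smul_apply, smul_eq_mul, c0, c1, Fin.mk_one]
            exact (hab _ _ _ _ (Real.exp_pos _)).2.trans_lt hX'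
        · fin_cases k
          · simp [flowFun, co, hij]; linarith [(hc (.inr (.inr (i, 0)))).1]
          · simp [flowFun, co, hij]; linarith [(hc (.inr (.inr (i, 1)))).1]
    · rw [flow_apply]
      rcases i with i | i | ⟨i, k⟩
      · simp [flowFun, co]; linarith [(hc (.inl i)).2]
      · simp [flowFun, co]; linarith [(hc (.inr (.inl i))).2]
      · by_cases hij : i = j
        · subst hij
          fin_cases k
          · simp only [flowFun, Pi.smul_apply, smul_eq_mul, c0, c1, Fin.zero_eta]
            exact (hab _ _ _ _ (Real.exp_pos _)).1.trans_lt hY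
          · simp only [flowFun, Pi.smul_apply, smul_eq_mul, c0, c1, Fin.mk_one]
            exact (hab _ _ _ _ (Real.exp_pos _)).2.trans_lt hY'
        · fin_cases k
          · simp [flowFun, co, hij]; linarith [(hc (.inr (.inr (i, 0)))).2]
          · simp [flowFun, co, hij]; linarith [(hc (.inr (.inr (i, 1)))).2]
  have hR := h.map_flow hpath
  rw [hflow] at hR
  rw [hR, flow_apply]
  simp only [flowFun, c0, c1, hLe, Real.cos_neg, Real.sin_neg, ← hρ2]
  rw [e0, e1]
  constructor
  · field_simp; ring
  · field_simp; ring

/-- The limits defining the focus-focus factors exist, and are the values of `R` on the section. -/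
lemma IsUnipotentOn.focus_tendsto {R : Phase ke kh kf → Phase ke kh kf} {ε : ℝ} (hε : 0 < ε)
    (h : IsUnipotentOn R (4 * ε)) {z : Phase ke kh kf} (hz : z ∈ Metric.ball 0 ε) (j : Fin kf) :
    focusA R j z = (R (focusSec ε j z)).1 (.inr (.inr (j, 0))) / (2 * ε) ∧
    focusB R j z = (R (focusSec ε j z)).1 (.inr (.inr (j, 1))) / (2 * ε) := by
  have hcl : Continuous fun t : ℝ => z + t • (focusDir j : Phase ke kh kf) := by fun_prop
  have hev : ∀ᶠ t : ℝ in 𝓝[>] 0, z + t • focusDir j ∈ Metric.ball 0 ε ∧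
      z.1 (.inr (.inr (j, 0))) + t ≠ 0 := by
    refine Eventually.and ?_ ?_
    · refine Eventually.filter_mono nhdsWithin_le_nhds ?_
      exact hcl.continuousAt.eventually (Metric.isOpen_ball.mem_nhds (by simpa using hz))
    · by_cases hi : z.1 (.inr (.inr (j, 0))) = 0
      · filter_upwards [self_mem_nhdsWithin] with t ht
        simpa [hi] using ne_of_gt ht
      · have : ContinuousAt (fun t : ℝ => z.1 (.inr (.inr (j, 0))) + t) 0 := by fun_prop
        exact (this.eventually_ne (by simpa using hi)).filter_mono nhdsWithin_le_nhds
  have hcont : ContinuousAt (fun t : ℝ => R (focusSec ε j (z + t • focusDir j))) 0 := by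
    have h1 : ContinuousAt R (focusSec ε j z) :=
      (h.differentiableAt (focusSec_mem hε hz j)).continuousAt
    have h2 : ContinuousAt (fun t : ℝ => focusSec ε j (z + t • focusDir j)) 0 :=
      ((contDiff_focusSec (n := 1) ε j).continuous.comp hcl).continuousAt
    exact ContinuousAt.comp (g := R) (by simpa using h1) h2
  have hlim : ∀ k : Fin 2, Tendsto
      (fun t : ℝ => (R (focusSec ε j (z + t • focusDir j))).1 (.inr (.inr (j, k))) / (2 * ε)) (𝓝[>] 0)
      (𝓝 ((R (focusSec ε j z)).1 (.inr (.inr (j, k))) / (2 * ε))) := fun k => by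
    have h1 : ContinuousAt (fun t : ℝ =>
        (R (focusSec ε j (z + t • focusDir j))).1 (.inr (.inr (j, k))) / (2 * ε)) 0 :=
      (((continuous_apply (Sum.inr (Sum.inr (j, k)) : Idx ke kh kf)).comp
        continuous_fst).continuousAt.comp hcont).div_const _
    have := h1.tendsto.mono_left (nhdsWithin_le_nhds (s := Ioi 0))
    simpa using this
  have e : ∀ t : ℝ, (z + t • (focusDir j : Phase ke kh kf)).1 (.inr (.inr (j, 0)))
      = z.1 (.inr (.inr (j, 0))) + t ∧ (z + t • (focusDir j : Phase ke kh kf)).1 (.inr (.inr (j, 1)))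
      = z.1 (.inr (.inr (j, 1))) := fun t => by simp [focusDir]
  constructor
  · refine ((hlim 0).congr' ?_).limUnder_eq
    filter_upwards [hev] with t ⟨ht, hne⟩
    have := (h.focus_section hε ht j (Or.inl (by rw [(e t).1]; exact hne))).1
    rw [(e t).1, (e t).2] at this
    rw [this, mul_div_cancel_right₀]
    positivity
  · refine ((hlim 1).congr' ?_).limUnder_eq
    filter_upwards [hev] with t ⟨ht, hne⟩
    have := (h.focus_section hε ht j (Or.inl (by rw [(e t).1]; exact hne))).2
    rw [(e t).1, (e t).2] at this
    rw [this, mul_div_cancel_right₀]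
    positivity

lemma IsUnipotentOn.focus {R : Phase ke kh kf → Phase ke kh kf} {ε : ℝ} (hε : 0 < ε)
    (h : IsUnipotentOn R (4 * ε)) {z : Phase ke kh kf} (hz : z ∈ Metric.ball 0 ε) (j : Fin kf)
    (hne : z.1 (.inr (.inr (j, 0))) ≠ 0) :
    (R z).1 (.inr (.inr (j, 0))) = focusA R j z * z.1 (.inr (.inr (j, 0)))
      - focusB R j z * z.1 (.inr (.inr (j, 1))) ∧
    (R z).1 (.inr (.inr (j, 1))) = focusA R j z * z.1 (.inr (.inr (j, 1)))
      + focusB R j z * z.1 (.inr (.inr (j, 0))) := by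
  obtain ⟨h1, h2⟩ := h.focus_section hε hz j (Or.inl hne)
  rw [← (h.focus_tendsto hε hz j).1] at h1
  rw [← (h.focus_tendsto hε hz j).2] at h2
  have h3 : z.1 (.inr (.inr (j, 0))) ^ 2 + z.1 (.inr (.inr (j, 1))) ^ 2 ≠ 0 := by positivity
  constructor
  · refine mul_left_cancel₀ h3 ?_
    linear_combination z.1 (.inr (.inr (j, 0))) * h1 - z.1 (.inr (.inr (j, 1))) * h2
  · refine mul_left_cancel₀ h3 ?_
    linear_combination z.1 (.inr (.inr (j, 1))) * h1 + z.1 (.inr (.inr (j, 0))) * h2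

/-! ### Recovering a map from its exponents -/

lemma _root_.ContinuousAt.flow {E : Type*} [TopologicalSpace E] {C : E → Idx ke kh kf → ℝ}
    {B : E → Phase ke kh kf} {y : E} (hC : ContinuousAt C y) (hB : ContinuousAt B y) :
    ContinuousAt (fun y => LinearSystem.flow (C y) (B y)) y :=
  ContinuousAt.comp (x := y) (f := fun y => (C y, B y))
    (g := fun q : (Idx ke kh kf → ℝ) × Phase ke kh kf => LinearSystem.flow q.1 q.2)
    (contDiff_flow (n := 1)).continuous.continuousAt (hC.prodMk hB)

lemma _root_.ContDiffAt.flow {E : Type*} [NormedAddCommGroup E] [NormedSpace ℝ E] {n : ℕ∞ω}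
    {C : E → Idx ke kh kf → ℝ} {B : E → Phase ke kh kf} {y : E} (hC : ContDiffAt ℝ n C y)
    (hB : ContDiffAt ℝ n B y) : ContDiffAt ℝ n (fun y => LinearSystem.flow (C y) (B y)) y :=
  ContDiffAt.comp y (f := fun y => (C y, B y))
    (g := fun q : (Idx ke kh kf → ℝ) × Phase ke kh kf => LinearSystem.flow q.1 q.2)
    contDiff_flow.contDiffAt (hC.prodMk hB)

lemma cos_arctan_div {a b : ℝ} (ha : 0 < a) (h : a ^ 2 + b ^ 2 = 1) :
    Real.cos (Real.arctan (b / a)) = a ∧ Real.sin (Real.arctan (b / a)) = b := by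
  have h1 : Real.sqrt (1 + (b / a) ^ 2) = 1 / a := by
    rw [Real.sqrt_eq_iff_eq_sq (by positivity) (by positivity)]
    field_simp; linarith
  rw [Real.cos_arctan, Real.sin_arctan, h1]
  constructor <;> field_simp

lemma exp_log_arctan {a b : ℝ} (ha : 0 < a) :
    Real.exp (1 / 2 * Real.log (a ^ 2 + b ^ 2)) * Real.cos (Real.arctan (b / a)) = a ∧
    Real.exp (1 / 2 * Real.log (a ^ 2 + b ^ 2)) * Real.sin (Real.arctan (b / a)) = b := by
  have hpos : 0 < a ^ 2 + b ^ 2 := by positivity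
  have h0 : Real.exp (1 / 2 * Real.log (a ^ 2 + b ^ 2)) = Real.sqrt (a ^ 2 + b ^ 2) := by
    rw [Real.sqrt_eq_rpow, Real.rpow_def_of_pos hpos, mul_comm]
  have h1 : Real.sqrt (1 + (b / a) ^ 2) = Real.sqrt (a ^ 2 + b ^ 2) / a := by
    rw [Real.sqrt_eq_iff_eq_sq (by positivity) (by positivity), div_pow (Real.sqrt _),
      Real.sq_sqrt hpos.le]
    field_simp
  have h2 : Real.sqrt (a ^ 2 + b ^ 2) ≠ 0 := (Real.sqrt_pos.2 hpos).ne'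
  rw [Real.cos_arctan, Real.sin_arctan, h0, h1]
  constructor <;> field_simp

/-- The exponents recover `R`: the factors give the elliptic coordinates and all positions, and the
values of the moment map then give the remaining momenta. -/
lemma IsUnipotentOn.eq_flow_coef_of_regular {R : Phase ke kh kf → Phase ke kh kf} {ε : ℝ}
    (hε : 0 < ε) (h : IsUnipotentOn R (4 * ε)) {z : Phase ke kh kf} (hz : z ∈ Metric.ball 0 ε)
    (hreg : ∀ i, z.1 i ≠ 0) (h1 : ∀ i, 0 < ellA R i z) (h2 : ∀ i, 0 < hypU R i z)
    (h3 : ∀ j, 0 < focusA R j z) : R z = flow (coef R z) z := by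
  have hz4 : z ∈ Metric.ball 0 (4 * ε) := Metric.ball_subset_ball (by linarith) hz
  have hm : momentMap (R z) = momentMap (flow (coef R z) z) := by
    rw [momentMap_flow, h.preserves.2 z hz4]
  have hell : ∀ i, (flow (coef R z) z).1 (.inl i) = (R z).1 (.inl i) ∧
      (flow (coef R z) z).2 (.inl i) = (R z).2 (.inl i) := fun i => by
    obtain ⟨e1, e2⟩ := h.elliptic hz4 i
    have hx := hreg (.inl i)
    have e3 : ellA R i z ^ 2 + ellB R i z ^ 2 = 1 := by
      have := congrFun (h.preserves.2 z hz4) (.inl i)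
      simp only [momentMap, e1, e2] at this
      have hne : z.1 (.inl i) ^ 2 + z.2 (.inl i) ^ 2 ≠ 0 := by positivity
      refine mul_right_cancel₀ hne ?_
      linear_combination this
    obtain ⟨e4, e5⟩ := cos_arctan_div (h1 i) e3
    have e6 : 2 * (-(1 / 2) * Real.arctan (ellB R i z / ellA R i z)) =
      -Real.arctan (ellB R i z / ellA R i z) := by ring
    rw [e1, e2]
    simp only [flow_apply, flowFun, coef, e6, Real.cos_neg, Real.sin_neg, e4, e5]
    constructor <;> ring
  have hpos : (flow (coef R z) z).1 = (R z).1 := by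
    refine idx_ext (fun i => (hell i).1) (fun i => ?_) (fun j => ?_) (fun j => ?_)
    · rw [h.hyperbolic hz4 i]
      simp only [flow_apply, flowFun, coef, Real.exp_log (h2 i)]
    · rw [(h.focus hε hz j (hreg _)).1]
      obtain ⟨e1, e2⟩ := exp_log_arctan (b := focusB R j z) (h3 j)
      simp only [flow_apply, flowFun, coef]
      linear_combination z.1 (.inr (.inr (j, 0))) * e1 - z.1 (.inr (.inr (j, 1))) * e2
    · rw [(h.focus hε hz j (hreg _)).2]
      obtain ⟨e1, e2⟩ := exp_log_arctan (b := focusB R j z) (h3 j)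
      simp only [flow_apply, flowFun, coef]
      linear_combination z.1 (.inr (.inr (j, 1))) * e1 + z.1 (.inr (.inr (j, 0))) * e2
  refine phase_ext (fun i => (hell i).1.symm) (fun i => (hell i).2.symm) (fun i => by rw [hpos])
    (fun i => ?_) (fun i => by rw [hpos]) (fun i => by rw [hpos]) (fun j => ?_) (fun j => ?_)
  · have := congrFun hm (.inr (.inl i))
    have hne : (R z).1 (.inr (.inl i)) ≠ 0 := by
      rw [h.hyperbolic hz4 i]; exact mul_ne_zero (h2 i).ne' (hreg _)
    simp only [momentMap, hpos] at this
    exact mul_left_cancel₀ hne this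
  all_goals
    have e0 := congrFun hm (.inr (.inr (j, 0)))
    have e1 := congrFun hm (.inr (.inr (j, 1)))
    simp only [momentMap, hpos] at e0 e1
    have hne : (R z).1 (.inr (.inr (j, 0))) ^ 2 + (R z).1 (.inr (.inr (j, 1))) ^ 2 ≠ 0 := by
      obtain ⟨f1, f2⟩ := h.focus hε hz j (hreg _)
      have : (R z).1 (.inr (.inr (j, 0))) ^ 2 + (R z).1 (.inr (.inr (j, 1))) ^ 2 =
          (focusA R j z ^ 2 + focusB R j z ^ 2) *
            (z.1 (.inr (.inr (j, 0))) ^ 2 + z.1 (.inr (.inr (j, 1))) ^ 2) := by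
        rw [f1, f2]; ring
      rw [this]
      have := h3 j
      have := hreg (.inr (.inr (j, 0)))
      positivity
    refine mul_left_cancel₀ hne ?_
  · linear_combination (R z).1 (.inr (.inr (j, 0))) * e1 - (R z).1 (.inr (.inr (j, 1))) * e0
  · linear_combination (R z).1 (.inr (.inr (j, 1))) * e1 + (R z).1 (.inr (.inr (j, 0))) * e0

/-! ### The factors at the origin -/

lemma IsUnipotentOn.ellA_zero {R : Phase ke kh kf → Phase ke kh kf} {ε : ℝ}
    (h : IsUnipotentOn R ε) (i : Fin ke) : ellA R i 0 = 1 ∧ ellB R i 0 = 0 := by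
  simp only [ellA, ellB, blk_zero_right, dxx, dyy, dyx, dxy, h.fderiv_zero]
  constructor
  · simp; norm_num
  · simp

lemma IsUnipotentOn.hypU_zero {R : Phase ke kh kf → Phase ke kh kf} {ε : ℝ}
    (h : IsUnipotentOn R ε) (i : Fin kh) : hypU R i 0 = 1 := by
  simp only [hypU, blk_zero_right, dxx, h.fderiv_zero]
  simp only [ContinuousLinearMap.id_apply, Pi.single_eq_same, mul_one]
  rw [intervalIntegral.integral_const_mul, integral_id]
  norm_num

lemma IsUnipotentOn.focus_zero {R : Phase ke kh kf → Phase ke kh kf} {ε : ℝ} (hε : 0 < ε)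
    (h : IsUnipotentOn R (4 * ε)) (j : Fin kf) : focusA R j 0 = 1 ∧ focusB R j 0 = 0 := by
  have h0 : (0 : Phase ke kh kf) ∈ Metric.ball 0 ε := Metric.mem_ball_self hε
  obtain ⟨e1, e2⟩ := h.focus_tendsto hε h0 j
  rw [focusSec_zero] at e1 e2
  set p : Phase ke kh kf := (2 * ε) • focusDir j with hp
  -- `R` is homogeneous along the ray through `p`, hence equal to its linear part there
  have hfl : ∀ L : ℝ, flow (Pi.single (.inr (.inr (j, 1))) L) (focusDir j : Phase ke kh kf) =
      Real.exp L • focusDir j := fun L => by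
    rw [flow_apply]
    apply phase_ext <;> intro i <;> simp [flowFun, focusDir, Pi.single_apply]
    split_ifs with hij
    · simp
    · rfl
  have hhom : ∀ t : ℝ, 0 < t → t ≤ 1 → R (t • p) = flow (Pi.single (.inr (.inr (j, 1)))
      (Real.log t)) (R p) := fun t ht ht1 => by
    have e : flow (Pi.single (.inr (.inr (j, 1))) (Real.log t)) p = t • p := by
      rw [hp, map_smul, hfl, Real.exp_log ht, smul_comm]
    rw [← e]
    refine h.map_flow fun s hs => ?_
    have e' : s • (Pi.single (.inr (.inr (j, 1))) (Real.log t) : Idx ke kh kf → ℝ) =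
        Pi.single (.inr (.inr (j, 1))) (s * Real.log t) := by
      rw [← Pi.single_smul, smul_eq_mul]
    have hexp : Real.exp (s * Real.log t) ≤ 1 := by
      rw [Real.exp_le_one_iff]
      exact mul_nonpos_of_nonneg_of_nonpos hs.1 (Real.log_nonpos ht.le ht1)
    rw [e', hp, map_smul, hfl, mem_ball_zero_iff, norm_smul, norm_smul, Real.norm_eq_abs,
      Real.norm_eq_abs, abs_of_pos (Real.exp_pos _), abs_of_pos (by linarith : 0 < 2 * ε)]
    have hn : ‖(focusDir j : Phase ke kh kf)‖ ≤ 1 := by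
      refine norm_prod_le_iff.2 ⟨(pi_norm_le_iff_of_nonneg zero_le_one).2 fun i => ?_, by
        simp [focusDir]⟩
      simp only [focusDir, Pi.single_apply]
      split_ifs <;> simp
    calc 2 * ε * (Real.exp (s * Real.log t) * ‖(focusDir j : Phase ke kh kf)‖)
        ≤ 2 * ε * (1 * 1) := by gcongr
      _ < 4 * ε := by linarith
  have hd : HasDerivAt (fun t : ℝ => R (t • p)) p 0 := by
    have h1 : HasDerivAt (fun t : ℝ => t • p) p 0 := by
      simpa using (hasDerivAt_id (0 : ℝ)).smul_const p
    have h2 : HasFDerivAt R (fderiv ℝ R 0) ((0 : ℝ) • p) := by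
      rw [zero_smul]
      exact (h.differentiableAt (Metric.mem_ball_self (by linarith))).hasFDerivAt
    have := h2.comp_hasDerivAt 0 h1
    rw [h.fderiv_zero] at this
    exact this
  have hk : ∀ k : Fin 2, (R p).1 (.inr (.inr (j, k))) = p.1 (.inr (.inr (j, k))) := fun k => by
    have hdk := hasDerivAt_pi.1 hd.fst (.inr (.inr (j, k)))
    have hs := (hasDerivAt_iff_tendsto_slope.1 hdk).mono_left
      (nhdsWithin_mono (0 : ℝ) (s := Ioi 0) (t := {0}ᶜ) fun t ht => ne_of_gt ht)
    refine tendsto_nhds_unique (tendsto_const_nhds.congr' ?_) hs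
    filter_upwards [Ioc_mem_nhdsGT (zero_lt_one' ℝ)] with t ht
    have hcc : (flow (Pi.single (.inr (.inr (j, 1))) (Real.log t)) (R p)).1 (.inr (.inr (j, k)))
        = t * (R p).1 (.inr (.inr (j, k))) := by
      rw [flow_apply]
      fin_cases k <;> simp [flowFun, Real.exp_log ht.1]
    have ht0 := ht.1.ne'
    simp only [slope, zero_smul, h.map_zero, hhom t ht.1 ht.2, hcc, sub_zero, vsub_eq_sub,
      Prod.fst_zero, Pi.zero_apply, smul_eq_mul]
    field_simp
  rw [e1, e2, hk, hk]
  constructor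
  · simp [hp, focusDir, hε.ne']
  · simp [hp, focusDir]

/-! ### Joint smoothness of the exponents -/

section Family

variable {𝔸 : Type} [NormedAddCommGroup 𝔸] [NormedSpace ℝ 𝔸]
  {R : 𝔸 → Phase ke kh kf → Phase ke kh kf} {N : Set 𝔸} {ρ : ℝ} {r : ℕ∞ω}

lemma contDiffAt_fderiv_blk (hr : r = ∞ ∨ r = ω) (hN : IsOpen N)
    (hR : ContDiffOn ℝ r (fun q : 𝔸 × Phase ke kh kf => R q.1 q.2) (N ×ˢ Metric.ball 0 ρ))
    {a : 𝔸} (ha : a ∈ N) {z : Phase ke kh kf} (hz : z ∈ Metric.ball 0 ρ) (i : Idx ke kh kf)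
    {s : ℝ} (hs : s ∈ Icc (0 : ℝ) 1) (v : Phase ke kh kf) :
    ContDiffAt ℝ r (fun w : ℝ × (𝔸 × Phase ke kh kf) =>
      fderiv ℝ (R w.2.1) (blk i w.1 w.2.2) v) (s, (a, z)) := by
  have hb : ContDiff ℝ r fun w : ℝ × (𝔸 × Phase ke kh kf) => blk i w.1 w.2.2 :=
    (contDiff_blk i).comp (contDiff_fst.prodMk contDiff_snd.snd)
  have hmem : (a, blk i s z) ∈ N ×ˢ Metric.ball (0 : Phase ke kh kf) ρ :=
    ⟨ha, IsUnipotentOn.mem_blk hz i hs⟩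
  have h1 : ContDiffAt ℝ r (fun q : 𝔸 × Phase ke kh kf => R q.1 q.2) (a, blk i s z) :=
    hR.contDiffAt ((hN.prod Metric.isOpen_ball).mem_nhds hmem)
  have h2 : ContDiffAt ℝ r (Function.uncurry fun w : ℝ × (𝔸 × Phase ke kh kf) => R w.2.1)
      ((s, (a, z)), blk i s z) :=
    ContDiffAt.comp (g := fun q : 𝔸 × Phase ke kh kf => R q.1 q.2)
      (f := fun u : (ℝ × (𝔸 × Phase ke kh kf)) × Phase ke kh kf => (u.1.2.1, u.2))
      ((s, (a, z)), blk i s z) h1 (by fun_prop)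
  have h3 : ContDiffAt ℝ r (fun w : ℝ × (𝔸 × Phase ke kh kf) =>
      fderiv ℝ (R w.2.1) (blk i w.1 w.2.2)) (s, (a, z)) :=
    ContDiffAt.fderiv (f := fun w : ℝ × (𝔸 × Phase ke kh kf) => R w.2.1)
      (g := fun w => blk i w.1 w.2.2) h2 hb.contDiffAt (by rcases hr with rfl | rfl <;> simp)
  exact h3.clm_apply contDiffAt_const

/-- Integrals over the unit interval of jointly `C^r` functions are `C^r` in the parameters. -/
lemma contDiffAt_intervalIntegral {X Y : Type} [NormedAddCommGroup X] [NormedSpace ℝ X]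
    [NormedAddCommGroup Y] [NormedSpace ℝ Y] [CompleteSpace Y] (hr : r = ∞ ∨ r = ω)
    {F : ℝ → X → Y} {x : X}
    (hF : ∀ s ∈ Icc (0 : ℝ) 1, ContDiffAt ℝ r (fun w : ℝ × X => F w.1 w.2) (s, x)) :
    ContDiffAt ℝ r (fun x => ∫ s in (0 : ℝ)..1, F s x) x := by
  simp only [intervalIntegral.integral_of_le zero_le_one]
  refine ParamIntegral.contDiffAt_integral (𝔸 := ℝ) hr (isCompact_Icc (a := (0 : ℝ)) (b := 1))
    ((ae_restrict_mem measurableSet_Ioc).mono fun s hs => Ioc_subset_Icc_self hs) fun s hs => ?_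
  exact ⟨id, fun w => F w.1 w.2, Eventually.of_forall fun _ => continuousAt_id, hF s hs,
    Eventually.of_forall fun _ => rfl⟩

/-- The exponents of a family of maps preserving the system, with linear parts the identity, are
small, jointly `C^r`, and satisfy `R z = flow (coef R z) z` close to the origin. -/
theorem eventually_coef {ε : ℝ} (hr : r = ∞ ∨ r = ω) (hN : IsOpen N) (hε : 0 < ε)
    (hR : ContDiffOn ℝ r (fun q : 𝔸 × Phase ke kh kf => R q.1 q.2) (N ×ˢ Metric.ball 0 (4 * ε)))
    (hu : ∀ a ∈ N, IsUnipotentOn (R a) (4 * ε)) {a₀ : 𝔸} (ha₀ : a₀ ∈ N) :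
    ∀ᶠ q in 𝓝 (a₀, (0 : Phase ke kh kf)),
      ContDiffAt ℝ r (fun q : 𝔸 × Phase ke kh kf => coef (R q.1) q.2) q ∧
      (∀ i, |coef (R q.1) q.2 i| < 1 / 4) ∧ R q.1 q.2 = flow (coef (R q.1) q.2) q.2 := by
  have hO : IsOpen (N ×ˢ Metric.ball (0 : Phase ke kh kf) ε) := hN.prod Metric.isOpen_ball
  have h0 : (a₀, (0 : Phase ke kh kf)) ∈ N ×ˢ Metric.ball (0 : Phase ke kh kf) ε :=
    ⟨ha₀, Metric.mem_ball_self hε⟩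
  have hsub : Metric.ball (0 : Phase ke kh kf) ε ⊆ Metric.ball 0 (4 * ε) :=
    Metric.ball_subset_ball (by linarith)
  have hpx : ∀ k : Idx ke kh kf, ContDiff ℝ r fun z : Phase ke kh kf => z.1 k := fun k => by fun_prop
  have hpy : ∀ k : Idx ke kh kf, ContDiff ℝ r fun z : Phase ke kh kf => z.2 k := fun k => by fun_prop
  have sA : ∀ q ∈ N ×ˢ Metric.ball (0 : Phase ke kh kf) ε, ∀ i,
      ContDiffAt ℝ r (fun q : 𝔸 × Phase ke kh kf => ellA (R q.1) i q.2) q := fun q hq i =>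
    contDiffAt_intervalIntegral hr fun s hs => contDiffAt_fst.mul
      (((hpx _).contDiffAt.comp _
        (contDiffAt_fderiv_blk hr hN hR hq.1 (hsub hq.2) (.inl i) hs _)).add
      ((hpy _).contDiffAt.comp _
        (contDiffAt_fderiv_blk hr hN hR hq.1 (hsub hq.2) (.inl i) hs _)))
  have sB : ∀ q ∈ N ×ˢ Metric.ball (0 : Phase ke kh kf) ε, ∀ i,
      ContDiffAt ℝ r (fun q : 𝔸 × Phase ke kh kf => ellB (R q.1) i q.2) q := fun q hq i =>
    contDiffAt_intervalIntegral hr fun s hs => contDiffAt_fst.mul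
      (((hpy _).contDiffAt.comp _
        (contDiffAt_fderiv_blk hr hN hR hq.1 (hsub hq.2) (.inl i) hs _)).sub
      ((hpx _).contDiffAt.comp _
        (contDiffAt_fderiv_blk hr hN hR hq.1 (hsub hq.2) (.inl i) hs _)))
  have sU : ∀ q ∈ N ×ˢ Metric.ball (0 : Phase ke kh kf) ε, ∀ i,
      ContDiffAt ℝ r (fun q : 𝔸 × Phase ke kh kf => hypU (R q.1) i q.2) q := fun q hq i =>
    contDiffAt_intervalIntegral hr fun s hs => (contDiffAt_const.mul contDiffAt_fst).mul
      ((hpx _).contDiffAt.comp _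
        (contDiffAt_fderiv_blk hr hN hR hq.1 (hsub hq.2) (.inr (.inl i)) hs _))
  have sec : ∀ q ∈ N ×ˢ Metric.ball (0 : Phase ke kh kf) ε, ∀ (j : Fin kf) (k : Idx ke kh kf),
      ContDiffAt ℝ r (fun q : 𝔸 × Phase ke kh kf => (R q.1 (focusSec ε j q.2)).1 k / (2 * ε)) q :=
    fun q hq j k => by
      have h1 : ContDiffAt ℝ r (fun q : 𝔸 × Phase ke kh kf => R q.1 q.2) (q.1, focusSec ε j q.2) :=
        hR.contDiffAt ((hN.prod Metric.isOpen_ball).mem_nhds ⟨hq.1, focusSec_mem hε hq.2 j⟩)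
      have h2 : ContDiff ℝ r fun q : 𝔸 × Phase ke kh kf => (q.1, focusSec ε j q.2) :=
        contDiff_fst.prodMk ((contDiff_focusSec ε j).comp contDiff_snd)
      have h3 := ContDiffAt.comp q (g := fun q : 𝔸 × Phase ke kh kf => R q.1 q.2)
        (f := fun q : 𝔸 × Phase ke kh kf => (q.1, focusSec ε j q.2)) h1 h2.contDiffAt
      exact ((hpx k).contDiffAt.comp q h3).div_const _
  have sFA : ∀ q ∈ N ×ˢ Metric.ball (0 : Phase ke kh kf) ε, ∀ j,
      ContDiffAt ℝ r (fun q : 𝔸 × Phase ke kh kf => focusA (R q.1) j q.2) q := fun q hq j =>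
    (sec q hq j _).congr_of_eventuallyEq <| by
      filter_upwards [hO.mem_nhds hq] with q' hq'
      exact ((hu q'.1 hq'.1).focus_tendsto hε hq'.2 j).1
  have sFB : ∀ q ∈ N ×ˢ Metric.ball (0 : Phase ke kh kf) ε, ∀ j,
      ContDiffAt ℝ r (fun q : 𝔸 × Phase ke kh kf => focusB (R q.1) j q.2) q := fun q hq j =>
    (sec q hq j _).congr_of_eventuallyEq <| by
      filter_upwards [hO.mem_nhds hq] with q' hq'
      exact ((hu q'.1 hq'.1).focus_tendsto hε hq'.2 j).2
  set Pos : 𝔸 × Phase ke kh kf → Prop := fun q => (∀ i, 0 < ellA (R q.1) i q.2) ∧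
    (∀ i, 0 < hypU (R q.1) i q.2) ∧ ∀ j, 0 < focusA (R q.1) j q.2 with hPos
  have hPev : ∀ q ∈ N ×ˢ Metric.ball (0 : Phase ke kh kf) ε, Pos q → ∀ᶠ q' in 𝓝 q, Pos q' :=
    fun q hq hp =>
      (eventually_all.2 fun i => (sA q hq i).continuousAt.eventually (lt_mem_nhds (hp.1 i))).and
      ((eventually_all.2 fun i => (sU q hq i).continuousAt.eventually (lt_mem_nhds (hp.2.1 i))).and
      (eventually_all.2 fun i => (sFA q hq i).continuousAt.eventually (lt_mem_nhds (hp.2.2 i))))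
  have hP0 : Pos (a₀, 0) := by
    refine ⟨fun i => ?_, fun i => ?_, fun j => ?_⟩
    · simp only [((hu a₀ ha₀).ellA_zero i).1]; exact one_pos
    · simp only [(hu a₀ ha₀).hypU_zero i]; exact one_pos
    · simp only [((hu a₀ ha₀).focus_zero hε j).1]; exact one_pos
  have hC : ∀ q ∈ N ×ˢ Metric.ball (0 : Phase ke kh kf) ε, Pos q →
      ContDiffAt ℝ r (fun q : 𝔸 × Phase ke kh kf => coef (R q.1) q.2) q := by
    intro q hq hp
    refine contDiffAt_pi.2 fun i => ?_
    rcases i with i | i | ⟨j, k⟩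
    · have h1 := (contDiffAt_const (c := (-(1 / 2) : ℝ))).mul
        ((Real.contDiff_arctan (n := r)).contDiffAt.comp q
          ((sB q hq i).div (sA q hq i) (hp.1 i).ne'))
      exact h1
    · exact (sU q hq i).log (hp.2.1 i).ne'
    · have hj := hp.2.2 j
      fin_cases k
      · have h1 := (Real.contDiff_arctan (n := r)).contDiffAt.comp q
          ((sFB q hq j).div (sFA q hq j) hj.ne')
        exact h1
      · have h2 : focusA (R q.1) j q.2 ^ 2 + focusB (R q.1) j q.2 ^ 2 ≠ 0 := by positivity
        have h1 := (contDiffAt_const (c := (1 / 2 : ℝ))).mul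
          ((((sFA q hq j).pow 2).add ((sFB q hq j).pow 2)).log h2)
        exact h1
  have hc0 : coef (R a₀) (0 : Phase ke kh kf) = 0 := by
    refine idx_ext (fun i => ?_) (fun i => ?_) (fun j => ?_) (fun j => ?_)
    · simp [coef, ((hu a₀ ha₀).ellA_zero i).2]
    · simp [coef, (hu a₀ ha₀).hypU_zero i]
    · simp [coef, ((hu a₀ ha₀).focus_zero hε j).2]
    · simp [coef, ((hu a₀ ha₀).focus_zero hε j).1, ((hu a₀ ha₀).focus_zero hε j).2]
  have hsmall : ∀ᶠ q in 𝓝 (a₀, (0 : Phase ke kh kf)), ∀ i, |coef (R q.1) q.2 i| < 1 / 4 := by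
    refine eventually_all.2 fun i => ?_
    have h1 : ContinuousAt (fun q : 𝔸 × Phase ke kh kf => |coef (R q.1) q.2 i|) (a₀, 0) :=
      ((continuous_apply i).continuousAt.comp (hC _ h0 hP0).continuousAt).abs
    refine h1.eventually (gt_mem_nhds ?_)
    simp [hc0]
  filter_upwards [hO.mem_nhds h0, hPev _ h0 hP0, hsmall] with q hq hp hs
  refine ⟨hC q hq hp, hs, ?_⟩
  have hsl : ContinuousAt (fun y : Phase ke kh kf => (q.1, y)) q.2 := by fun_prop
  have hcR : ContinuousAt (R q.1) q.2 :=
    ((hu q.1 hq.1).differentiableAt (hsub hq.2)).continuousAt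
  have hcc : ContinuousAt (fun y => coef (R q.1) y) q.2 :=
    ContinuousAt.comp (x := q.2) (f := fun y : Phase ke kh kf => (q.1, y))
      (hC q hq hp).continuousAt hsl
  -- the identity holds at points with nonzero positions, which are dense
  refine eq_of_eq_regular (f' := fun y => flow (coef (R q.1) y) y) hcR ?_ ?_
  · exact hcc.flow continuousAt_id
  · filter_upwards [hsl.eventually (hO.mem_nhds hq), hsl.eventually (hPev q hq hp)] with y hy hpy hreg
    exact (hu q.1 hq.1).eq_flow_coef_of_regular hε hy.2 hreg hpy.1 hpy.2.1 hpy.2.2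

end Family

/-! ### Maps of the form `z ↦ flow (C z) z` -/

/-- `C` is a field of small exponents of the map `R` on the ball of radius `δ`. -/
structure IsExponentOn (R : Phase ke kh kf → Phase ke kh kf) (C : Phase ke kh kf → Idx ke kh kf → ℝ)
    (δ : ℝ) : Prop where
  unipotent : IsUnipotentOn R δ
  differentiableAt : ∀ z ∈ Metric.ball 0 δ, DifferentiableAt ℝ C z
  small : ∀ z ∈ Metric.ball 0 δ, ∀ i, |C z i| < 1 / 4
  eq_flow : ∀ z ∈ Metric.ball 0 δ, R z = flow (C z) z

section Exponent

variable {R : Phase ke kh kf → Phase ke kh kf} {C : Phase ke kh kf → Idx ke kh kf → ℝ} {δ : ℝ}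

lemma abs_smul_le {c : Idx ke kh kf → ℝ} (hc : ∀ i, |c i| ≤ 1) {t : ℝ} (ht : t ∈ Icc (0 : ℝ) 1)
    (i : Idx ke kh kf) : |(t • c) i| ≤ 1 := by
  rw [Pi.smul_apply, smul_eq_mul, abs_mul, abs_of_nonneg ht.1]
  nlinarith [ht.2, hc i, abs_nonneg (c i)]

lemma flow_mem_ball {c : Idx ke kh kf → ℝ} (hc : ∀ i, |c i| ≤ 1) {z : Phase ke kh kf}
    (hz : z ∈ Metric.ball 0 (δ / 6)) : flow c z ∈ Metric.ball 0 δ := by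
  rw [mem_ball_zero_iff] at hz ⊢
  linarith [norm_flow_le hc z]

lemma IsExponentOn.hasFDerivAt (h : IsExponentOn R C δ) {z : Phase ke kh kf}
    (hz : z ∈ Metric.ball 0 δ) : HasFDerivAt C (fderiv ℝ C z) z :=
  (h.differentiableAt z hz).hasFDerivAt

lemma IsExponentOn.fderiv_eq (h : IsExponentOn R C δ) {z : Phase ke kh kf}
    (hz : z ∈ Metric.ball 0 δ) : fderiv ℝ R z = fderiv ℝ (fun y => flow (C y) y) z := by
  refine Filter.EventuallyEq.fderiv_eq ?_
  filter_upwards [Metric.isOpen_ball.mem_nhds hz] with y hy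
  exact h.eq_flow y hy

lemma IsExponentOn.isClosedAt (h : IsExponentOn R C δ) {z : Phase ke kh kf}
    (hz : z ∈ Metric.ball 0 δ) : IsClosedAt (fderiv ℝ C z) z := fun u v => by
  have h1 := omegaL_fderiv_flow (h.hasFDerivAt hz) u v
  have h2 : omegaL (fderiv ℝ R z u) (fderiv ℝ R z v) = omegaL u v := h.unipotent.preserves.1 z hz u v
  rw [h.fderiv_eq hz] at h2
  linarith

/-- The linear part of `z ↦ flow (C z) z` at the origin is `flow (C 0)`. -/
lemma IsExponentOn.map_zero (h : IsExponentOn R C δ) (hδ : 0 < δ) : C 0 = 0 := by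
  have h0 : (0 : Phase ke kh kf) ∈ Metric.ball 0 δ := Metric.mem_ball_self hδ
  have h1 := h.fderiv_eq h0
  have hf := (hasFDerivAt_flow_comp (h.hasFDerivAt h0) (hasFDerivAt_id 0)).fderiv
  simp only [id] at hf
  rw [h.unipotent.fderiv_zero, hf] at h1
  have h2 := congrArg (fun L => L ((fun _ => 1, 0) : Phase ke kh kf)) h1
  simp only [_root_.map_zero, ContinuousLinearMap.id_apply, add_apply, ContinuousLinearMap.comp_apply,
    zero_apply, add_zero] at h2
  exact eq_zero_of_flow_eq (z := (fun _ => 1, 0)) (fun i => one_ne_zero)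
    (fun i => by linarith [h.small 0 h0 i]) h2.symm

/-- The exponents are first integrals of the linear flows. -/
lemma IsExponentOn.map_flow (h : IsExponentOn R C δ) (hδ : 0 < δ) {c : Idx ke kh kf → ℝ}
    (hc : ∀ i, |c i| ≤ 1) {z : Phase ke kh kf} (hz : z ∈ Metric.ball 0 (δ / 6)) :
    C (flow c z) = C z := by
  have hsub : Metric.ball (0 : Phase ke kh kf) (δ / 6) ⊆ Metric.ball 0 δ :=
    Metric.ball_subset_ball (by linarith)
  have hcf : ContinuousAt (fun y => C (flow c y)) z :=
    ContinuousAt.comp (g := C) (f := fun y => flow c y)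
      (h.differentiableAt _ (flow_mem_ball hc hz)).continuousAt (flow c).continuous.continuousAt
  refine eq_of_eq_regular hcf (h.differentiableAt z (hsub hz)).continuousAt ?_
  filter_upwards [Metric.isOpen_ball.mem_nhds hz] with y hy hreg
  have e := h.unipotent.map_flow (c := c) (z := y) fun t ht => flow_mem_ball (abs_smul_le hc ht) hy
  rw [h.eq_flow _ (flow_mem_ball hc hy), h.eq_flow y (hsub hy), flow_comm] at e
  have e' := congrArg (flow (-c)) e
  rw [flow_neg_flow, flow_neg_flow] at e'
  refine eq_of_flow_eq hreg (fun i => ?_) e'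
  have h1 := h.small _ (flow_mem_ball hc hy) i
  have h2 := h.small y (hsub hy) i
  exact (abs_sub _ _).trans_lt (by linarith)

end Exponent

/-! ### Linear parts of a local action -/

lemma momentMap_smul (t : ℝ) (z : Phase ke kh kf) : momentMap (t • z) = t ^ 2 • momentMap z := by
  apply idx_ext <;> intro i <;> simp [momentMap] <;> ring

lemma continuous_momentMap : Continuous (momentMap : Phase ke kh kf → Idx ke kh kf → ℝ) :=
  continuous_iff_continuousAt.2 fun z => (hasFDerivAt_momentMap z).continuousAt

/-- The linear part preserves the moment map because the moment map is homogeneous. -/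
lemma preservesSystem_fderiv_zero {f : Phase ke kh kf → Phase ke kh kf} {U : Set (Phase ke kh kf)}
    (hU : IsOpen U) (h0 : (0 : Phase ke kh kf) ∈ U) (hf : PreservesSystem f U) (hz : f 0 = 0)
    (hd : DifferentiableAt ℝ f 0) : PreservesSystem (fderiv ℝ f 0) univ := by
  refine ⟨fun z _ u v => ?_, fun z _ => ?_⟩
  · rw [ContinuousLinearMap.fderiv]
    exact hf.1 0 h0 u v
  · have h1 : HasDerivAt (fun t : ℝ => f (t • z)) (fderiv ℝ f 0 z) 0 := by
      have e1 : HasDerivAt (fun t : ℝ => t • z) z 0 := by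
        simpa using (hasDerivAt_id (0 : ℝ)).smul_const z
      have e2 : HasFDerivAt f (fderiv ℝ f 0) ((0 : ℝ) • z) := by
        rw [zero_smul]; exact hd.hasFDerivAt
      exact e2.comp_hasDerivAt 0 e1
    have h2 := hasDerivAt_iff_tendsto_slope.1 h1
    have h3 : Tendsto (fun t : ℝ => momentMap (slope (fun t : ℝ => f (t • z)) 0 t)) (𝓝[≠] 0)
        (𝓝 (momentMap (fderiv ℝ f 0 z))) := (continuous_momentMap.tendsto _).comp h2
    refine (tendsto_nhds_unique (tendsto_const_nhds.congr' ?_) h3).symm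
    have h4 : ∀ᶠ t : ℝ in 𝓝 0, t • z ∈ U := by
      have : ContinuousAt (fun t : ℝ => t • z) 0 := by fun_prop
      exact this.eventually (hU.mem_nhds (by simpa using h0))
    filter_upwards [h4.filter_mono nhdsWithin_le_nhds, self_mem_nhdsWithin] with t ht hne
    have hne' : t ≠ 0 := hne
    simp only [slope, zero_smul, hz, sub_zero, vsub_eq_sub]
    rw [momentMap_smul, hf.2 _ ht, momentMap_smul, smul_smul]
    simp [hne']

section Action

variable {d : ℕ} {G : Type*} [Group G] [TopologicalSpace G]
  [ChartedSpace (EuclideanSpace ℝ (Fin d)) G] {r : ℕ∞ω}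
  {ρ : G → Phase ke kh kf → Phase ke kh kf} {U : Set (Phase ke kh kf)}

/-- The map `ρ(g)⁽¹⁾ ∘ ρ(g)⁻¹`, with linear part the identity. -/
noncomputable def unip (ρ : G → Phase ke kh kf → Phase ke kh kf) (g : G) (z : Phase ke kh kf) :
    Phase ke kh kf := linearPart (ρ g) (ρ g⁻¹ z)

namespace IsLocalAction

lemma contDiffOn (h : IsLocalAction (d := d) r ρ U) (g : G) : ContDiffOn ℝ r (ρ g) U := by
  rw [← contMDiffOn_iff_contDiffOn]
  exact h.contMDiffOn.comp (contMDiff_const.prodMk contMDiff_id).contMDiffOn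
    fun z hz => ⟨mem_univ g, hz⟩

lemma differentiableAt (h : IsLocalAction (d := d) r ρ U) (hr : r ≠ 0) (g : G)
    {z : Phase ke kh kf} (hz : z ∈ U) : DifferentiableAt ℝ (ρ g) z :=
  ((h.contDiffOn g).contDiffAt (h.isOpen.mem_nhds hz)).differentiableAt hr

lemma linearPart_mul (h : IsLocalAction (d := d) r ρ U) (hr : r ≠ 0) (g k : G)
    (z : Phase ke kh kf) : linearPart (ρ (g * k)) z = linearPart (ρ g) (linearPart (ρ k) z) := by
  have hk := h.differentiableAt hr k h.zero_mem
  have e1 : HasFDerivAt (fun z => ρ g (ρ k z)) ((linearPart (ρ g)).comp (linearPart (ρ k))) 0 := by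
    have hg : HasFDerivAt (ρ g) (linearPart (ρ g)) (ρ k 0) := by
      rw [h.map_zero k]; exact (h.differentiableAt hr g h.zero_mem).hasFDerivAt
    exact hg.comp 0 hk.hasFDerivAt
  have e2 : ρ (g * k) =ᶠ[𝓝 0] fun z => ρ g (ρ k z) := by
    have := hk.continuousAt.eventually (p := fun w => w ∈ U)
      (h.isOpen.mem_nhds (by rw [h.map_zero k]; exact h.zero_mem))
    filter_upwards [h.isOpen.mem_nhds h.zero_mem, this] with z hz hkz
    exact h.mul g k z hz hkz
  have : linearPart (ρ (g * k)) = (linearPart (ρ g)).comp (linearPart (ρ k)) := by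
    rw [linearPart, e2.fderiv_eq, e1.fderiv]
  rw [this]; rfl

lemma linearPart_one (h : IsLocalAction (d := d) r ρ U) (z : Phase ke kh kf) :
    linearPart (ρ 1) z = z := by
  have e2 : ρ 1 =ᶠ[𝓝 0] id := by
    filter_upwards [h.isOpen.mem_nhds h.zero_mem] with z hz
    exact h.one z hz
  rw [linearPart, e2.fderiv_eq, fderiv_id]; rfl

lemma linearPart_inv_apply (h : IsLocalAction (d := d) r ρ U) (hr : r ≠ 0) (g : G)
    (z : Phase ke kh kf) : linearPart (ρ g⁻¹) (linearPart (ρ g) z) = z := by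
  rw [← h.linearPart_mul hr, inv_mul_cancel, h.linearPart_one]

lemma linearPart_apply_inv (h : IsLocalAction (d := d) r ρ U) (hr : r ≠ 0) (g : G)
    (z : Phase ke kh kf) : linearPart (ρ g) (linearPart (ρ g⁻¹) z) = z := by
  rw [← h.linearPart_mul hr, mul_inv_cancel, h.linearPart_one]

lemma preservesSystem_linearPart (h : IsLocalAction (d := d) r ρ U) (hr : r ≠ 0) (g : G) :
    PreservesSystem (linearPart (ρ g)) univ :=
  preservesSystem_fderiv_zero h.isOpen h.zero_mem (h.preserves g) (h.map_zero g)
    (h.differentiableAt hr g h.zero_mem)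

lemma isLinearSystemAction (h : IsLocalAction (d := d) r ρ U) (hr : r ≠ 0) :
    IsLinearSystemAction ρ :=
  ⟨{ toFun := fun g => linearPart (ρ g)
     map_one' := ContinuousLinearMap.ext fun z => h.linearPart_one z
     map_mul' := fun g k => ContinuousLinearMap.ext fun z => h.linearPart_mul hr g k z },
    fun g => ⟨rfl, h.preservesSystem_linearPart hr g⟩⟩

lemma linearPart_gen (h : IsLocalAction (d := d) r ρ U) (hr : r ≠ 0) (g : G)
    (c : Idx ke kh kf → ℝ) (z : Phase ke kh kf) :
    linearPart (ρ g) (gen c z) = gen c (linearPart (ρ g) z) := by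
  have := (h.preservesSystem_linearPart hr g).fderiv_gen isOpen_univ (mem_univ z)
    (linearPart (ρ g)).differentiableAt c
  rwa [ContinuousLinearMap.fderiv] at this

lemma linearPart_flow (h : IsLocalAction (d := d) r ρ U) (hr : r ≠ 0) (g : G)
    (c : Idx ke kh kf → ℝ) (z : Phase ke kh kf) :
    linearPart (ρ g) (flow c z) = flow c (linearPart (ρ g) z) :=
  map_flow_eq_flow_map (fun t _ => (linearPart (ρ g)).differentiableAt) fun t _ => by
    rw [ContinuousLinearMap.fderiv]; exact h.linearPart_gen hr g c _

lemma isUnipotentOn (h : IsLocalAction (d := d) r ρ U) (hr : 1 ≤ r) (g : G) {δ : ℝ}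
    (hδ : Metric.ball 0 δ ⊆ U) : IsUnipotentOn (unip ρ g) δ := by
  have hr0 : r ≠ 0 := (zero_lt_one.trans_le hr).ne'
  have hfd : ∀ z ∈ U, fderiv ℝ (unip ρ g) z =
      (linearPart (ρ g)).comp (fderiv ℝ (ρ g⁻¹) z) := fun z hz =>
    ((linearPart (ρ g)).hasFDerivAt.comp z
      (h.differentiableAt hr0 g⁻¹ hz).hasFDerivAt).fderiv
  have hL := h.preservesSystem_linearPart hr0 g
  refine ⟨?_, ⟨fun z hz u v => ?_, fun z hz => ?_⟩, ?_, ?_⟩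
  · exact (linearPart (ρ g)).contDiff.comp_contDiffOn (((h.contDiffOn g⁻¹).of_le hr).mono hδ)
  · have h1 := hL.1 z (mem_univ z) (fderiv ℝ (ρ g⁻¹) z u) (fderiv ℝ (ρ g⁻¹) z v)
    rw [ContinuousLinearMap.fderiv] at h1
    rw [hfd z (hδ hz)]
    exact h1.trans ((h.preserves g⁻¹).1 z (hδ hz) u v)
  · exact (hL.2 _ (mem_univ _)).trans ((h.preserves g⁻¹).2 z (hδ hz))
  · simp [unip, h.map_zero]
  · rw [hfd 0 h.zero_mem]
    exact ContinuousLinearMap.ext fun z => h.linearPart_apply_inv hr0 g z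

lemma inv_apply (h : IsLocalAction (d := d) r ρ U) (g : G) {z : Phase ke kh kf} (hz : z ∈ U)
    (hgz : ρ g z ∈ U) : ρ g⁻¹ (ρ g z) = z := by
  rw [← h.mul g⁻¹ g z hz hgz, inv_mul_cancel, h.one z hz]

lemma apply_inv (h : IsLocalAction (d := d) r ρ U) (g : G) {z : Phase ke kh kf} (hz : z ∈ U)
    (hgz : ρ g⁻¹ z ∈ U) : ρ g (ρ g⁻¹ z) = z := by
  rw [← h.mul g g⁻¹ z hz hgz, mul_inv_cancel, h.one z hz]

end IsLocalAction

end Action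

/-! ### Joint smoothness over a manifold, read in charts -/

section Chart

variable {d : ℕ} {G : Type*} [TopologicalSpace G] [ChartedSpace (EuclideanSpace ℝ (Fin d)) G]
  {r : ℕ∞ω} [IsManifold (𝓡 d) r G] {X Y Z : Type*} [NormedAddCommGroup X] [NormedSpace ℝ X]
  [NormedAddCommGroup Y] [NormedSpace ℝ Y] [NormedAddCommGroup Z] [NormedSpace ℝ Z]

/-- `F : G × X → Y` is jointly `C^r` at `q`. -/
abbrev JointAt (d : ℕ) {G : Type*} [TopologicalSpace G] [ChartedSpace (EuclideanSpace ℝ (Fin d)) G]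
    {X Y : Type*} [NormedAddCommGroup X] [NormedSpace ℝ X] [NormedAddCommGroup Y] [NormedSpace ℝ Y]
    (r : ℕ∞ω) (F : G × X → Y) (q : G × X) : Prop :=
  ContMDiffAt ((𝓡 d).prod 𝓘(ℝ, X)) 𝓘(ℝ, Y) r F q

lemma contMDiffAt_symm_prod (g : G) {a : EuclideanSpace ℝ (Fin d)}
    (ha : a ∈ (extChartAt (𝓡 d) g).target) (x : X) :
    ContMDiffAt 𝓘(ℝ, EuclideanSpace ℝ (Fin d) × X) ((𝓡 d).prod 𝓘(ℝ, X)) r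
      (fun q : EuclideanSpace ℝ (Fin d) × X => ((extChartAt (𝓡 d) g).symm q.1, q.2)) (a, x) := by
  have h1 : ContMDiffAt 𝓘(ℝ, EuclideanSpace ℝ (Fin d)) (𝓡 d) r (extChartAt (𝓡 d) g).symm a :=
    (contMDiffOn_extChartAt_symm g).contMDiffAt ((isOpen_extChartAt_target g).mem_nhds ha)
  have h2 : ContMDiffAt 𝓘(ℝ, EuclideanSpace ℝ (Fin d) × X) 𝓘(ℝ, EuclideanSpace ℝ (Fin d)) r
      (fun q : EuclideanSpace ℝ (Fin d) × X => q.1) (a, x) := contDiff_fst.contMDiff.contMDiffAt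
  have h3 : ContMDiffAt 𝓘(ℝ, EuclideanSpace ℝ (Fin d) × X) 𝓘(ℝ, X) r
      (fun q : EuclideanSpace ℝ (Fin d) × X => q.2) (a, x) := contDiff_snd.contMDiff.contMDiffAt
  exact ContMDiffAt.prodMk (ContMDiffAt.comp (x := (a, x)) h1 h2) h3

lemma contMDiffAt_chart_prod {g g' : G} (hg : g' ∈ (chartAt (EuclideanSpace ℝ (Fin d)) g).source)
    (x : X) : ContMDiffAt ((𝓡 d).prod 𝓘(ℝ, X)) 𝓘(ℝ, EuclideanSpace ℝ (Fin d) × X) r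
      (fun q : G × X => (extChartAt (𝓡 d) g q.1, q.2)) (g', x) := by
  have h1 : ContMDiffAt (𝓡 d) 𝓘(ℝ, EuclideanSpace ℝ (Fin d)) r (extChartAt (𝓡 d) g) g' :=
    contMDiffAt_extChartAt' hg
  exact (ContMDiffAt.comp (x := (g', x)) (I' := 𝓡 d) h1 contMDiffAt_fst).prodMk_space contMDiffAt_snd

lemma JointAt.comp_symm {F : G × X → Y} (g : G) {a : EuclideanSpace ℝ (Fin d)}
    (ha : a ∈ (extChartAt (𝓡 d) g).target) {x : X}
    (hF : JointAt d r F ((extChartAt (𝓡 d) g).symm a, x)) :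
    ContDiffAt ℝ r (fun q : EuclideanSpace ℝ (Fin d) × X => F ((extChartAt (𝓡 d) g).symm q.1, q.2))
      (a, x) := by
  rw [← contMDiffAt_iff_contDiffAt]
  exact ContMDiffAt.comp (I' := (𝓡 d).prod 𝓘(ℝ, X)) (x := (a, x)) (g := F) hF
    (contMDiffAt_symm_prod g ha x)

lemma ContDiffAt.assoc_right {A B : Type*} [NormedAddCommGroup A] [NormedSpace ℝ A]
    [NormedAddCommGroup B] [NormedSpace ℝ B] {F : A × (B × X) → Y} {a : A} {b : B} {x : X}
    (hF : ContDiffAt ℝ r F (a, (b, x))) :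
    ContDiffAt ℝ r (fun q : (A × B) × X => F (q.1.1, (q.1.2, q.2))) ((a, b), x) :=
  ContDiffAt.comp ((a, b), x) (f := fun q : (A × B) × X => (q.1.1, (q.1.2, q.2))) hF (by fun_prop)

lemma ContDiffAt.assoc_left {A B : Type*} [NormedAddCommGroup A] [NormedSpace ℝ A]
    [NormedAddCommGroup B] [NormedSpace ℝ B] {F : (A × B) × X → Y} {a : A} {b : B} {x : X}
    (hF : ContDiffAt ℝ r F ((a, b), x)) :
    ContDiffAt ℝ r (fun q : A × (B × X) => F ((q.1, q.2.1), q.2.2)) (a, (b, x)) :=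
  ContDiffAt.comp (a, (b, x)) (f := fun q : A × (B × X) => ((q.1, q.2.1), q.2.2)) hF (by fun_prop)

lemma jointAt_of_chart {F : G × X → Y} {g g' : G} {x : X}
    (hs : g' ∈ (extChartAt (𝓡 d) g).source)
    (hF : ContDiffAt ℝ r (fun q : EuclideanSpace ℝ (Fin d) × X =>
      F ((extChartAt (𝓡 d) g).symm q.1, q.2)) (extChartAt (𝓡 d) g g', x)) :
    JointAt d r F (g', x) := by
  have hs' : g' ∈ (chartAt (EuclideanSpace ℝ (Fin d)) g).source := by
    rwa [extChartAt_source] at hs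
  have h1 := ContMDiffAt.comp (x := (g', x)) (f := fun q : G × X => (extChartAt (𝓡 d) g q.1, q.2))
    hF.contMDiffAt (contMDiffAt_chart_prod hs' x)
  refine h1.congr_of_eventuallyEq ?_
  have : ∀ᶠ q : G × X in 𝓝 (g', x), q.1 ∈ (extChartAt (𝓡 d) g).source :=
    continuousAt_fst.eventually ((isOpen_extChartAt_source g).mem_nhds hs)
  filter_upwards [this] with q hq
  simp only [Function.comp, (extChartAt (𝓡 d) g).left_inv hq]

/-- Joint smoothness at a point is smoothness in the preferred chart there. -/
lemma jointAt_iff_chart {F : G × X → Y} {g : G} {x : X} :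
    JointAt d r F (g, x) ↔ ContDiffAt ℝ r
      (fun q : EuclideanSpace ℝ (Fin d) × X => F ((extChartAt (𝓡 d) g).symm q.1, q.2))
      (extChartAt (𝓡 d) g g, x) :=
  ⟨fun h => JointAt.comp_symm g (mem_extChartAt_target g) (by simpa using h),
    jointAt_of_chart (mem_extChartAt_source g)⟩

/-- Composition of a jointly `C^r` function with a `C^r` map in the second variable. -/
lemma JointAt.comp_right {F : G × X → Y} {g : G} {x : Z} {f : Z → X}
    (hF : JointAt d r F (g, f x)) (hf : ContDiffAt ℝ r f x) :
    JointAt d r (fun q : G × Z => F (q.1, f q.2)) (g, x) :=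
  ContMDiffAt.comp (I' := (𝓡 d).prod 𝓘(ℝ, X)) (x := (g, x)) (f := fun q : G × Z => (q.1, f q.2)) hF
    (contMDiffAt_fst.prodMk (ContMDiffAt.comp (x := (g, x)) (I' := 𝓘(ℝ, Z)) (f := Prod.snd)
      (g := f) hf.contMDiffAt contMDiffAt_snd))

/-- The derivative in the last variable of a jointly `C^r` function is jointly `C^r`. -/
lemma JointAt.fderiv_right (hr : r + 1 ≤ r) {F : G × (X × Z) → Y} {g : G} {x : X} {f : X → Z}
    (hF : JointAt d r F (g, (x, f x))) (hf : ContDiffAt ℝ r f x) :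
    JointAt d r (fun q : G × X => fderiv ℝ (fun z => F (q.1, (q.2, z))) (f q.2)) (g, x) := by
  rw [jointAt_iff_chart] at hF ⊢
  refine ContDiffAt.fderiv
    (f := fun (q : EuclideanSpace ℝ (Fin d) × X) (z : Z) =>
      F ((extChartAt (𝓡 d) g).symm q.1, (q.2, z))) (g := fun q => f q.2) (n := r) ?_ ?_ hr
  · exact ContDiffAt.comp (f := fun u : (EuclideanSpace ℝ (Fin d) × X) × Z =>
      ((u.1.1, (u.1.2, u.2)) : EuclideanSpace ℝ (Fin d) × (X × Z)))
      ((extChartAt (𝓡 d) g g, x), f x) hF (by fun_prop)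
  · exact ContDiffAt.comp (f := fun q : EuclideanSpace ℝ (Fin d) × X => q.2)
      (extChartAt (𝓡 d) g g, x) hf contDiffAt_snd

lemma JointAt.jointContDiffAt {F : G × X → Y} {g : G} {x : X} (hF : JointAt d r F (g, x)) :
    ParamIntegral.JointContDiffAt (EuclideanSpace ℝ (Fin d)) r (fun g x => F (g, x)) g x := by
  refine ⟨extChartAt (𝓡 d) g, fun q => F ((extChartAt (𝓡 d) g).symm q.1, q.2), ?_,
    jointAt_iff_chart.1 hF, ?_⟩
  · filter_upwards [extChartAt_source_mem_nhds (I := 𝓡 d) g] with k hk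
    exact continuousAt_extChartAt' hk
  · have : ∀ᶠ q : G × X in 𝓝 (g, x), q.1 ∈ (extChartAt (𝓡 d) g).source :=
      continuousAt_fst.eventually (extChartAt_source_mem_nhds g)
    filter_upwards [this] with q hq
    simp only [(extChartAt (𝓡 d) g).left_inv hq]

end Chart

section Family

variable {d m : ℕ} {G : Type*} [Group G] [TopologicalSpace G]
  [ChartedSpace (EuclideanSpace ℝ (Fin d)) G] {r : ℕ∞ω} [LieGroup (𝓡 d) r G]
  {ρ : EuclideanSpace ℝ (Fin m) → G → Phase ke kh kf → Phase ke kh kf} {ε : ℝ}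
  {W : Set (EuclideanSpace ℝ (Fin m) × Phase ke kh kf)}

namespace IsLocalActionFamily

lemma zero_mem (h : IsLocalActionFamily (d := d) r ρ ε W) {p : EuclideanSpace ℝ (Fin m)}
    (hp : p ∈ Metric.ball 0 ε) : (p, (0 : Phase ke kh kf)) ∈ W := (h.action p hp).zero_mem

lemma jointAt (h : IsLocalActionFamily (d := d) r ρ ε W) {g : G}
    {x : EuclideanSpace ℝ (Fin m) × Phase ke kh kf} (hx : x ∈ W) :
    JointAt d r (fun q : G × (EuclideanSpace ℝ (Fin m) × Phase ke kh kf) => ρ q.2.1 q.1 q.2.2)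
      (g, x) := by
  have hO : IsOpen {q : EuclideanSpace ℝ (Fin m) × (G × Phase ke kh kf) | (q.1, q.2.2) ∈ W} :=
    h.isOpen.preimage (by fun_prop)
  have h1 := h.contMDiffOn.contMDiffAt (hO.mem_nhds (x := (x.1, (g, x.2))) hx)
  refine ContMDiffAt.comp (x := (g, x))
    (f := fun q : G × (EuclideanSpace ℝ (Fin m) × Phase ke kh kf) => (q.2.1, (q.1, q.2.2))) h1 ?_
  have h2 : ContMDiffAt ((𝓡 d).prod 𝓘(ℝ, EuclideanSpace ℝ (Fin m) × Phase ke kh kf))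
      𝓘(ℝ, EuclideanSpace ℝ (Fin m)) r
      (fun q : G × (EuclideanSpace ℝ (Fin m) × Phase ke kh kf) => q.2.1) (g, x) :=
    ContMDiffAt.comp (x := (g, x)) (I' := 𝓘(ℝ, EuclideanSpace ℝ (Fin m) × Phase ke kh kf))
      (g := Prod.fst) (f := Prod.snd) contDiff_fst.contMDiff.contMDiffAt contMDiffAt_snd
  have h3 : ContMDiffAt ((𝓡 d).prod 𝓘(ℝ, EuclideanSpace ℝ (Fin m) × Phase ke kh kf))
      𝓘(ℝ, Phase ke kh kf) r
      (fun q : G × (EuclideanSpace ℝ (Fin m) × Phase ke kh kf) => q.2.2) (g, x) :=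
    ContMDiffAt.comp (x := (g, x)) (I' := 𝓘(ℝ, EuclideanSpace ℝ (Fin m) × Phase ke kh kf))
      (g := Prod.snd) (f := Prod.snd) contDiff_snd.contMDiff.contMDiffAt contMDiffAt_snd
  exact h2.prodMk (contMDiffAt_fst.prodMk h3)

lemma jointAt_inv (h : IsLocalActionFamily (d := d) r ρ ε W) {g : G}
    {x : EuclideanSpace ℝ (Fin m) × Phase ke kh kf} (hx : x ∈ W) :
    JointAt d r (fun q : G × (EuclideanSpace ℝ (Fin m) × Phase ke kh kf) => ρ q.2.1 q.1⁻¹ q.2.2)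
      (g, x) := by
  have h1 := h.jointAt (g := g⁻¹) hx
  have hinv : ContMDiff (𝓡 d) (𝓡 d) r fun a : G => a⁻¹ := contMDiff_inv (𝓡 d) r
  exact ContMDiffAt.comp (x := (g, x))
    (f := fun q : G × (EuclideanSpace ℝ (Fin m) × Phase ke kh kf) => (q.1⁻¹, q.2)) h1
    ((hinv.contMDiffAt.comp (g, x) contMDiffAt_fst).prodMk contMDiffAt_snd)

lemma jointAt_linearPart (h : IsLocalActionFamily (d := d) r ρ ε W) (hr : r = ∞ ∨ r = ω) {g : G}
    {p : EuclideanSpace ℝ (Fin m)} (hp : p ∈ Metric.ball 0 ε) :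
    JointAt d r (fun q : G × EuclideanSpace ℝ (Fin m) => linearPart (ρ q.2 q.1)) (g, p) := by
  have : IsManifold (𝓡 d) r G := inferInstance
  exact JointAt.fderiv_right (by rcases hr with rfl | rfl <;> simp)
    (F := fun q : G × (EuclideanSpace ℝ (Fin m) × Phase ke kh kf) => ρ q.2.1 q.1 q.2.2)
    (f := fun _ => 0) (h.jointAt (h.zero_mem hp)) contDiffAt_const

lemma jointAt_linearPart' (h : IsLocalActionFamily (d := d) r ρ ε W) (hr : r = ∞ ∨ r = ω) {g : G}
    {x : EuclideanSpace ℝ (Fin m) × Phase ke kh kf} (hp : x.1 ∈ Metric.ball 0 ε) :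
    JointAt d r (fun q : G × (EuclideanSpace ℝ (Fin m) × Phase ke kh kf) =>
      linearPart (ρ q.2.1 q.1)) (g, x) :=
  (h.jointAt_linearPart hr hp).comp_right
    (f := (Prod.fst : EuclideanSpace ℝ (Fin m) × Phase ke kh kf → _)) contDiffAt_fst

lemma jointAt_unip (h : IsLocalActionFamily (d := d) r ρ ε W) (hr : r = ∞ ∨ r = ω) {g : G}
    {x : EuclideanSpace ℝ (Fin m) × Phase ke kh kf} (hx : x ∈ W) :
    JointAt d r (fun q : G × (EuclideanSpace ℝ (Fin m) × Phase ke kh kf) =>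
      unip (ρ q.2.1) q.1 q.2.2) (g, x) :=
  ContMDiffAt.clm_apply (h.jointAt_linearPart' hr (h.subset hx).1) (h.jointAt_inv hx)

/-- The exponents of `ρ_p(g)⁽¹⁾ ∘ ρ_p(g)⁻¹` exist close to the origin, and are jointly `C^r` in `g`,
`p` and the point. -/
lemma eventually_coef_unip (h : IsLocalActionFamily (d := d) r ρ ε W) (hr : r = ∞ ∨ r = ω) (g₀ : G)
    {p₀ : EuclideanSpace ℝ (Fin m)} (hp₀ : p₀ ∈ Metric.ball 0 ε) :
    ∀ᶠ q : (EuclideanSpace ℝ (Fin m) × Phase ke kh kf) × G in 𝓝 ((p₀, 0), g₀),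
      JointAt d r (fun q : G × (EuclideanSpace ℝ (Fin m) × Phase ke kh kf) =>
        coef (unip (ρ q.2.1) q.1) q.2.2) (q.2, q.1) ∧
      (∀ i, |coef (unip (ρ q.1.1) q.2) q.1.2 i| < 1 / 4) ∧
      unip (ρ q.1.1) q.2 q.1.2 = flow (coef (unip (ρ q.1.1) q.2) q.1.2) q.1.2 := by
  obtain ⟨ε₁, hε₁, hsub⟩ : ∃ ε₁ > 0, Metric.ball p₀ ε₁ ×ˢ Metric.ball (0 : Phase ke kh kf) (4 * ε₁) ⊆
      W := by
    obtain ⟨u, hu, v, hv, huv⟩ := mem_nhds_prod_iff.1 (h.isOpen.mem_nhds (h.zero_mem hp₀))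
    obtain ⟨e1, he1, h1⟩ := Metric.mem_nhds_iff.1 hu
    obtain ⟨e2, he2, h2⟩ := Metric.mem_nhds_iff.1 hv
    refine ⟨min e1 (e2 / 4), by positivity, fun q hq => huv ⟨h1 ?_, h2 ?_⟩⟩
    · exact Metric.ball_subset_ball (min_le_left _ _) hq.1
    · exact Metric.ball_subset_ball (by linarith [min_le_right e1 (e2 / 4)]) hq.2
  have hNo : IsOpen ((extChartAt (𝓡 d) g₀).target ×ˢ Metric.ball p₀ ε₁) :=
    (isOpen_extChartAt_target g₀).prod Metric.isOpen_ball
  have hRc : ContDiffOn ℝ r (fun q : (EuclideanSpace ℝ (Fin d) × EuclideanSpace ℝ (Fin m)) ×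
      Phase ke kh kf => unip (ρ q.1.2) ((extChartAt (𝓡 d) g₀).symm q.1.1) q.2)
      (((extChartAt (𝓡 d) g₀).target ×ˢ Metric.ball p₀ ε₁) ×ˢ Metric.ball 0 (4 * ε₁)) := by
    rintro ⟨⟨a, p⟩, z⟩ ⟨⟨ha, hp⟩, hz⟩
    refine ContDiffAt.contDiffWithinAt ?_
    exact ContDiffAt.assoc_right (JointAt.comp_symm
      (F := fun q : G × (EuclideanSpace ℝ (Fin m) × Phase ke kh kf) => unip (ρ q.2.1) q.1 q.2.2)
      g₀ ha (h.jointAt_unip hr (hsub ⟨hp, hz⟩)))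
  have hu : ∀ a ∈ (extChartAt (𝓡 d) g₀).target ×ˢ Metric.ball p₀ ε₁,
      IsUnipotentOn (unip (ρ a.2) ((extChartAt (𝓡 d) g₀).symm a.1)) (4 * ε₁) := by
    rintro ⟨a, p⟩ ⟨ha, hp⟩
    have hp' : p ∈ Metric.ball 0 ε :=
      (h.subset (hsub (show (p, (0 : Phase ke kh kf)) ∈ _ from
        ⟨hp, Metric.mem_ball_self (by linarith)⟩))).1
    exact (h.action p hp').isUnipotentOn (by rcases hr with rfl | rfl <;> simp) _
      fun z hz => hsub ⟨hp, hz⟩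
  have h0 : (extChartAt (𝓡 d) g₀ g₀, p₀) ∈ (extChartAt (𝓡 d) g₀).target ×ˢ Metric.ball p₀ ε₁ :=
    ⟨mem_extChartAt_target g₀, Metric.mem_ball_self hε₁⟩
  have hev := eventually_coef (R := fun a : EuclideanSpace ℝ (Fin d) × EuclideanSpace ℝ (Fin m) =>
    unip (ρ a.2) ((extChartAt (𝓡 d) g₀).symm a.1)) hr hNo hε₁ hRc hu h0
  have hcont : ContinuousAt (fun q : (EuclideanSpace ℝ (Fin m) × Phase ke kh kf) × G =>
      ((extChartAt (𝓡 d) g₀ q.2, q.1.1), q.1.2)) ((p₀, 0), g₀) := by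
    have h1 : ContinuousAt (fun q : (EuclideanSpace ℝ (Fin m) × Phase ke kh kf) × G =>
        extChartAt (𝓡 d) g₀ q.2) ((p₀, 0), g₀) :=
      ContinuousAt.comp (f := Prod.snd) (g := extChartAt (𝓡 d) g₀)
        (continuousAt_extChartAt g₀) continuousAt_snd
    exact (h1.prodMk (by fun_prop)).prodMk (by fun_prop)
  have hsrc : ∀ᶠ q : (EuclideanSpace ℝ (Fin m) × Phase ke kh kf) × G in 𝓝 ((p₀, 0), g₀),
      q.2 ∈ (extChartAt (𝓡 d) g₀).source :=
    continuousAt_snd.eventually (extChartAt_source_mem_nhds g₀)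
  filter_upwards [hcont.eventually hev, hsrc] with q hq hs
  obtain ⟨h1, h2, h3⟩ := hq
  simp only [(extChartAt (𝓡 d) g₀).left_inv hs] at h2 h3
  exact ⟨jointAt_of_chart hs (ContDiffAt.assoc_left (F := fun q : (EuclideanSpace ℝ (Fin d) ×
      EuclideanSpace ℝ (Fin m)) × Phase ke kh kf =>
        coef (unip (ρ q.1.2) ((extChartAt (𝓡 d) g₀).symm q.1.1)) q.2) h1), h2, h3⟩

end IsLocalActionFamily

end Family

/-! ### Averaging the exponents of a local action -/

section Automorphism

variable {r : ℕ∞ω} {A : Phase ke kh kf → Idx ke kh kf → ℝ} {O V : Set (Phase ke kh kf)}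

/-- If `A` is closed in the sense of `IsClosedAt` and constant along the orbits concerned, then
`z ↦ flow (A z) z` is an automorphism of the system, with inverse `w ↦ flow (-A w) w`. -/
lemma isSystemAutomorphism_flow (hr : r ≠ 0) (hO : IsOpen O) (hA : ContDiffOn ℝ r A O)
    (hcl : ∀ z ∈ O, IsClosedAt (fderiv ℝ A z) z) (hV : IsOpen V) (hVO : V ⊆ O)
    (h0 : (0 : Phase ke kh kf) ∈ V)
    (h1 : ∀ z ∈ V, flow (A z) z ∈ O ∧ A (flow (A z) z) = A z)
    (h2 : ∀ w ∈ O, A (flow (-A w) w) = A w) :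
    IsSystemAutomorphism r (fun z => flow (A z) z) V := by
  have hAd : ∀ z ∈ O, ContDiffAt ℝ r A z := fun z hz => hA.contDiffAt (hO.mem_nhds hz)
  have hf : ContDiffOn ℝ r (fun z => flow (A z) z) O := fun z hz =>
    ((hAd z hz).flow contDiffAt_id).contDiffWithinAt
  have hb : ContDiffOn ℝ r (fun z => flow (-A z) z) O := fun z hz =>
    ((hAd z hz).neg.flow contDiffAt_id).contDiffWithinAt
  let e : OpenPartialHomeomorph (Phase ke kh kf) (Phase ke kh kf) :=
    { toFun := fun z => flow (A z) z
      invFun := fun w => flow (-A w) w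
      source := V
      target := O ∩ (fun w => flow (-A w) w) ⁻¹' V
      map_source' := fun z hz => by
        refine ⟨(h1 z hz).1, ?_⟩
        rw [mem_preimage, (h1 z hz).2, flow_neg_flow]
        exact hz
      map_target' := fun w hw => hw.2
      left_inv' := fun z hz => by rw [(h1 z hz).2, flow_neg_flow]
      right_inv' := fun w hw => by rw [h2 w hw.1, flow_flow_neg]
      open_source := hV
      open_target := hb.continuousOn.isOpen_inter_preimage hO hV
      continuousOn_toFun := hf.continuousOn.mono hVO
      continuousOn_invFun := hb.continuousOn.mono inter_subset_left }
  refine ⟨hV, h0, _root_.map_zero _, hf.mono hVO, ⟨e, rfl, fun z _ => rfl,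
    hb.mono inter_subset_left⟩, fun z hz u v => ?_, fun z _ => momentMap_flow _ _⟩
  have h3 := omegaL_fderiv_flow ((hAd z (hVO hz)).differentiableAt hr).hasFDerivAt u v
  rw [hcl z (hVO hz) u v, sub_self, add_zero] at h3
  exact h3

end Automorphism

section Exponents

variable {d : ℕ} {G : Type*} [Group G] [TopologicalSpace G]
  [ChartedSpace (EuclideanSpace ℝ (Fin d)) G] {r : ℕ∞ω} [LieGroup (𝓡 d) r G]
  {ρ : G → Phase ke kh kf → Phase ke kh kf} {U : Set (Phase ke kh kf)} {K δ : ℝ}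

/-- The exponents of the maps `ρ(g)⁽¹⁾ ∘ ρ(g)⁻¹` of a local action are defined and jointly `C^r` on
the ball of radius `δ`, uniformly in `g`; `K` bounds the norms of the linear parts. -/
structure HasExponents (d : ℕ) {G : Type*} [Group G] [TopologicalSpace G]
    [ChartedSpace (EuclideanSpace ℝ (Fin d)) G] (r : ℕ∞ω)
    (ρ : G → Phase ke kh kf → Phase ke kh kf) (U : Set (Phase ke kh kf)) (K δ : ℝ) : Prop where
  isLocalAction : IsLocalAction (d := d) r ρ U
  ne_zero : r ≠ 0
  pos : 0 < δ
  one_le : 1 ≤ K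
  subset : Metric.ball 0 δ ⊆ U
  norm_linearPart_le : ∀ g z, ‖linearPart (ρ g) z‖ ≤ K * ‖z‖
  exponent : ∀ g, IsExponentOn (unip ρ g) (coef (unip ρ g)) δ
  jointAt : ∀ g, ∀ z ∈ Metric.ball 0 δ,
    JointAt d r (fun q : G × Phase ke kh kf => coef (unip ρ q.1) q.2) (g, z)

namespace HasExponents

/-- `ρ(g)` is the composition of its linear part with a flow by small exponents. -/
lemma norm_apply_le (h : HasExponents d r ρ U K δ) (g : G) {z : Phase ke kh kf}
    (hz : z ∈ Metric.ball 0 δ) : ‖ρ g z‖ ≤ 6 * K * ‖z‖ := by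
  have h1 : ρ g z = linearPart (ρ g) (unip ρ g⁻¹ z) := by
    rw [unip, h.isLocalAction.linearPart_apply_inv h.ne_zero, inv_inv]
  have h2 : ‖unip ρ g⁻¹ z‖ ≤ 6 * ‖z‖ := by
    rw [(h.exponent g⁻¹).eq_flow z hz]
    exact norm_flow_le (fun i => by linarith [(h.exponent g⁻¹).small z hz i]) z
  rw [h1]
  have := h.norm_linearPart_le g (unip ρ g⁻¹ z)
  nlinarith [h.one_le]

lemma continuous_coef (h : HasExponents d r ρ U K δ) {z : Phase ke kh kf}
    (hz : z ∈ Metric.ball 0 δ) : Continuous fun g => coef (unip ρ g) z :=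
  continuous_iff_continuousAt.2 fun g => ContinuousAt.comp (x := g) (f := fun g => (g, z))
    (g := fun q : G × Phase ke kh kf => coef (unip ρ q.1) q.2) (h.jointAt g z hz).continuousAt
    (by fun_prop)

lemma mem_ball_of_norm_le (h : HasExponents d r ρ U K δ) {z w : Phase ke kh kf} {c : ℝ}
    (hc : 0 < c) (hz : z ∈ Metric.ball 0 (δ / (c * K))) (hw : ‖w‖ ≤ c * K * ‖z‖) {η : ℝ}
    (hη : δ ≤ η) : w ∈ Metric.ball 0 η := by
  rw [mem_ball_zero_iff] at hz ⊢
  have : 0 < c * K := mul_pos hc (zero_lt_one.trans_le h.one_le)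
  rw [lt_div_iff₀ this] at hz
  linarith

/-- The cocycle relation of the exponents. -/
lemma coef_mul (h : HasExponents d r ρ U K δ) (g k : G) {z : Phase ke kh kf}
    (hz : z ∈ Metric.ball 0 (δ / (6 * K))) :
    coef (unip ρ (g * k)) z =
      coef (unip ρ k) (linearPart (ρ g⁻¹) z) + coef (unip ρ g) z := by
  have hK := h.one_le
  have hδ := h.pos
  have hK0 : 0 < 6 * K := by linarith
  have hle : δ / (6 * K) ≤ δ / 6 :=
    div_le_div_of_nonneg_left hδ.le (by norm_num) (by linarith)
  have hsub : Metric.ball (0 : Phase ke kh kf) (δ / (6 * K)) ⊆ Metric.ball 0 δ :=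
    Metric.ball_subset_ball (by linarith)
  have hL : ∀ y ∈ Metric.ball (0 : Phase ke kh kf) (δ / (6 * K)),
      linearPart (ρ g⁻¹) y ∈ Metric.ball 0 (δ / 6) := fun y hy => by
    have h1 := h.norm_linearPart_le g⁻¹ y
    rw [mem_ball_zero_iff] at hy ⊢
    rw [lt_div_iff₀ hK0] at hy
    linarith
  have hLδ : ∀ y ∈ Metric.ball (0 : Phase ke kh kf) (δ / (6 * K)),
      linearPart (ρ g⁻¹) y ∈ Metric.ball 0 δ := fun y hy =>
    Metric.ball_subset_ball (by linarith) (hL y hy)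
  have hd : ∀ g' : G, ∀ y ∈ Metric.ball (0 : Phase ke kh kf) δ,
      ContinuousAt (coef (unip ρ g')) y :=
    fun g' y hy => ((h.exponent g').differentiableAt y hy).continuousAt
  refine eq_of_eq_regular (f := coef (unip ρ (g * k)))
    (f' := fun z => coef (unip ρ k) (linearPart (ρ g⁻¹) z) + coef (unip ρ g) z)
    (hd _ z (hsub hz)) (ContinuousAt.add ?_ (hd _ z (hsub hz))) ?_
  · exact ContinuousAt.comp (g := coef (unip ρ k)) (hd k _ (hLδ z hz))
      (linearPart (ρ g⁻¹)).continuous.continuousAt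
  · filter_upwards [Metric.isOpen_ball.mem_nhds hz] with y hy hreg
    have hloc := h.isLocalAction
    have hyδ := hsub hy
    have hρ : ρ g⁻¹ y ∈ Metric.ball 0 δ :=
      h.mem_ball_of_norm_le (by norm_num) hy (h.norm_apply_le g⁻¹ hyδ) le_rfl
    -- the point `ρ(g)⁻¹ y` lies on the orbit of `ρ(g⁻¹)⁽¹⁾ y`
    have e1 : ρ g⁻¹ y = flow (coef (unip ρ g) y) (linearPart (ρ g⁻¹) y) := by
      rw [← hloc.linearPart_flow h.ne_zero, ← (h.exponent g).eq_flow y hyδ, unip,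
        hloc.linearPart_inv_apply h.ne_zero]
    have e2 : coef (unip ρ k) (ρ g⁻¹ y) = coef (unip ρ k) (linearPart (ρ g⁻¹) y) := by
      rw [e1]
      exact (h.exponent k).map_flow hδ
        (fun i => by linarith [(h.exponent g).small y hyδ i]) (hL y hy)
    have e3 : unip ρ (g * k) y = linearPart (ρ g) (unip ρ k (ρ g⁻¹ y)) := by
      rw [unip, unip, hloc.linearPart_mul h.ne_zero, mul_inv_rev,
        hloc.mul _ _ y (h.subset hyδ) (h.subset hρ)]
    rw [(h.exponent k).eq_flow _ hρ, e2, e1, ← flow_add, hloc.linearPart_flow h.ne_zero,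
      hloc.linearPart_apply_inv h.ne_zero, (h.exponent (g * k)).eq_flow y hyδ] at e3
    refine eq_of_flow_eq hreg (fun i => ?_) e3
    have s1 := (h.exponent (g * k)).small y hyδ i
    have s2 := (h.exponent k).small _ (hLδ y hy) i
    have s3 := (h.exponent g).small y hyδ i
    rw [Pi.add_apply]
    rw [abs_lt] at *
    constructor <;> linarith

variable [CompactSpace G] [T2Space G] [MeasurableSpace G] [BorelSpace G] {μ : Measure G}

/-- The average over the group of the exponents. -/
noncomputable def _root_.LinearSystem.averagedCoef (μ : Measure G)
    (ρ : G → Phase ke kh kf → Phase ke kh kf) (z : Phase ke kh kf) : Idx ke kh kf → ℝ :=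
  ∫ g, coef (unip ρ g) z ∂μ

lemma integrable_coef [IsFiniteMeasure μ] (h : HasExponents d r ρ U K δ) {z : Phase ke kh kf}
    (hz : z ∈ Metric.ball 0 δ) : Integrable (fun g => coef (unip ρ g) z) μ :=
  (h.continuous_coef hz).integrable_of_hasCompactSupport (HasCompactSupport.of_compactSpace _)

lemma averagedCoef_flow (h : HasExponents d r ρ U K δ) {c : Idx ke kh kf → ℝ}
    (hc : ∀ i, |c i| ≤ 1) {z : Phase ke kh kf} (hz : z ∈ Metric.ball 0 (δ / 6)) :
    averagedCoef μ ρ (flow c z) = averagedCoef μ ρ z := by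
  simp only [averagedCoef, (h.exponent _).map_flow h.pos hc hz]

lemma abs_averagedCoef_le [IsProbabilityMeasure μ] (h : HasExponents d r ρ U K δ)
    {z : Phase ke kh kf} (hz : z ∈ Metric.ball 0 δ) (i : Idx ke kh kf) :
    |averagedCoef μ ρ z i| ≤ 1 / 4 := by
  rw [averagedCoef, ← Real.norm_eq_abs]
  refine (norm_le_pi_norm _ i).trans ((norm_integral_le_of_norm_le_const
    (C := 1 / 4) (Eventually.of_forall fun g => ?_)).trans (by simp))
  exact (pi_norm_le_iff_of_nonneg (by norm_num)).2 fun i => ((h.exponent g).small z hz i).le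

/-- The cocycle relation, integrated over the group. -/
lemma averagedCoef_linearPart [ContinuousMul G] [μ.IsMulLeftInvariant] [IsProbabilityMeasure μ]
    [SecondCountableTopology G]
    (h : HasExponents d r ρ U K δ) (g : G) {z : Phase ke kh kf}
    (hz : z ∈ Metric.ball 0 (δ / (6 * K))) :
    averagedCoef μ ρ (linearPart (ρ g⁻¹) z) = averagedCoef μ ρ z - coef (unip ρ g) z := by
  have hK := h.one_le
  have hδ := h.pos
  have hsub : Metric.ball (0 : Phase ke kh kf) (δ / (6 * K)) ⊆ Metric.ball 0 δ := by
    refine Metric.ball_subset_ball (div_le_self hδ.le (by linarith))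
  have h1 : ∀ k, coef (unip ρ k) (linearPart (ρ g⁻¹) z) =
      coef (unip ρ (g * k)) z - coef (unip ρ g) z := fun k => by
    rw [h.coef_mul g k hz, add_sub_cancel_right]
  have hi := h.integrable_coef (μ := μ) (hsub hz)
  have hi' : Integrable (fun k => coef (unip ρ (g * k)) z) μ :=
    hi.comp_mul_left g
  simp only [averagedCoef, h1]
  rw [integral_sub hi' (integrable_const _), integral_mul_left_eq_self
    (fun k => coef (unip ρ k) z), integral_const, probReal_univ, one_smul]

/-- The map `z ↦ flow (averagedCoef μ ρ z) z` intertwines the action with its linear part. -/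
lemma flow_averagedCoef_apply [ContinuousMul G] [μ.IsMulLeftInvariant] [IsProbabilityMeasure μ]
    [SecondCountableTopology G]
    (h : HasExponents d r ρ U K δ) (g : G) {z : Phase ke kh kf}
    (hz : z ∈ Metric.ball 0 (δ / (36 * K))) (hw : ρ g z ∈ Metric.ball 0 (δ / (36 * K))) :
    flow (averagedCoef μ ρ (ρ g z)) (ρ g z) = linearPart (ρ g) (flow (averagedCoef μ ρ z) z) := by
  have hK := h.one_le
  have hδ := h.pos
  have hloc := h.isLocalAction
  have hsub : Metric.ball (0 : Phase ke kh kf) (δ / (36 * K)) ⊆ Metric.ball 0 (δ / 6) :=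
    Metric.ball_subset_ball (div_le_div_of_nonneg_left hδ.le (by norm_num) (by linarith))
  have hsub' : Metric.ball (0 : Phase ke kh kf) (δ / 6) ⊆ Metric.ball 0 δ :=
    Metric.ball_subset_ball (by linarith)
  have hc : ∀ i, |coef (unip ρ g) (ρ g z) i| ≤ 1 := fun i => by
    linarith [(h.exponent g).small _ (hsub' (hsub hw)) i]
  have e1 : linearPart (ρ g) z = flow (coef (unip ρ g) (ρ g z)) (ρ g z) := by
    rw [← (h.exponent g).eq_flow _ (hsub' (hsub hw)), unip, hloc.inv_apply g
      (h.subset (hsub' (hsub hz))) (h.subset (hsub' (hsub hw)))]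
  have hb : linearPart (ρ g) z ∈ Metric.ball 0 (δ / (6 * K)) := by
    rw [e1]
    refine flow_mem_ball hc ?_
    convert! hw using 2
    field_simp
    norm_num
  -- `ρ(g)⁽¹⁾ z` lies on the orbit of `ρ(g) z`, where the exponents are constant
  have e2 := h.averagedCoef_linearPart (μ := μ) g hb
  rw [hloc.linearPart_inv_apply h.ne_zero, e1, h.averagedCoef_flow hc (hsub hw),
    (h.exponent g).map_flow hδ hc (hsub hw)] at e2
  rw [hloc.linearPart_flow h.ne_zero, e1, e2, ← flow_add, sub_add_cancel]

lemma jointContDiffAt (h : HasExponents d r ρ U K δ) (g : G) {z : Phase ke kh kf}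
    (hz : z ∈ Metric.ball 0 δ) : ParamIntegral.JointContDiffAt (EuclideanSpace ℝ (Fin d)) r
      (fun g z => coef (unip ρ g) z) g z := by
  have : IsManifold (𝓡 d) r G := inferInstance
  exact (h.jointAt g z hz).jointContDiffAt

lemma isClosedAt_averagedCoef [SecondCountableTopology G] [IsFiniteMeasure μ]
    (h : HasExponents d r ρ U K δ) {z : Phase ke kh kf} (hz : z ∈ Metric.ball 0 δ) :
    IsClosedAt (fderiv ℝ (averagedCoef μ ρ) z) z := by
  have hr : ((1 : ℕ) : ℕ∞ω) ≤ r := by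
    simpa using ENat.one_le_iff_ne_zero_withTop.2 h.ne_zero
  have hj : ∀ g ∈ (univ : Set G), ParamIntegral.JointContDiffAt (EuclideanSpace ℝ (Fin d)) (1 : ℕ)
      (fun g z => coef (unip ρ g) z) g z := fun g _ => (h.jointContDiffAt g hz).of_le hr
  have hfd := (ParamIntegral.hasFDerivAt_integral (μ := μ) isCompact_univ (by simp) hj).fderiv
  have hint : Integrable (fun g => fderiv ℝ (coef (unip ρ g)) z) μ := by
    refine ParamIntegral.integrable_of_continuousAt isCompact_univ (by simp) fun g hg => ?_
    have := (ParamIntegral.JointContDiffAt.fderiv (n := 0) (hj g hg)).1.continuousAt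
    exact ContinuousAt.comp (x := g) (f := fun g => (g, z)) this (by fun_prop)
  have key : ∀ u v, omegaL (gen (fderiv ℝ (averagedCoef μ ρ) z u) z) v =
      ∫ g, omegaL (gen (fderiv ℝ (coef (unip ρ g)) z u) z) v ∂μ := fun u v => by
    let T : (Phase ke kh kf →L[ℝ] Idx ke kh kf → ℝ) →L[ℝ] ℝ :=
      (omegaL.flip v).comp ((gen.flip z).comp (ContinuousLinearMap.apply ℝ _ u))
    have h1 := T.integral_comp_comm hint
    rw [← hfd] at h1
    exact h1.symm
  intro u v
  rw [key u v, key v u]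
  exact integral_congr_ae (Eventually.of_forall fun g => (h.exponent g).isClosedAt hz u v)

end HasExponents

end Exponents

/-! ### Uniformity over the group, and invariant domains -/

section Family

variable {d m : ℕ} {G : Type*} [Group G] [TopologicalSpace G]
  [ChartedSpace (EuclideanSpace ℝ (Fin d)) G] {r : ℕ∞ω} [LieGroup (𝓡 d) r G]

/-- A local action as a family over the disk of dimension zero. -/
lemma IsLocalAction.isLocalActionFamily {ρ : G → Phase ke kh kf → Phase ke kh kf}
    {U : Set (Phase ke kh kf)} (h : IsLocalAction (d := d) r ρ U) :
    IsLocalActionFamily (d := d) (m := 0) r (fun _ => ρ) 1 {q | q.2 ∈ U} where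
  isOpen := h.isOpen.preimage continuous_snd
  subset := fun q _ => ⟨by simp [Subsingleton.elim q.1 0], mem_univ _⟩
  contMDiffOn := h.contMDiffOn.comp contMDiff_snd.contMDiffOn fun q hq => ⟨mem_univ _, hq⟩
  action := fun _ _ => h

variable {ρ : EuclideanSpace ℝ (Fin m) → G → Phase ke kh kf → Phase ke kh kf} {ε : ℝ}
  {W : Set (EuclideanSpace ℝ (Fin m) × Phase ke kh kf)}

namespace IsLocalActionFamily

lemma continuousAt_linearPart (h : IsLocalActionFamily (d := d) r ρ ε W) (hr : r = ∞ ∨ r = ω)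
    (g : G) {p : EuclideanSpace ℝ (Fin m)} (hp : p ∈ Metric.ball 0 ε) :
    ContinuousAt (fun q : EuclideanSpace ℝ (Fin m) × G => linearPart (ρ q.1 q.2)) (p, g) :=
  ContinuousAt.comp (x := (p, g)) (f := Prod.swap)
    (g := fun q : G × EuclideanSpace ℝ (Fin m) => linearPart (ρ q.2 q.1))
    (h.jointAt_linearPart hr hp).continuousAt continuous_swap.continuousAt

variable [CompactSpace G]

/-- The exponents of a family of local actions of a compact group exist on balls locally
independent of the parameter. -/
lemma exists_hasExponents (h : IsLocalActionFamily (d := d) r ρ ε W) (hr : r = ∞ ∨ r = ω)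
    {p₀ : EuclideanSpace ℝ (Fin m)} (hp₀ : p₀ ∈ Metric.ball 0 ε) :
    ∃ K δ : ℝ, 0 < δ ∧ ∀ p ∈ Metric.ball p₀ δ, p ∈ Metric.ball 0 ε ∧
      HasExponents d r (ρ p) {z | (p, z) ∈ W} K δ ∧
      ∀ g : G, ∀ z ∈ Metric.ball (0 : Phase ke kh kf) δ,
        JointAt d r (fun q : G × (EuclideanSpace ℝ (Fin m) × Phase ke kh kf) =>
          coef (unip (ρ q.2.1) q.1) q.2.2) (g, (p, z)) := by
  have hr1 : 1 ≤ r := by rcases hr with rfl | rfl <;> simp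
  have hr0 : r ≠ 0 := (zero_lt_one.trans_le hr1).ne'
  obtain ⟨B, hB⟩ := (isCompact_univ (X := G)).exists_bound_of_continuousOn
    (f := fun g => linearPart (ρ p₀ g)) fun g _ =>
      (ContinuousAt.comp (x := g) (f := fun g => (p₀, g)) (h.continuousAt_linearPart hr g hp₀)
        (by fun_prop)).continuousWithinAt
  have hL : ∀ᶠ p in 𝓝 p₀, ∀ g ∈ (univ : Set G), ‖linearPart (ρ p g)‖ < B + 1 :=
    isCompact_univ.eventually_forall_of_forall_eventually fun g hg =>
      (h.continuousAt_linearPart hr g hp₀).norm.eventually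
        (gt_mem_nhds ((hB g hg).trans_lt (lt_add_one B)))
  have hC : ∀ᶠ q in 𝓝 (p₀, (0 : Phase ke kh kf)), ∀ g ∈ (univ : Set G),
      JointAt d r (fun q : G × (EuclideanSpace ℝ (Fin m) × Phase ke kh kf) =>
        coef (unip (ρ q.2.1) q.1) q.2.2) (g, q) ∧
      (∀ i, |coef (unip (ρ q.1) g) q.2 i| < 1 / 4) ∧
      unip (ρ q.1) g q.2 = flow (coef (unip (ρ q.1) g) q.2) q.2 :=
    isCompact_univ.eventually_forall_of_forall_eventually fun g _ =>
      h.eventually_coef_unip hr g hp₀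
  have hW : ∀ᶠ q in 𝓝 (p₀, (0 : Phase ke kh kf)), q ∈ W := h.isOpen.mem_nhds (h.zero_mem hp₀)
  obtain ⟨e1, he1, h1⟩ := Metric.eventually_nhds_iff_ball.1 hL
  obtain ⟨e2, he2, h2⟩ := Metric.eventually_nhds_iff_ball.1 (hC.and hW)
  have hmem : ∀ p ∈ Metric.ball p₀ (min e1 e2), ∀ z ∈ Metric.ball (0 : Phase ke kh kf) (min e1 e2),
      (p, z) ∈ Metric.ball (p₀, (0 : Phase ke kh kf)) e2 := fun p hp z hz => by
    rw [← ball_prod_same]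
    exact ⟨Metric.ball_subset_ball (min_le_right _ _) hp,
      Metric.ball_subset_ball (min_le_right _ _) hz⟩
  refine ⟨max 1 (B + 1), min e1 e2, lt_min he1 he2, fun p hp => ?_⟩
  have hpε : p ∈ Metric.ball 0 ε := (h.subset (h2 (p, 0) (hmem p hp 0
    (Metric.mem_ball_self (lt_min he1 he2)))).2).1
  have hj : ∀ g : G, ∀ z ∈ Metric.ball (0 : Phase ke kh kf) (min e1 e2),
        JointAt d r (fun q : G × (EuclideanSpace ℝ (Fin m) × Phase ke kh kf) =>
          coef (unip (ρ q.2.1) q.1) q.2.2) (g, (p, z)) := fun g z hz =>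
    ((h2 (p, z) (hmem p hp z hz)).1 g (mem_univ g)).1
  have hjz : ∀ g, ∀ z ∈ Metric.ball (0 : Phase ke kh kf) (min e1 e2),
      JointAt d r (fun q : G × Phase ke kh kf => coef (unip (ρ p) q.1) q.2) (g, z) := fun g z hz =>
    JointAt.comp_right (f := fun z => (p, z)) (hj g z hz) (by fun_prop)
  have hsub : Metric.ball (0 : Phase ke kh kf) (min e1 e2) ⊆ {z | (p, z) ∈ W} := fun z hz =>
    (h2 (p, z) (hmem p hp z hz)).2
  refine ⟨hpε, ⟨h.action p hpε, hr0, lt_min he1 he2, le_max_left _ _, hsub, fun g z => ?_,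
    fun g => ⟨(h.action p hpε).isUnipotentOn hr1 g hsub, fun z hz => ?_, fun z hz => ?_,
      fun z hz => ?_⟩, hjz⟩, hj⟩
  · exact (linearPart (ρ p g)).le_of_opNorm_le (((h1 p (Metric.ball_subset_ball
      (min_le_left _ _) hp) g (mem_univ g)).le).trans (le_max_right _ _)) z
  · have := JointAt.comp_symm g (mem_extChartAt_target g) (x := z) (r := r)
      (F := fun q : G × Phase ke kh kf => coef (unip (ρ p) q.1) q.2)
      (by simpa using hjz g z hz)
    have h3 := ContDiffAt.comp z (f := fun z => (extChartAt (𝓡 d) g g, z)) this (by fun_prop)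
    simp only [Function.comp_def, extChartAt_to_inv] at h3
    exact h3.differentiableAt hr0
  · exact ((h2 (p, z) (hmem p hp z hz)).1 g (mem_univ g)).2.1
  · exact ((h2 (p, z) (hmem p hp z hz)).1 g (mem_univ g)).2.2

variable {W₀ : Set (EuclideanSpace ℝ (Fin m) × Phase ke kh kf)}

/-- The points whose orbits stay in `W₀` form an open set. -/
lemma isOpen_orbits (h : IsLocalActionFamily (d := d) r ρ ε W) (hW : IsOpen W₀) (hsub : W₀ ⊆ W) :
    IsOpen {q | q ∈ W₀ ∧ ∀ g, (q.1, ρ q.1 g q.2) ∈ W₀} := by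
  refine isOpen_iff_mem_nhds.2 fun q hq => ?_
  have h1 : ∀ᶠ q' in 𝓝 q, ∀ g ∈ (univ : Set G), (q'.1, ρ q'.1 g q'.2) ∈ W₀ := by
    refine isCompact_univ.eventually_forall_of_forall_eventually fun g _ => ?_
    have h2 : ContinuousAt (fun w : (EuclideanSpace ℝ (Fin m) × Phase ke kh kf) × G =>
        (w.1.1, ρ w.1.1 w.2 w.1.2)) (q, g) := by
      refine ContinuousAt.prodMk (by fun_prop) ?_
      exact ContinuousAt.comp (x := (q, g)) (f := Prod.swap)
        (g := fun q : G × (EuclideanSpace ℝ (Fin m) × Phase ke kh kf) => ρ q.2.1 q.1 q.2.2)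
        (h.jointAt (r := r) (hsub hq.1)).continuousAt continuous_swap.continuousAt
    exact h2.eventually (hW.mem_nhds (hq.2 g))
  filter_upwards [hW.mem_nhds hq.1, h1] with q' h3 h4
  exact ⟨h3, fun g => h4 g (mem_univ g)⟩

lemma mem_orbits (h : IsLocalActionFamily (d := d) r ρ ε W) (hsub : W₀ ⊆ W)
    {q : EuclideanSpace ℝ (Fin m) × Phase ke kh kf}
    (hq : q ∈ {q | q ∈ W₀ ∧ ∀ g, (q.1, ρ q.1 g q.2) ∈ W₀}) (g : G) :
    (q.1, ρ q.1 g q.2) ∈ {q | q ∈ W₀ ∧ ∀ g, (q.1, ρ q.1 g q.2) ∈ W₀} := by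
  refine ⟨hq.2 g, fun k => ?_⟩
  have h1 := (h.action q.1 (h.subset (hsub hq.1)).1).mul k g q.2 (hsub hq.1) (hsub (hq.2 g))
  simp only [← h1]
  exact hq.2 (k * g)

lemma zero_mem_orbits (h : IsLocalActionFamily (d := d) r ρ ε W) {p : EuclideanSpace ℝ (Fin m)}
    (hp : p ∈ Metric.ball 0 ε) (h0 : (p, (0 : Phase ke kh kf)) ∈ W₀) :
    (p, (0 : Phase ke kh kf)) ∈ {q | q ∈ W₀ ∧ ∀ g, (q.1, ρ q.1 g q.2) ∈ W₀} :=
  ⟨h0, fun g => by simpa only [(h.action p hp).map_zero] using h0⟩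

end IsLocalActionFamily

end Family

/-! ### The linear parts of a family do not depend on the parameter -/

/-- Coefficients for which `gen cyclicCoef` is a rotation on every elliptic block, and expands `x`
and contracts `y` on the other blocks. -/
def cyclicCoef : Idx ke kh kf → ℝ
  | .inl _ => 1
  | .inr (.inl _) => 1
  | .inr (.inr (_, 0)) => 0
  | .inr (.inr (_, 1)) => 1

/-- The vector all of whose coordinates are one is cyclic for the algebra generated by the linear
vector fields `gen c`. -/
lemma exists_gen_add_gen_gen (u : Phase ke kh kf) : ∃ c c' : Idx ke kh kf → ℝ,
    u = gen c 1 + gen cyclicCoef (gen c' 1) := by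
  refine ⟨fun i => match i with
    | .inl i => (u.1 (.inl i) - u.2 (.inl i)) / 4
    | .inr (.inl i) => (u.1 (.inr (.inl i)) - u.2 (.inr (.inl i))) / 2
    | .inr (.inr (j, 0)) => (u.1 (.inr (.inr (j, 1))) - u.1 (.inr (.inr (j, 0))) +
        u.2 (.inr (.inr (j, 1))) - u.2 (.inr (.inr (j, 0)))) / 4
    | .inr (.inr (j, 1)) => (u.1 (.inr (.inr (j, 1))) + u.1 (.inr (.inr (j, 0))) -
        u.2 (.inr (.inr (j, 1))) - u.2 (.inr (.inr (j, 0)))) / 4,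
    fun i => match i with
    | .inl i => -(u.1 (.inl i) + u.2 (.inl i)) / 8
    | .inr (.inl i) => (u.1 (.inr (.inl i)) + u.2 (.inr (.inl i))) / 2
    | .inr (.inr (j, 0)) => (u.1 (.inr (.inr (j, 1))) - u.1 (.inr (.inr (j, 0))) -
        u.2 (.inr (.inr (j, 1))) + u.2 (.inr (.inr (j, 0)))) / 4
    | .inr (.inr (j, 1)) => (u.1 (.inr (.inr (j, 1))) + u.1 (.inr (.inr (j, 0))) +
        u.2 (.inr (.inr (j, 1))) + u.2 (.inr (.inr (j, 0)))) / 4, ?_⟩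
  apply phase_ext <;> intro i <;> simp [gen_apply, genFun, cyclicCoef] <;> ring

/-- Linear maps commuting with all the linear vector fields `gen c` commute with one another. -/
lemma comm_of_gen_comm {M M' : Phase ke kh kf →L[ℝ] Phase ke kh kf}
    (hM : ∀ c z, M (gen c z) = gen c (M z)) (hM' : ∀ c z, M' (gen c z) = gen c (M' z))
    (z : Phase ke kh kf) : M (M' z) = M' (M z) := by
  obtain ⟨a, a', ha⟩ := exists_gen_add_gen_gen z
  obtain ⟨b, b', hb⟩ := exists_gen_add_gen_gen (M 1)
  obtain ⟨e, e', he⟩ := exists_gen_add_gen_gen (M' 1)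
  have key : M (M' 1) = M' (M 1) := by
    rw [he, hb]
    simp only [map_add, hM, hM']
    rw [he, hb]
    simp only [map_add, gen_comm b, gen_comm b']
    simp only [gen_comm cyclicCoef e, gen_comm cyclicCoef e']
    abel
  rw [ha]
  simp only [map_add, hM, hM', key]

/-- A multiplicative map into a normed algebra with values uniformly close to one is trivial: the
units have no small subgroups. -/
lemma eq_one_of_norm_sub_one_le {G E : Type*} [Monoid G] [NormedRing E] [NormedAlgebra ℝ E]
    (B : G →* E) (hB : ∀ g, ‖B g - 1‖ ≤ 1 / 2) (g : G) : B g = 1 := by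
  have key : ∀ n : ℕ, ∀ g, ‖B g - 1‖ ≤ (2 / 3) ^ n * (1 / 2) := fun n => by
    induction n with
    | zero => simpa using hB
    | succ n ih =>
      intro g
      have h1 : (2 : ℝ) • (B g - 1) = (B (g * g) - 1) - (B g - 1) * (B g - 1) := by
        rw [map_mul, two_smul]; noncomm_ring
      have h2 : 2 * ‖B g - 1‖ ≤ ‖B (g * g) - 1‖ + ‖B g - 1‖ * ‖B g - 1‖ := by
        rw [← abs_of_pos (zero_lt_two (α := ℝ)), ← Real.norm_eq_abs, ← norm_smul, h1]
        exact (norm_sub_le _ _).trans (add_le_add_right (norm_mul_le _ _) _)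
      have h3 := ih (g * g)
      have h4 := hB g
      rw [pow_succ]
      nlinarith [norm_nonneg (B g - 1)]
  have h0 : Tendsto (fun n : ℕ => (2 / 3 : ℝ) ^ n * (1 / 2)) atTop (𝓝 0) := by
    have := (tendsto_pow_atTop_nhds_zero_of_lt_one (r := (2 / 3 : ℝ)) (by norm_num)
      (by norm_num)).mul_const (1 / 2)
    rwa [zero_mul] at this
  have := ge_of_tendsto' h0 fun n => key n g
  exact sub_eq_zero.1 (norm_le_zero_iff.1 this)

section Family

variable {d m : ℕ} {G : Type*} [Group G] [TopologicalSpace G]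
  [ChartedSpace (EuclideanSpace ℝ (Fin d)) G] {r : ℕ∞ω} [LieGroup (𝓡 d) r G] [CompactSpace G]
  {ρ : EuclideanSpace ℝ (Fin m) → G → Phase ke kh kf → Phase ke kh kf} {ε : ℝ}
  {W : Set (EuclideanSpace ℝ (Fin m) × Phase ke kh kf)}

namespace IsLocalActionFamily

/-- A small deformation of a representation commuting with it is constant. -/
lemma eventually_linearPart_eq (h : IsLocalActionFamily (d := d) r ρ ε W) (hr : r = ∞ ∨ r = ω)
    {p₀ : EuclideanSpace ℝ (Fin m)} (hp₀ : p₀ ∈ Metric.ball 0 ε) :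
    ∀ᶠ p in 𝓝 p₀, ∀ g, linearPart (ρ p g) = linearPart (ρ p₀ g) := by
  have hr0 : r ≠ 0 := by rcases hr with rfl | rfl <;> simp
  have : IsTopologicalGroup G := topologicalGroup_of_lieGroup (𝓡 d) r
  have h₀ := h.action p₀ hp₀
  have h1 : ∀ᶠ p in 𝓝 p₀, ∀ g ∈ (univ : Set G),
      ‖linearPart (ρ p g) * linearPart (ρ p₀ g⁻¹) - 1‖ < 1 / 2 := by
    refine isCompact_univ.eventually_forall_of_forall_eventually fun g _ => ?_
    have h2 : ContinuousAt (fun q : EuclideanSpace ℝ (Fin m) × G => linearPart (ρ p₀ q.2⁻¹))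
        (p₀, g) :=
      ContinuousAt.comp (x := (p₀, g))
        (f := fun q : EuclideanSpace ℝ (Fin m) × G => (p₀, q.2⁻¹))
        (g := fun q : EuclideanSpace ℝ (Fin m) × G => linearPart (ρ q.1 q.2))
        (h.continuousAt_linearPart hr g⁻¹ hp₀) (by fun_prop)
    have h3 := (((h.continuousAt_linearPart hr g hp₀).mul h2).sub
      (continuousAt_const (y := 1))).norm
    refine h3.eventually (gt_mem_nhds ?_)
    have : linearPart (ρ p₀ g) * linearPart (ρ p₀ g⁻¹) = 1 :=
      ContinuousLinearMap.ext fun z => h₀.linearPart_apply_inv hr0 g z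
    simp [this]
  filter_upwards [h1, Metric.isOpen_ball.mem_nhds hp₀] with p hp hpε g
  have hp' := h.action p hpε
  -- `g ↦ ρ_p(g)⁽¹⁾ ρ_{p₀}(g)⁽¹⁾⁻¹` is a homomorphism, as the linear parts commute
  let B : G →* (Phase ke kh kf →L[ℝ] Phase ke kh kf) :=
    { toFun := fun g => linearPart (ρ p g) * linearPart (ρ p₀ g⁻¹)
      map_one' := ContinuousLinearMap.ext fun z => by
        simp [hp'.linearPart_one, h₀.linearPart_one]
      map_mul' := fun g k => ContinuousLinearMap.ext fun z => by
        simp only [mul_apply_eq_comp, mul_inv_rev, hp'.linearPart_mul hr0,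
          h₀.linearPart_mul hr0]
        congr 1
        rw [comm_of_gen_comm (h₀.linearPart_gen hr0 g⁻¹) (hp'.linearPart_gen hr0 k),
          comm_of_gen_comm (h₀.linearPart_gen hr0 g⁻¹) (h₀.linearPart_gen hr0 k⁻¹)] }
  have hB := eq_one_of_norm_sub_one_le B (fun g => (hp g (mem_univ g)).le) g
  refine ContinuousLinearMap.ext fun z => ?_
  have h2 := congrArg (fun L => L (linearPart (ρ p₀ g) z)) hB
  have h3 : linearPart (ρ p g) (linearPart (ρ p₀ g⁻¹) (linearPart (ρ p₀ g) z)) =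
    linearPart (ρ p₀ g) z := h2
  rwa [h₀.linearPart_inv_apply hr0] at h3

lemma linearPart_eq (h : IsLocalActionFamily (d := d) r ρ ε W) (hr : r = ∞ ∨ r = ω)
    {p q : EuclideanSpace ℝ (Fin m)} (hp : p ∈ Metric.ball 0 ε) (hq : q ∈ Metric.ball 0 ε) (g : G) :
    linearPart (ρ p g) = linearPart (ρ q g) := by
  refine Metric.isPreconnected_ball.induction₂
    (fun p q => ∀ g, linearPart (ρ p g) = linearPart (ρ q g)) (fun x hx => ?_)
    (fun x y z _ _ _ hxy hyz g => (hxy g).trans (hyz g)) (fun x y _ _ hxy g => (hxy g).symm)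
    hp hq g
  filter_upwards [nhdsWithin_le_nhds (h.eventually_linearPart_eq hr hx)] with y hy g
  exact (hy g).symm

end IsLocalActionFamily

end Family

/-! ### Linearization of a family of local actions -/

section Family

variable {d m : ℕ} {G : Type*} [Group G] [TopologicalSpace G]
  [ChartedSpace (EuclideanSpace ℝ (Fin d)) G] {r : ℕ∞ω} [LieGroup (𝓡 d) r G] [CompactSpace G]
  [T2Space G] [MeasurableSpace G] [BorelSpace G]

lemma contDiffAt_averagedCoef [SecondCountableTopology G] {μ : Measure G} [IsFiniteMeasure μ]
    (hr : r = ∞ ∨ r = ω) {ρ : EuclideanSpace ℝ (Fin m) → G → Phase ke kh kf → Phase ke kh kf}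
    {x : EuclideanSpace ℝ (Fin m) × Phase ke kh kf}
    (hj : ∀ g : G, JointAt d r (fun q : G × (EuclideanSpace ℝ (Fin m) × Phase ke kh kf) =>
          coef (unip (ρ q.2.1) q.1) q.2.2) (g, x)) :
    ContDiffAt ℝ r (fun x : EuclideanSpace ℝ (Fin m) × Phase ke kh kf =>
      averagedCoef μ (ρ x.1) x.2) x := by
  have : IsManifold (𝓡 d) r G := inferInstance
  exact ParamIntegral.contDiffAt_integral (𝔸 := EuclideanSpace ℝ (Fin d)) hr isCompact_univ
    (by simp) fun g _ => (hj g).jointContDiffAt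

lemma HasExponents.contDiffAt_averagedCoef [SecondCountableTopology G] {μ : Measure G}
    [IsFiniteMeasure μ] (hr : r = ∞ ∨ r = ω) {ρ : G → Phase ke kh kf → Phase ke kh kf}
    {U : Set (Phase ke kh kf)} {K δ : ℝ} (h : HasExponents d r ρ U K δ) {z : Phase ke kh kf}
    (hz : z ∈ Metric.ball 0 δ) : ContDiffAt ℝ r (averagedCoef μ ρ) z :=
  ParamIntegral.contDiffAt_integral (𝔸 := EuclideanSpace ℝ (Fin d)) hr isCompact_univ
    (by simp) fun g _ => h.jointContDiffAt g hz

/-- The averaged map is an automorphism of the system on every open set covered by balls on which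
the exponents exist. -/
lemma isSystemAutomorphism_averaged [SecondCountableTopology G] {μ : Measure G}
    [IsProbabilityMeasure μ] (hr : r = ∞ ∨ r = ω) {ρ : G → Phase ke kh kf → Phase ke kh kf}
    {U V : Set (Phase ke kh kf)} (hV : IsOpen V) (h0 : (0 : Phase ke kh kf) ∈ V)
    (h : ∀ z ∈ V, ∃ K δ, HasExponents d r ρ U K δ ∧ z ∈ Metric.ball 0 (δ / (36 * K))) :
    IsSystemAutomorphism r (fun z => flow (averagedCoef μ ρ z) z) V := by
  have hr0 : r ≠ 0 := by rcases hr with rfl | rfl <;> simp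
  set O : Set (Phase ke kh kf) := {z | ∃ K δ, HasExponents d r ρ U K δ ∧
    z ∈ Metric.ball 0 (δ / 6)} with hO
  have hOo : IsOpen O := isOpen_iff_mem_nhds.2 fun z ⟨K, δ, h1, h2⟩ => by
    filter_upwards [Metric.isOpen_ball.mem_nhds h2] with y hy
    exact ⟨K, δ, h1, hy⟩
  have h36 : ∀ {K δ : ℝ}, HasExponents d r ρ U K δ →
      Metric.ball (0 : Phase ke kh kf) (δ / (36 * K)) ⊆ Metric.ball 0 (δ / 6 / 6) := fun h1 =>
    Metric.ball_subset_ball (by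
      rw [div_div]
      exact div_le_div_of_nonneg_left h1.pos.le (by norm_num) (by linarith [h1.one_le]))
  have h6 : ∀ {K δ : ℝ}, HasExponents d r ρ U K δ →
      Metric.ball (0 : Phase ke kh kf) (δ / 6) ⊆ Metric.ball 0 δ := fun h1 =>
    Metric.ball_subset_ball (by linarith [h1.pos])
  have h66 : ∀ {K δ : ℝ}, HasExponents d r ρ U K δ →
      Metric.ball (0 : Phase ke kh kf) (δ / 6 / 6) ⊆ Metric.ball 0 (δ / 6) := fun h1 =>
    Metric.ball_subset_ball (by linarith [h1.pos])
  have hc : ∀ {K δ : ℝ}, HasExponents d r ρ U K δ → ∀ z ∈ Metric.ball (0 : Phase ke kh kf) (δ / 6),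
      ∀ i, |averagedCoef μ ρ z i| ≤ 1 := fun h1 z hz i => by
    linarith [h1.abs_averagedCoef_le (μ := μ) (h6 h1 hz) i]
  refine isSystemAutomorphism_flow hr0 hOo (fun z ⟨K, δ, h1, h2⟩ => ?_) (fun z ⟨K, δ, h1, h2⟩ => ?_)
    hV (fun z hz => ?_) h0 (fun z hz => ?_) fun z ⟨K, δ, h1, h2⟩ => ?_
  · exact (h1.contDiffAt_averagedCoef hr (h6 h1 h2)).contDiffWithinAt
  · exact h1.isClosedAt_averagedCoef (h6 h1 h2)
  · obtain ⟨K, δ, h1, h2⟩ := h z hz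
    exact ⟨K, δ, h1, h66 h1 (h36 h1 h2)⟩
  · obtain ⟨K, δ, h1, h2⟩ := h z hz
    have h3 := h66 h1 (h36 h1 h2)
    exact ⟨⟨K, δ, h1, flow_mem_ball (hc h1 z h3) (h36 h1 h2)⟩,
      h1.averagedCoef_flow (hc h1 z h3) h3⟩
  · refine h1.averagedCoef_flow (fun i => ?_) h2
    rw [Pi.neg_apply, abs_neg]
    exact hc h1 z h2 i

/-- Linearization of a family of local actions, with a linear model independent of the parameter. -/
theorem IsLocalActionFamily.exists_linearization (hr : r = ∞ ∨ r = ω)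
    {ρ : EuclideanSpace ℝ (Fin m) → G → Phase ke kh kf → Phase ke kh kf} {ε : ℝ}
    {W : Set (EuclideanSpace ℝ (Fin m) × Phase ke kh kf)} (hε : 0 < ε)
    (h : IsLocalActionFamily (d := d) r ρ ε W) :
    ∃ (W' : Set (EuclideanSpace ℝ (Fin m) × Phase ke kh kf))
        (Φ : EuclideanSpace ℝ (Fin m) → Phase ke kh kf → Phase ke kh kf),
        IsOpen W' ∧ W' ⊆ W ∧
        ContDiffOn ℝ r (fun q : EuclideanSpace ℝ (Fin m) × Phase ke kh kf => Φ q.1 q.2) W' ∧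
        IsLinearSystemAction (ρ 0) ∧
        ∀ p ∈ Metric.ball (0 : EuclideanSpace ℝ (Fin m)) ε,
          IsSystemAutomorphism r (Φ p) {z | (p, z) ∈ W'} ∧
          ∀ g z, (p, z) ∈ W' →
            (p, ρ p g z) ∈ W' ∧ Φ p (ρ p g z) = linearPart (ρ 0 g) (Φ p z) := by
  have hr0 : r ≠ 0 := by rcases hr with rfl | rfl <;> simp
  have : IsTopologicalGroup G := topologicalGroup_of_lieGroup (𝓡 d) r
  have : SecondCountableTopology G :=
    ChartedSpace.secondCountable_of_sigmaCompact (EuclideanSpace ℝ (Fin d)) G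
  let μ : Measure G := Measure.haarMeasure ⊤
  have hμ : IsProbabilityMeasure μ := ⟨by
    have := Measure.haarMeasure_self (K₀ := (⊤ : TopologicalSpace.PositiveCompacts G))
    simpa [μ] using this⟩
  choose! K δ hδ hexp using fun p (hp : p ∈ Metric.ball (0 : EuclideanSpace ℝ (Fin m)) ε) =>
    h.exists_hasExponents hr hp
  -- near each `(p₀, 0)`, the product of a ball of parameters with a ball where exponents exist
  set W₀ : Set (EuclideanSpace ℝ (Fin m) × Phase ke kh kf) := {q | ∃ p₀ ∈ Metric.ball 0 ε,
    q.1 ∈ Metric.ball p₀ (δ p₀) ∧ q.2 ∈ Metric.ball 0 (δ p₀ / (36 * K p₀))} with hW₀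
  have hW₀o : IsOpen W₀ := isOpen_iff_mem_nhds.2 fun q ⟨p₀, hp₀, h1, h2⟩ => by
    filter_upwards [continuousAt_fst.eventually (Metric.isOpen_ball.mem_nhds h1),
      continuousAt_snd.eventually (Metric.isOpen_ball.mem_nhds h2)] with q' h3 h4
    exact ⟨p₀, hp₀, h3, h4⟩
  have hball : ∀ {ρ' : G → Phase ke kh kf → Phase ke kh kf} {U K' δ'},
      HasExponents d r ρ' U K' δ' →
      Metric.ball (0 : Phase ke kh kf) (δ' / (36 * K')) ⊆ Metric.ball 0 δ' := fun h1 =>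
    Metric.ball_subset_ball (div_le_self h1.pos.le (by linarith [h1.one_le]))
  have hW₀W : W₀ ⊆ W := fun q ⟨p₀, hp₀, h1, h2⟩ =>
    (hexp p₀ hp₀ q.1 h1).2.1.subset (hball (hexp p₀ hp₀ q.1 h1).2.1 h2)
  refine ⟨{q | q ∈ W₀ ∧ ∀ g, (q.1, ρ q.1 g q.2) ∈ W₀},
    fun p z => flow (averagedCoef μ (ρ p) z) z, h.isOpen_orbits hW₀o hW₀W,
    fun q hq => hW₀W hq.1, fun q hq => ?_,
    (h.action 0 (Metric.mem_ball_self hε)).isLinearSystemAction hr0, fun p hp => ⟨?_, ?_⟩⟩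
  · obtain ⟨p₀, hp₀, h1, h2⟩ := hq.1
    obtain ⟨-, h3, h4⟩ := hexp p₀ hp₀ q.1 h1
    exact ((contDiffAt_averagedCoef hr fun g => h4 g q.2 (hball h3 h2)).flow
      contDiffAt_snd).contDiffWithinAt
  · refine isSystemAutomorphism_averaged (d := d) hr
      ((h.isOpen_orbits hW₀o hW₀W).preimage (by fun_prop : Continuous fun z => (p, z)))
      (h.zero_mem_orbits hp ⟨p, hp, Metric.mem_ball_self (hδ p hp), Metric.mem_ball_self ?_⟩)
      (U := {z | (p, z) ∈ W}) fun z hz => ?_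
    · have := (hexp p hp p (Metric.mem_ball_self (hδ p hp))).2.1
      exact div_pos this.pos (by linarith [this.one_le])
    · obtain ⟨p₀, hp₀, h1, h2⟩ := hz.1
      exact ⟨K p₀, δ p₀, (hexp p₀ hp₀ p h1).2.1, h2⟩
  · intro g z hz
    refine ⟨h.mem_orbits hW₀W hz g, ?_⟩
    obtain ⟨p₀, hp₀, h1, h2⟩ := hz.1
    obtain ⟨p₁, hp₁, h3, h4⟩ := hz.2 g
    have e₀ := (hexp p₀ hp₀ p h1).2.1
    have e₁ := (hexp p₁ hp₁ p h3).2.1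
    rw [← h.linearPart_eq hr hp (Metric.mem_ball_self hε) g]
    -- the larger of the two balls contains both points
    rcases le_total (δ p₀ / (36 * K p₀)) (δ p₁ / (36 * K p₁)) with hle | hle
    · exact e₁.flow_averagedCoef_apply g (Metric.ball_subset_ball hle h2) h4
    · exact e₀.flow_averagedCoef_apply g h2 (Metric.ball_subset_ball hle h4)

end Family

/-! ### The generating Hamiltonians -/

lemma hamVF_eq_of_hasFDerivAt {f : Phase ke kh kf → ℝ} {X z : Phase ke kh kf}
    (h : HasFDerivAt f (omegaL X) z) : hamVF f z = X := by
  refine Prod.ext (funext fun i => ?_) (funext fun i => ?_)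
  · simp only [hamVF, h.fderiv, omegaL_single_right]
  · simp only [hamVF, h.fderiv, omegaL_single_left, neg_neg]

/-- The primitive, vanishing at the origin, of the one-form `∑ i, C i • dh i`, which is the
contraction of the symplectic form with the vector field `z ↦ gen (C z) z`. -/
noncomputable def potential (C : Phase ke kh kf → Idx ke kh kf → ℝ) (z : Phase ke kh kf) : ℝ :=
  ∫ s in (0 : ℝ)..1, omegaL (gen (C (s • z)) (s • z)) z

lemma potential_zero (C : Phase ke kh kf → Idx ke kh kf → ℝ) : potential C 0 = 0 := by
  simp [potential]

lemma smul_mem_ball {η : ℝ} {z : Phase ke kh kf} (hz : z ∈ Metric.ball 0 η) {s : ℝ}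
    (hs : s ∈ Icc (0 : ℝ) 1) : s • z ∈ Metric.ball 0 η := by
  rw [mem_ball_zero_iff] at hz ⊢
  rw [norm_smul, Real.norm_of_nonneg hs.1]
  nlinarith [norm_nonneg z, hs.1, hs.2]

/-- The Poincaré lemma for the closed one-form `∑ i, C i • dh i`. -/
lemma hasFDerivAt_potential {C : Phase ke kh kf → Idx ke kh kf → ℝ} {η : ℝ}
    (hC : ContDiffOn ℝ 1 C (Metric.ball 0 η))
    (hcl : ∀ z ∈ Metric.ball 0 η, IsClosedAt (fderiv ℝ C z) z) {z : Phase ke kh kf}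
    (hz : z ∈ Metric.ball 0 η) : HasFDerivAt (potential C) (omegaL (gen (C z) z)) z := by
  have hCd : ∀ s ∈ Icc (0 : ℝ) 1, ContDiffAt ℝ 1 C (s • z) := fun s hs =>
    hC.contDiffAt (Metric.isOpen_ball.mem_nhds (smul_mem_ball hz hs))
  have hCf : ∀ s ∈ Icc (0 : ℝ) 1, HasFDerivAt C (fderiv ℝ C (s • z)) (s • z) := fun s hs =>
    ((hCd s hs).differentiableAt one_ne_zero).hasFDerivAt
  have hj : ∀ s ∈ Icc (0 : ℝ) 1, ParamIntegral.JointContDiffAt ℝ ((0 : ℕ) + 1 : ℕ)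
      (fun (s : ℝ) z => omegaL (gen (C (s • z)) (s • z)) z) s z := fun s hs => by
    refine ⟨id, fun w => omegaL (gen (C (w.1 • w.2)) (w.1 • w.2)) w.2,
      Eventually.of_forall fun _ => continuousAt_id, ?_, Eventually.of_forall fun _ => rfl⟩
    have h1 : ContDiffAt ℝ 1 (fun w : ℝ × Phase ke kh kf => C (w.1 • w.2)) (id s, z) :=
      ContDiffAt.comp (id s, z) (f := fun w : ℝ × Phase ke kh kf => w.1 • w.2) (g := C)
        (hCd s hs) (by fun_prop)
    have h2 : ContDiffAt ℝ 1 (fun w : ℝ × Phase ke kh kf => w.1 • w.2) (id s, z) := by fun_prop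
    have h3 := (gen.contDiff.contDiffAt.comp (id s, z) h1).clm_apply h2
    simpa using (omegaL.contDiff.contDiffAt.comp (id s, z) h3).clm_apply contDiffAt_snd
  have hμ : ∀ᵐ s ∂(volume.restrict (Ioc (0 : ℝ) 1)), s ∈ Icc (0 : ℝ) 1 :=
    (ae_restrict_mem measurableSet_Ioc).mono fun s hs => Ioc_subset_Icc_self hs
  have hint : Integrable (fun s : ℝ => fderiv ℝ (fun z => omegaL (gen (C (s • z)) (s • z)) z) z)
      (volume.restrict (Ioc (0 : ℝ) 1)) :=
    ParamIntegral.integrable_of_continuousAt isCompact_Icc hμ fun s hs =>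
      ContinuousAt.comp (x := s) (f := fun s => (s, z)) (hj s hs).fderiv.1.continuousAt
        (by fun_prop)
  have hmain := ParamIntegral.hasFDerivAt_integral (𝔸 := ℝ) isCompact_Icc hμ hj
  simp only [← intervalIntegral.integral_of_le (zero_le_one (α := ℝ))] at hmain
  convert! hmain using 1
  refine ContinuousLinearMap.ext fun v => ?_
  rw [intervalIntegral.integral_of_le zero_le_one, ContinuousLinearMap.integral_apply hint,
    ← intervalIntegral.integral_of_le zero_le_one]
  -- the derivative of the integrand in the direction `v` is an exact derivative in `s`
  have hder : ∀ s ∈ uIcc (0 : ℝ) 1, HasDerivAt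
      (fun s : ℝ => s * omegaL (gen (C (s • z)) (s • z)) v)
      (fderiv ℝ (fun z => omegaL (gen (C (s • z)) (s • z)) z) z v) s := fun s hs => by
    rw [uIcc_of_le zero_le_one] at hs
    have e1 : fderiv ℝ (fun z => omegaL (gen (C (s • z)) (s • z)) z) z v =
        omegaL (gen (C (s • z)) (s • z)) v +
          omegaL (gen (C (s • z)) (s • v) + gen (fderiv ℝ C (s • z) (s • v)) (s • z)) z := by
      have f1 : HasFDerivAt (fun z : Phase ke kh kf => s • z)
          (s • ContinuousLinearMap.id ℝ (Phase ke kh kf)) z := (hasFDerivAt_id z).const_smul s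
      have f2 : HasFDerivAt (fun z => C (s • z)) ((fderiv ℝ C (s • z)).comp
          (s • ContinuousLinearMap.id ℝ (Phase ke kh kf))) z := (hCf s hs).comp z f1
      have f3 := (gen.hasFDerivAt.comp z f2).clm_apply f1
      have f4 := (omegaL.hasFDerivAt.comp z f3).clm_apply (hasFDerivAt_id z)
      exact congrArg (fun L => L v) f4.fderiv
    have e2 : HasDerivAt (fun s : ℝ => s * omegaL (gen (C (s • z)) (s • z)) v)
        (1 * omegaL (gen (C (s • z)) (s • z)) v + s * omegaL
          (gen (fderiv ℝ C (s • z) z) (s • z) + gen (C (s • z)) z) v) s := by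
      have f1 : HasDerivAt (fun s : ℝ => s • z) z s := by
        simpa using (hasDerivAt_id s).smul_const z
      have f2 : HasDerivAt (fun s : ℝ => C (s • z)) (fderiv ℝ C (s • z) z) s :=
        (hCf s hs).comp_hasDerivAt s f1
      have f3 : HasDerivAt (fun s : ℝ => gen (C (s • z)) (s • z))
          (gen (fderiv ℝ C (s • z) z) (s • z) + gen (C (s • z)) z) s :=
        (gen.hasFDerivAt.comp_hasDerivAt s f2).clm_apply f1
      exact (hasDerivAt_id s).mul ((omegaL.flip v).hasFDerivAt.comp_hasDerivAt s f3)
    convert! e2 using 1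
    rw [e1]
    have e3 := hcl (s • z) (smul_mem_ball hz hs) v z
    have e4 := omegaL_gen_symm (C (s • z)) v z
    simp only [map_smul, add_apply, smul_apply, smul_eq_mul, map_add, mul_add] at e3 ⊢
    simp [e3, e4]
    ring
  have hii : IntervalIntegrable (fun s : ℝ =>
      fderiv ℝ (fun z => omegaL (gen (C (s • z)) (s • z)) z) z v) volume 0 1 := by
    rw [intervalIntegrable_iff_integrableOn_Ioc_of_le zero_le_one]
    exact hint.apply_continuousLinearMap v
  rw [intervalIntegral.integral_eq_sub_of_hasDerivAt hder hii]
  simp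

section Action

variable {d : ℕ} {G : Type*} [Group G] [TopologicalSpace G]
  [ChartedSpace (EuclideanSpace ℝ (Fin d)) G] {r : ℕ∞ω} [LieGroup (𝓡 d) r G]
  {ρ : G → Phase ke kh kf → Phase ke kh kf} {U : Set (Phase ke kh kf)} {K δ : ℝ}

namespace HasExponents

lemma ball_subset (h : HasExponents d r ρ U K δ) {a b : ℝ} (hb : 0 < b) (hab : b ≤ a) :
    Metric.ball (0 : Phase ke kh kf) (δ / (a * K)) ⊆ Metric.ball 0 (δ / b) :=
  Metric.ball_subset_ball (div_le_div_of_nonneg_left h.pos.le hb (by nlinarith [h.one_le]))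

lemma ball_subset' (h : HasExponents d r ρ U K δ) :
    Metric.ball (0 : Phase ke kh kf) (δ / 6) ⊆ Metric.ball 0 δ :=
  Metric.ball_subset_ball (by linarith [h.pos])

lemma linearPart_mem_ball (h : HasExponents d r ρ U K δ) (g : G) {z : Phase ke kh kf}
    (hz : z ∈ Metric.ball 0 (δ / (6 * K))) : linearPart (ρ g) z ∈ Metric.ball 0 δ := by
  have h1 := h.norm_linearPart_le g z
  have h2 := mul_nonneg (zero_le_one.trans h.one_le) (norm_nonneg z)
  exact h.mem_ball_of_norm_le (by norm_num) hz (by linarith) le_rfl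

lemma abs_coef_le (h : HasExponents d r ρ U K δ) (g : G) {z : Phase ke kh kf}
    (hz : z ∈ Metric.ball 0 δ) (i : Idx ke kh kf) : |coef (unip ρ g) z i| ≤ 1 := by
  linarith [(h.exponent g).small z hz i]

lemma contDiffOn_coef (h : HasExponents d r ρ U K δ) (g : G) :
    ContDiffOn ℝ r (coef (unip ρ g)) (Metric.ball 0 δ) := fun z hz => by
  have : IsManifold (𝓡 d) r G := inferInstance
  have h1 := JointAt.comp_symm g (mem_extChartAt_target g) (x := z) (r := r)
    (F := fun q : G × Phase ke kh kf => coef (unip ρ q.1) q.2) (by simpa using h.jointAt g z hz)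
  have h2 := ContDiffAt.comp z (f := fun z => (extChartAt (𝓡 d) g g, z)) h1 (by fun_prop)
  simp only [Function.comp_def, extChartAt_to_inv] at h2
  exact h2.contDiffWithinAt

/-- The path `R_t` in terms of the exponents; at `t = 0` both sides are the identity. -/
lemma pathMap_eq (h : HasExponents d r ρ U K δ) (g : G) {s : ℝ} {w : Phase ke kh kf}
    (hw : s • w ∈ Metric.ball 0 δ) : pathMap ρ g s w = flow (coef (unip ρ g) (s • w)) w := by
  by_cases hs : s = 0
  · subst hs
    simp only [pathMap, contraction, if_true, zero_smul, (h.exponent g).map_zero h.pos, flow_zero]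
    exact h.isLocalAction.linearPart_apply_inv h.ne_zero g w
  · simp only [pathMap, contraction, if_neg hs, map_smul]
    have h1 := (h.exponent g).eq_flow _ hw
    rw [unip] at h1
    rw [h1, map_smul, smul_smul, inv_mul_cancel₀ hs, one_smul]

/-- The inverse of `ρ(g)⁽¹⁾ ∘ ρ(g)⁻¹` is the flow by the opposite exponents. -/
lemma apply_linearPart_inv (h : HasExponents d r ρ U K δ) (g : G) {x : Phase ke kh kf}
    (hx : x ∈ Metric.ball 0 (δ / (6 * K))) :
    ρ g (linearPart (ρ g⁻¹) x) = flow (-coef (unip ρ g) x) x := by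
  have hloc := h.isLocalAction
  have hx6 := h.ball_subset (by norm_num) le_rfl hx
  have hc : ∀ i, |(-coef (unip ρ g) x) i| ≤ 1 := fun i => by
    rw [Pi.neg_apply, abs_neg]; exact h.abs_coef_le g (h.ball_subset' hx6) i
  have hw := flow_mem_ball hc hx6
  have h1 := (h.exponent g).eq_flow _ hw
  rw [(h.exponent g).map_flow h.pos hc hx6, flow_flow_neg, unip] at h1
  have h2 : linearPart (ρ g⁻¹) x = ρ g⁻¹ (flow (-coef (unip ρ g) x) x) := by
    nth_rw 1 [← h1]
    exact hloc.linearPart_inv_apply h.ne_zero g _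
  have h3 : linearPart (ρ g⁻¹) x ∈ Metric.ball 0 δ := by
    exact h.linearPart_mem_ball g⁻¹ hx
  rw [h2]
  exact hloc.apply_inv g (h.subset hw) (h.subset (h2 ▸ h3))

lemma pathInv_eq (h : HasExponents d r ρ U K δ) (g : G) {t : ℝ} {z : Phase ke kh kf}
    (hz : t • z ∈ Metric.ball 0 (δ / (6 * K))) :
    pathInv ρ g t z = flow (-coef (unip ρ g) (t • z)) z := by
  by_cases ht : t = 0
  · subst ht
    simp only [pathInv, contraction, if_true, zero_smul, (h.exponent g).map_zero h.pos, neg_zero,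
      flow_zero]
    exact h.isLocalAction.linearPart_apply_inv h.ne_zero g z
  · simp only [pathInv, contraction, if_neg ht, ← map_smul]
    rw [h.apply_linearPart_inv g hz, ← map_smul, smul_smul, inv_mul_cancel₀ ht, one_smul]

lemma pathMap_pathInv (h : HasExponents d r ρ U K δ) (g : G) {s t : ℝ} {z : Phase ke kh kf}
    (hs : s • z ∈ Metric.ball 0 (δ / 6)) (ht : t • z ∈ Metric.ball 0 (δ / (6 * K))) :
    pathMap ρ g s (pathInv ρ g t z) =
      flow (coef (unip ρ g) (s • z) - coef (unip ρ g) (t • z)) z := by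
  have hc : ∀ i, |(-coef (unip ρ g) (t • z)) i| ≤ 1 := fun i => by
    rw [Pi.neg_apply, abs_neg]
    exact h.abs_coef_le g (h.ball_subset' (h.ball_subset (by norm_num) le_rfl ht)) i
  have h1 : s • flow (-coef (unip ρ g) (t • z)) z = flow (-coef (unip ρ g) (t • z)) (s • z) :=
    (map_smul _ _ _).symm
  rw [h.pathInv_eq g ht, h.pathMap_eq g (by rw [h1]; exact flow_mem_ball hc hs), h1,
    (h.exponent g).map_flow h.pos hc hs, ← flow_add, ← sub_eq_add_neg]

lemma hasDerivAt_pathMap (h : HasExponents d r ρ U K δ) (g : G) {t : ℝ} {z : Phase ke kh kf}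
    (ht : t • z ∈ Metric.ball 0 (δ / (6 * K))) :
    HasDerivAt (fun s => pathMap ρ g s (pathInv ρ g t z))
      (gen (fderiv ℝ (coef (unip ρ g)) (t • z) z) z) t := by
  have ht6 := h.ball_subset (by norm_num) le_rfl ht
  have hev : ∀ᶠ s : ℝ in 𝓝 t, s • z ∈ Metric.ball (0 : Phase ke kh kf) (δ / 6) :=
    (by fun_prop : ContinuousAt (fun s : ℝ => s • z) t).eventually
      (Metric.isOpen_ball.mem_nhds ht6)
  have h1 : HasDerivAt (fun s : ℝ => coef (unip ρ g) (s • z) - coef (unip ρ g) (t • z))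
      (fderiv ℝ (coef (unip ρ g)) (t • z) z) t := by
    have f1 : HasDerivAt (fun s : ℝ => s • z) z t := by
      simpa using (hasDerivAt_id t).smul_const z
    exact (((h.exponent g).hasFDerivAt (h.ball_subset' ht6)).comp_hasDerivAt t f1).sub_const _
  have h2 := (hasFDerivAt_flow_comp h1.hasFDerivAt (hasFDerivAt_const z t)).hasDerivAt
  simp only [sub_self, flow_zero] at h2
  have h3 : HasDerivAt (fun s : ℝ => flow (coef (unip ρ g) (s • z) - coef (unip ρ g) (t • z)) z)
      (gen (fderiv ℝ (coef (unip ρ g)) (t • z) z) z) t := by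
    convert! h2 using 1
    simp
  refine h3.congr_of_eventuallyEq ?_
  filter_upwards [hev] with s hs
  exact h.pathMap_pathInv g hs ht

/-- The field `X_t` is the derivative in `t` of `gen (coef (unip ρ g) (t • z)) z`. -/
lemma integral_pathField (h : HasExponents d r ρ U K δ) (g : G) {z : Phase ke kh kf}
    (hz : z ∈ Metric.ball 0 (δ / (6 * K))) :
    ContinuousOn (fun t => pathField ρ g t z) (Icc 0 1) ∧
      ∫ t in (0 : ℝ)..1, pathField ρ g t z = gen (coef (unip ρ g) z) z := by
  have hmem : ∀ t ∈ Icc (0 : ℝ) 1, t • z ∈ Metric.ball 0 (δ / (6 * K)) := fun t ht =>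
    smul_mem_ball hz ht
  have hmem' : ∀ t ∈ Icc (0 : ℝ) 1, t • z ∈ Metric.ball 0 δ := fun t ht =>
    h.ball_subset' (h.ball_subset (by norm_num) le_rfl (hmem t ht))
  have heq : ∀ t ∈ Icc (0 : ℝ) 1,
      pathField ρ g t z = gen (fderiv ℝ (coef (unip ρ g)) (t • z) z) z := fun t ht =>
    (h.hasDerivAt_pathMap g (hmem t ht)).deriv
  have hcont : ContinuousOn (fun t => pathField ρ g t z) (Icc 0 1) := by
    refine ContinuousOn.congr ?_ heq
    have h1 : ContinuousOn (fderiv ℝ (coef (unip ρ g))) (Metric.ball 0 δ) :=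
      (h.contDiffOn_coef g).continuousOn_fderiv_of_isOpen Metric.isOpen_ball
        (ENat.one_le_iff_ne_zero_withTop.2 h.ne_zero)
    have h2 : ContinuousOn (fun t : ℝ => fderiv ℝ (coef (unip ρ g)) (t • z)) (Icc 0 1) :=
      h1.comp (by fun_prop) hmem'
    exact (gen.flip z).continuous.comp_continuousOn (h2.clm_apply continuousOn_const)
  refine ⟨hcont, ?_⟩
  have hder : ∀ t ∈ uIcc (0 : ℝ) 1, HasDerivAt (fun t : ℝ => gen (coef (unip ρ g) (t • z)) z)
      (pathField ρ g t z) t := fun t ht => by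
    rw [uIcc_of_le zero_le_one] at ht
    rw [heq t ht]
    have f1 : HasDerivAt (fun s : ℝ => s • z) z t := by
      simpa using (hasDerivAt_id t).smul_const z
    have f2 : HasDerivAt (fun t : ℝ => coef (unip ρ g) (t • z))
        (fderiv ℝ (coef (unip ρ g)) (t • z) z) t := by
      have f3 := (h.exponent g).hasFDerivAt (hmem' t ht)
      exact f3.comp_hasDerivAt t f1
    exact (gen.flip z).hasFDerivAt.comp_hasDerivAt t f2
  rw [intervalIntegral.integral_eq_sub_of_hasDerivAt hder
    (ContinuousOn.intervalIntegrable (by rwa [uIcc_of_le zero_le_one]))]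
  simp [(h.exponent g).map_zero h.pos]

lemma hasFDerivAt_potential (h : HasExponents d r ρ U K δ) (g : G) {z : Phase ke kh kf}
    (hz : z ∈ Metric.ball 0 δ) : HasFDerivAt (potential (coef (unip ρ g)))
      (omegaL (gen (coef (unip ρ g) z) z)) z :=
  LinearSystem.hasFDerivAt_potential
    ((h.contDiffOn_coef g).of_le (ENat.one_le_iff_ne_zero_withTop.2 h.ne_zero))
    (fun _ hz => (h.exponent g).isClosedAt hz) hz

lemma jointAt_potential (h : HasExponents d r ρ U K δ) (hr : r = ∞ ∨ r = ω) (g : G)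
    {z : Phase ke kh kf} (hz : z ∈ Metric.ball 0 δ) :
    JointAt d r (fun q : G × Phase ke kh kf => potential (coef (unip ρ q.1)) q.2) (g, z) := by
  have : IsManifold (𝓡 d) r G := inferInstance
  rw [jointAt_iff_chart]
  refine contDiffAt_intervalIntegral hr (X := EuclideanSpace ℝ (Fin d) × Phase ke kh kf)
    (F := fun s q => omegaL (gen (coef (unip ρ ((extChartAt (𝓡 d) g).symm q.1)) (s • q.2))
      (s • q.2)) q.2) fun s hs => ?_
  have h0 := JointAt.comp_symm g (mem_extChartAt_target g) (x := s • z) (r := r)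
    (F := fun q : G × Phase ke kh kf => coef (unip ρ q.1) q.2)
    (by simpa using h.jointAt g _ (smul_mem_ball hz hs))
  have h1 : ContDiffAt ℝ r (fun w : ℝ × (EuclideanSpace ℝ (Fin d) × Phase ke kh kf) =>
      coef (unip ρ ((extChartAt (𝓡 d) g).symm w.2.1)) (w.1 • w.2.2))
      (s, (extChartAt (𝓡 d) g g, z)) :=
    ContDiffAt.comp (s, (extChartAt (𝓡 d) g g, z))
      (f := fun w : ℝ × (EuclideanSpace ℝ (Fin d) × Phase ke kh kf) => (w.2.1, w.1 • w.2.2)) h0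
      (by fun_prop)
  have h2 : ContDiffAt ℝ r (fun w : ℝ × (EuclideanSpace ℝ (Fin d) × Phase ke kh kf) =>
      w.1 • w.2.2) (s, (extChartAt (𝓡 d) g g, z)) := by fun_prop
  have h3 := (gen.contDiff.contDiffAt.comp _ h1).clm_apply h2
  exact (omegaL.contDiff.contDiffAt.comp _ h3).clm_apply (by fun_prop)

lemma isGeneratingFamily (h : HasExponents d r ρ U K δ) (hr : r = ∞ ∨ r = ω) :
    IsGeneratingFamily (d := d) r ρ U (Metric.ball 0 (δ / (6 * K)))
      (fun g => potential (coef (unip ρ g))) := by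
  have hpos : 0 < δ / (6 * K) := div_pos h.pos (by linarith [h.one_le])
  have h6 := h.ball_subset (a := 6) (by norm_num) le_rfl
  have hδ : Metric.ball (0 : Phase ke kh kf) (δ / (6 * K)) ⊆ Metric.ball 0 δ :=
    h6.trans h.ball_subset'
  have hham : ∀ g, ∀ z ∈ Metric.ball (0 : Phase ke kh kf) (δ / (6 * K)),
      hamVF (potential (coef (unip ρ g))) z = gen (coef (unip ρ g) z) z := fun g z hz =>
    hamVF_eq_of_hasFDerivAt (h.hasFDerivAt_potential g (hδ hz))
  refine ⟨Metric.isOpen_ball, Metric.isConnected_ball hpos, Metric.mem_ball_self hpos,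
    hδ.trans h.subset, fun g t ht z hz => ⟨h.subset ?_, h.subset ?_⟩, fun g t ht z hz => ?_,
    fun g t ht z hz => ?_, fun g z hz => (h.integral_pathField g hz).1, fun q hq => ?_,
    fun g => potential_zero _, fun g z hz => ?_, fun g z hz => ?_⟩
  · rw [← map_smul]
    exact h.linearPart_mem_ball g⁻¹ (smul_mem_ball hz ht)
  · have htz := smul_mem_ball hz ht
    rw [h.pathInv_eq g htz, ← map_smul]
    refine flow_mem_ball (fun i => ?_) (h6 htz)
    rw [Pi.neg_apply, abs_neg]
    exact h.abs_coef_le g (hδ htz) i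
  · have htz := smul_mem_ball hz ht
    rw [h.pathMap_pathInv g (h6 htz) htz, sub_self, flow_zero]
  · exact (h.hasDerivAt_pathMap g (smul_mem_ball hz ht)).differentiableAt
  · exact (h.jointAt_potential hr q.1 (hδ hq.2)).contMDiffWithinAt
  · rw [hham g z hz, (h.integral_pathField g hz).2]
  · rw [hham g z hz, fderiv_momentMap_gen]

end HasExponents

/-- The integral curves of `z ↦ gen (C z) z` are orbits of the linear flows, as `C` is constant
along them. -/
lemma isTimeOneMap_flow {X : Phase ke kh kf → Phase ke kh kf}
    {C : Phase ke kh kf → Idx ke kh kf → ℝ} {η : ℝ} {V : Set (Phase ke kh kf)}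
    (hV : V ⊆ Metric.ball 0 (η / 6))
    (hX : ∀ z ∈ Metric.ball 0 η, X z = gen (C z) z)
    (hC : ∀ z ∈ V, ∀ i, |C z i| ≤ 1)
    (hinv : ∀ z ∈ V, ∀ c : Idx ke kh kf → ℝ, (∀ i, |c i| ≤ 1) → C (flow c z) = C z)
    {Φ : Phase ke kh kf → Phase ke kh kf} (hΦ : ∀ z ∈ V, Φ z = flow (C z) z) :
    IsTimeOneMap X (Metric.ball 0 η) V Φ := by
  intro z hz
  have hmem : ∀ t ∈ Icc (0 : ℝ) 1, flow (t • C z) z ∈ Metric.ball 0 η := fun t ht =>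
    flow_mem_ball (abs_smul_le (hC z hz) ht) (hV hz)
  refine ⟨fun t => flow (t • C z) z, by simp [flow_zero], by simp [hΦ z hz], hmem,
    fun t ht => ?_⟩
  change HasDerivWithinAt _ (X (flow (t • C z) z)) _ _
  rw [hX _ (hmem t ht), hinv z hz _ (abs_smul_le (hC z hz) ht)]
  exact (hasDerivAt_flow (C z) z t).hasDerivWithinAt

end Action

/-! ### Linearization of a single local action -/

section Action

variable {d : ℕ} {G : Type*} [Group G] [TopologicalSpace G]
  [ChartedSpace (EuclideanSpace ℝ (Fin d)) G] {r : ℕ∞ω} [LieGroup (𝓡 d) r G] [CompactSpace G]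
  [T2Space G] [MeasurableSpace G] [BorelSpace G]
  {ρ : G → Phase ke kh kf → Phase ke kh kf} {U : Set (Phase ke kh kf)} {K δ : ℝ}

namespace HasExponents

variable {μ : Measure G}

lemma averagedField_potential [IsFiniteMeasure μ] (h : HasExponents d r ρ U K δ)
    {z : Phase ke kh kf} (hz : z ∈ Metric.ball 0 δ) :
    averagedField μ (fun g => potential (coef (unip ρ g))) z = gen (averagedCoef μ ρ z) z := by
  have h1 : ∀ g, hamVF (potential (coef (unip ρ g))) z = gen (coef (unip ρ g) z) z := fun g =>
    hamVF_eq_of_hasFDerivAt (h.hasFDerivAt_potential g hz)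
  simp only [averagedField, h1]
  exact (gen.flip z).integral_comp_comm (h.integrable_coef hz)

lemma hamVF_integral_potential [IsFiniteMeasure μ] [SecondCountableTopology G]
    (h : HasExponents d r ρ U K δ) (hr : r = ∞ ∨ r = ω) {z : Phase ke kh kf}
    (hz : z ∈ Metric.ball 0 δ) :
    hamVF (fun w => ∫ g, potential (coef (unip ρ g)) w ∂μ) z = gen (averagedCoef μ ρ z) z := by
  have : IsManifold (𝓡 d) r G := inferInstance
  have hr1 : ((1 : ℕ) : ℕ∞ω) ≤ r := by
    simpa using ENat.one_le_iff_ne_zero_withTop.2 h.ne_zero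
  have h1 := ParamIntegral.hasFDerivAt_integral (μ := μ) (𝔸 := EuclideanSpace ℝ (Fin d))
    isCompact_univ (by simp) (F := fun g w => potential (coef (unip ρ g)) w) (x₀ := z) fun g _ =>
      ((h.jointAt_potential hr g hz).jointContDiffAt).of_le hr1
  refine hamVF_eq_of_hasFDerivAt ?_
  convert! h1 using 1
  simp only [(h.hasFDerivAt_potential _ hz).fderiv]
  exact ((omegaL.comp (gen.flip z)).integral_comp_comm (h.integrable_coef hz)).symm

end HasExponents

/-- Linearization of a local action by the time-one map of the averaged generating field. -/
theorem IsLocalAction.exists_linearization (hr : r = ∞ ∨ r = ω) (μ : Measure G)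
    [μ.IsMulLeftInvariant] [IsProbabilityMeasure μ] (hρ : IsLocalAction (d := d) r ρ U) :
    ∃ (V V' : Set (Phase ke kh kf)) (Ψ : G → Phase ke kh kf → ℝ)
        (Φ : Phase ke kh kf → Phase ke kh kf),
        IsGeneratingFamily (d := d) r ρ U V Ψ ∧ V' ⊆ V ∧
        (∀ g, IsTimeOneMap (hamVF (Ψ g)) V V' (fun z => linearPart (ρ g) (ρ g⁻¹ z))) ∧
        (∀ z ∈ V, averagedField μ Ψ z = hamVF (fun w => ∫ g, Ψ g w ∂μ) z) ∧
        IsTimeOneMap (averagedField μ Ψ) V V' Φ ∧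
        IsSystemAutomorphism r Φ V' ∧
        IsLinearSystemAction ρ ∧
        ∀ g, ∀ z ∈ V', ρ g z ∈ V' ∧ Φ (ρ g z) = linearPart (ρ g) (Φ z) := by
  have hr0 : r ≠ 0 := by rcases hr with rfl | rfl <;> simp
  have : IsTopologicalGroup G := topologicalGroup_of_lieGroup (𝓡 d) r
  have : SecondCountableTopology G :=
    ChartedSpace.secondCountable_of_sigmaCompact (EuclideanSpace ℝ (Fin d)) G
  have hfam := hρ.isLocalActionFamily
  have h01 : (0 : EuclideanSpace ℝ (Fin 0)) ∈ Metric.ball 0 1 := Metric.mem_ball_self one_pos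
  obtain ⟨K, δ, hδ, hexp⟩ := hfam.exists_hasExponents hr h01
  have h : HasExponents d r ρ U K δ := (hexp 0 (Metric.mem_ball_self hδ)).2.1
  have hpos : 0 < δ / (36 * K) := div_pos h.pos (by linarith [h.one_le])
  have h36 : Metric.ball (0 : Phase ke kh kf) (δ / (36 * K)) =
      Metric.ball 0 (δ / (6 * K) / 6) := by
    rw [div_div]
    congr 2
    ring
  have h6 : Metric.ball (0 : Phase ke kh kf) (δ / (6 * K)) ⊆ Metric.ball 0 (δ / 6) :=
    h.ball_subset (by norm_num) le_rfl
  have h366 : Metric.ball (0 : Phase ke kh kf) (δ / (36 * K)) ⊆ Metric.ball 0 (δ / 6) :=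
    h.ball_subset (by norm_num) (by norm_num)
  have hsub : Metric.ball (0 : Phase ke kh kf) (δ / (6 * K)) ⊆ Metric.ball 0 δ :=
    h6.trans h.ball_subset'
  set W₀ : Set (EuclideanSpace ℝ (Fin 0) × Phase ke kh kf) :=
    {q | q.2 ∈ Metric.ball 0 (δ / (36 * K))} with hW₀
  have hW₀o : IsOpen W₀ := Metric.isOpen_ball.preimage continuous_snd
  have hW₀W : W₀ ⊆ {q | q.2 ∈ U} := fun q hq => h.subset (h.ball_subset' (h366 hq))
  -- the points whose orbits stay in a small ball
  set V' : Set (Phase ke kh kf) :=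
    {z | ((0 : EuclideanSpace ℝ (Fin 0)), z) ∈ {q | q ∈ W₀ ∧ ∀ g, (q.1, ρ g q.2) ∈ W₀}} with hV'
  have hV'o : IsOpen V' := (hfam.isOpen_orbits hW₀o hW₀W).preimage (by fun_prop)
  have hV'36 : V' ⊆ Metric.ball 0 (δ / (36 * K)) := fun z hz => hz.1
  have hV'δ : V' ⊆ Metric.ball 0 δ := fun z hz => h.ball_subset' (h366 (hV'36 hz))
  have hac : ∀ z ∈ V', ∀ i, |averagedCoef μ ρ z i| ≤ 1 := fun z hz i => by
    linarith [h.abs_averagedCoef_le (μ := μ) (hV'δ hz) i]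
  refine ⟨Metric.ball 0 (δ / (6 * K)), V', fun g => potential (coef (unip ρ g)),
    fun z => flow (averagedCoef μ ρ z) z, h.isGeneratingFamily hr, ?_, fun g => ?_,
    fun z hz => ?_, ?_, ?_, hρ.isLinearSystemAction hr0, fun g z hz => ⟨?_, ?_⟩⟩
  · refine fun z hz => Metric.ball_subset_ball ?_ (hV'36 hz)
    exact div_le_div_of_nonneg_left h.pos.le (by linarith [h.one_le]) (by linarith [h.one_le])
  · exact isTimeOneMap_flow (h36 ▸ hV'36)
      (fun z hz => hamVF_eq_of_hasFDerivAt (h.hasFDerivAt_potential g (hsub hz)))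
      (fun z hz => h.abs_coef_le g (hV'δ hz))
      (fun z hz c hc => (h.exponent g).map_flow h.pos hc (h366 (hV'36 hz)))
      fun z hz => (h.exponent g).eq_flow z (hV'δ hz)
  · rw [h.averagedField_potential (hsub hz), h.hamVF_integral_potential hr (hsub hz)]
  · exact isTimeOneMap_flow (h36 ▸ hV'36) (fun z hz => h.averagedField_potential (hsub hz)) hac
      (fun z hz c hc => h.averagedCoef_flow hc (h366 (hV'36 hz))) fun z _ => rfl
  · exact isSystemAutomorphism_averaged hr hV'o
      (hfam.zero_mem_orbits h01 (Metric.mem_ball_self hpos)) fun z hz => ⟨K, δ, h, hV'36 hz⟩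
  · exact hfam.mem_orbits hW₀W hz g
  · exact h.flow_averagedCoef_apply g (hV'36 hz) (hz.2 g)

end Action

end LinearSystem

theorem mainTheorem5 (ke kh kf d : ℕ) (r : ℕ∞ω) (hr : r = ∞ ∨ r = ω)
    {G : Type*} [Group G] [TopologicalSpace G] [ChartedSpace (EuclideanSpace ℝ (Fin d)) G]
    [LieGroup (𝓡 d) r G] [T2Space G] [CompactSpace G] [MeasurableSpace G] [BorelSpace G] :
    (∀ (μ : Measure G) [μ.IsHaarMeasure] [IsProbabilityMeasure μ]
        (ρ : G → Phase ke kh kf → Phase ke kh kf) (U : Set (Phase ke kh kf)),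
      IsLocalAction (d := d) r ρ U →
      ∃ (V V' : Set (Phase ke kh kf)) (Ψ : G → Phase ke kh kf → ℝ)
        (Φ : Phase ke kh kf → Phase ke kh kf),
        IsGeneratingFamily (d := d) r ρ U V Ψ ∧ V' ⊆ V ∧
        (∀ g, IsTimeOneMap (hamVF (Ψ g)) V V' (fun z => linearPart (ρ g) (ρ g⁻¹ z))) ∧
        (∀ z ∈ V, averagedField μ Ψ z = hamVF (fun w => ∫ g, Ψ g w ∂μ) z) ∧
        IsTimeOneMap (averagedField μ Ψ) V V' Φ ∧
        IsSystemAutomorphism r Φ V' ∧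
        IsLinearSystemAction ρ ∧
        ∀ g, ∀ z ∈ V', ρ g z ∈ V' ∧ Φ (ρ g z) = linearPart (ρ g) (Φ z)) ∧
    (∀ (m : ℕ) (ε : ℝ) (ρ : EuclideanSpace ℝ (Fin m) → G → Phase ke kh kf → Phase ke kh kf)
        (W : Set (EuclideanSpace ℝ (Fin m) × Phase ke kh kf)),
      0 < ε → IsLocalActionFamily (d := d) r ρ ε W →
      ∃ (W' : Set (EuclideanSpace ℝ (Fin m) × Phase ke kh kf))
        (Φ : EuclideanSpace ℝ (Fin m) → Phase ke kh kf → Phase ke kh kf),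
        IsOpen W' ∧ W' ⊆ W ∧
        ContDiffOn ℝ r (fun q : EuclideanSpace ℝ (Fin m) × Phase ke kh kf => Φ q.1 q.2) W' ∧
        IsLinearSystemAction (ρ 0) ∧
        ∀ p ∈ Metric.ball (0 : EuclideanSpace ℝ (Fin m)) ε,
          IsSystemAutomorphism r (Φ p) {z | (p, z) ∈ W'} ∧
          ∀ g z, (p, z) ∈ W' →
            (p, ρ p g z) ∈ W' ∧ Φ p (ρ p g z) = linearPart (ρ 0 g) (Φ p z)) := by
  refine ⟨fun μ _ _ ρ U hρ => hρ.exists_linearization hr μ, fun m ε ρ W hε hρ =>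
    IsLocalActionFamily.exists_linearization hr hε hρ⟩
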